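/- **Setting.** Let $T^2=\mathbb R^2/\mathbb Z^2$. A *drilled ananas* is a $3$-manifold $N$ homeomorphic to $T^2\times[0,\infty)\setminus\{x\}$, where $x\in T^2\times\{0\}$, endowed with a complete hyperbolic metric such that: for some $y>0$ the end $T^2\times[y,\infty)$ is isometric to a horocusp (the quotient of a closed horoball in $\mathbb H^3$ by a discrete group $G\cong\mathbb Z^2$ of parabolic isometries), whose cross-sections $T^2\times\{y'\}$ are horotori; and $\partial N=T^2\times\{0\}\setminus\{x\}$ is made up of two totally geodesic ideal triangles with vertices at $x$, glued by isometries along their edges to form a standard two-triangle triangulation of the once-punctured torus (shearing and bending along the edges are allowed). A *geometric ideal tetrahedron* is the convex hull in $\mathbb H^3$ of four non-coplanar ideal points. A *geometric ideal triangulation* of $N$ is a decomposition of $N$ into finitely many geometric ideal tetrahedra meeting face to face. A *geometric $2$–$3$ move* $\mathcal T\to\mathcal T'$ between geometric ideal triangulations replaces two distinct tetrahedra of $\mathcal T$ glued along a face $F$ by three tetrahedra with the same union that share an edge dual to $F$, and leaves all other tetrahedra unchanged. The *cusp cellulation* of a geometric ideal triangulation is the cell decomposition that it induces on a sufficiently small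 horotorus in the cusp of $N$. The *Farey complex* $\mathcal F$ has vertex set $\mathbb Q\cup\{\infty\}$ (the slopes of arcs on $T^2$ based at a marked point), with $\tfrac ab$ and $\tfrac cd$ (in lowest terms, $\infty=\tfrac10$) joined by an edge when $|ad-bc|=1$, and with a triangle for each triple of pairwise adjacent slopes. Its *dual graph* $\mathcal F^*$ has the triangles of $\mathcal F$ as vertices, two distinct triangles being adjacent when they share an edge. **Proposition 3.7.** Let $N$ be a drilled ananas with a geometric ideal triangulation $\mathcal T_0$ consisting of two tetrahedra, all of whose dihedral angles are acute. Then there are a set $V$ of geometric ideal triangulations of $N$ with $\mathcal T_0\in V$, and a graph $G$ with vertex set $V$, such that: 1. $G$ is an infinite trivalent tree; 2. for every edge of $G$ joining $\mathcal T$ to $\mathcal T'$, where $\mathcal T'$ is farther than $\mathcal T$ from $\mathcal T_0$ in $G$, the triangulation $\mathcal T'$ is obtained from $\mathcal T$ by a geometric $2$–$3$ move; 3. there is a bijection $\Phi$ from $V$ to the set of triangles of $\mathcal F$ that is an isomorphism of graphs $G\cong\mathcal F^*$, and it is natural: for every $\mathcal T\in V$ the cusp cellulation of $\mathcal T$ is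 a one-vertex triangulation of the cusp torus, and the slopes of its edges are exactly the three vertices of the Farey triangle $\Phi(\mathcal T)$. -/

import Mathlib

open Set Topology

noncomputable section

namespace Ananas

/-! ## Hyperbolic 3-space -/

/-- Hyperbolic 3-space, in the upper half-space model `{(z, t) : z ∈ ℂ, t > 0}`. -/
@[ext] structure H3 where
  z : ℂ
  t : ℝ
  t_pos : 0 < t

namespace H3

/-- The hyperbolic distance of the upper half-space model:
`sinh (d / 2) = |p - q| / (2 √(t(p) t(q)))`, with `|p - q|` the Euclidean distance. -/
instance : Dist H3 :=
  ⟨fun p q => 2 * Real.arsinh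
    (√(‖p.z - q.z‖ ^ 2 + (p.t - q.t) ^ 2) / (2 * √(p.t * q.t)))⟩

/-- Points of the upper half-plane, used to compare distances. -/
def toUHP (r : ℝ) (p : H3) : UpperHalfPlane := UpperHalfPlane.mk ⟨r, p.t⟩ p.t_pos

theorem dist_toUHP (r r' : ℝ) (p q : H3) :
    dist (toUHP r p) (toUHP r' q) = 2 * Real.arsinh
      (√((r - r') ^ 2 + (p.t - q.t) ^ 2) / (2 * √(p.t * q.t))) := by
  rw [UpperHalfPlane.dist_eq, Complex.dist_eq_re_im]
  rfl

theorem dist_def (p q : H3) : dist p q = 2 * Real.arsinh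
    (√(‖p.z - q.z‖ ^ 2 + (p.t - q.t) ^ 2) / (2 * √(p.t * q.t))) := rfl

/-- The hyperbolic metric on the upper half-space. -/
instance : MetricSpace H3 where
  dist_self p := by simp [dist_def]
  dist_comm p q := by
    rw [dist_def, dist_def, norm_sub_rev, mul_comm p.t q.t]
    congr 5
    ring
  dist_triangle p q r := by
    have h1 : dist p q = dist (toUHP 0 p) (toUHP ‖p.z - q.z‖ q) := by
      rw [dist_toUHP, dist_def]; simp
    have h2 : dist q r
        = dist (toUHP ‖p.z - q.z‖ q) (toUHP (‖p.z - q.z‖ + ‖q.z - r.z‖) r) := by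
      rw [dist_toUHP, dist_def]; simp
    have h3 : dist p r
        ≤ dist (toUHP 0 p) (toUHP (‖p.z - q.z‖ + ‖q.z - r.z‖) r) := by
      rw [dist_toUHP, dist_def]
      have h4 : ‖p.z - r.z‖ ≤ ‖p.z - q.z‖ + ‖q.z - r.z‖ := norm_sub_le_norm_sub_add_norm_sub _ _ _
      have h5 : ‖p.z - r.z‖ ^ 2 ≤ (0 - (‖p.z - q.z‖ + ‖q.z - r.z‖)) ^ 2 := by
        rw [zero_sub, neg_sq]
        exact pow_le_pow_left₀ (norm_nonneg _) h4 2
      have h6 : (0 : ℝ) ≤ 2 * √(p.t * r.t) := by positivity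
      have h7 := Real.sqrt_le_sqrt (add_le_add_left h5 ((p.t - r.t) ^ 2))
      have h8 := Real.arsinh_le_arsinh.2 (div_le_div_of_nonneg_right h7 h6)
      linarith
    rw [h1, h2]
    exact h3.trans (dist_triangle _ _ _)
  eq_of_dist_eq_zero {p q} h := by
    rw [dist_def] at h
    have hpos : 0 < 2 * √(p.t * q.t) := by
      have := Real.sqrt_pos.2 (mul_pos p.t_pos q.t_pos)
      linarith
    have h1 : √(‖p.z - q.z‖ ^ 2 + (p.t - q.t) ^ 2) / (2 * √(p.t * q.t)) = 0 := by
      have : Real.arsinh (√(‖p.z - q.z‖ ^ 2 + (p.t - q.t) ^ 2) / (2 * √(p.t * q.t))) = 0 := by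
        linarith
      exact Real.arsinh_eq_zero_iff.1 this
    rw [div_eq_zero_iff, or_iff_left hpos.ne', Real.sqrt_eq_zero (by positivity)] at h1
    have h2 : ‖p.z - q.z‖ ^ 2 = 0 := by nlinarith [sq_nonneg ‖p.z - q.z‖, sq_nonneg (p.t - q.t)]
    have h3 : (p.t - q.t) ^ 2 = 0 := by nlinarith [sq_nonneg ‖p.z - q.z‖, sq_nonneg (p.t - q.t)]
    ext1
    · exact sub_eq_zero.1 (norm_eq_zero.1 (pow_eq_zero_iff two_ne_zero |>.1 h2))
    · exact sub_eq_zero.1 (pow_eq_zero_iff two_ne_zero |>.1 h3)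

/-- The parabolic isometry `(z, t) ↦ (z + c, t)` fixing the ideal point `∞`. -/
def translate (c : ℂ) (p : H3) : H3 := ⟨p.z + c, p.t, p.t_pos⟩

end H3

/-! ## Ideal points, ideal convex hulls, dihedral angles

The sphere at infinity `∂ℍ³` is `OnePoint ℂ = ℂ ∪ {∞}`.  Convex hulls are taken in the
projective (Klein / hyperboloid) model: on `ℂ × ℝ × ℝ` consider the Lorentzian quadratic form
`Q (z, A, B) = A B - |z|²`.  The point `(z, t)` of the upper half-space spans the same ray as
`(z, |z|² + t², 1)`, on which `Q = t² > 0`; the ideal point `v ∈ ℂ` is the light ray of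
`(v, |v|², 1)`, and `∞` is the light ray of `(0, 1, 0)`.  Geodesics and totally geodesic planes
are the intersections of `{Q > 0}` with linear subspaces. -/

instance {X : Type*} : DecidableEq (OnePoint X) := Classical.decEq _

/-- The vector representing a point of hyperbolic space in the projective model. -/
def H3.vec (p : H3) : ℂ × ℝ × ℝ := (p.z, ‖p.z‖ ^ 2 + p.t ^ 2, 1)

/-- The light-like vector representing an ideal point in the projective model. -/
def nullVec : OnePoint ℂ → ℂ × ℝ × ℝ
  | none => (0, 1, 0)
  | some v => (v, ‖v‖ ^ 2, 1)

/-- The convex hull in `ℍ³` of a finite set of ideal points. -/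
def idealHull (s : Finset (OnePoint ℂ)) : Set H3 :=
  {p | ∃ c : OnePoint ℂ → ℝ, (∀ v ∈ s, 0 ≤ c v) ∧ ∑ v ∈ s, c v • nullVec v = p.vec}

/-- The relative interior of the convex hull of a finite set of ideal points: an open ideal
simplex when the points are in general position (a geodesic line for two points). -/
def openIdealHull (s : Finset (OnePoint ℂ)) : Set H3 :=
  {p | ∃ c : OnePoint ℂ → ℝ, (∀ v ∈ s, 0 < c v) ∧ ∑ v ∈ s, c v • nullVec v = p.vec}

/-- `s` is the vertex set of a geometric ideal tetrahedron: four ideal points that do not lie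
on the boundary of a common totally geodesic plane. -/
def IsTetVertexSet (s : Finset (OnePoint ℂ)) : Prop :=
  s.card = 4 ∧ LinearIndependent ℝ (fun v : s => nullVec v)

/-- Homogeneous coordinates on `OnePoint ℂ = ℂℙ¹`. -/
def homog : OnePoint ℂ → ℂ × ℂ
  | none => (1, 0)
  | some v => (v, 1)

/-- The determinant of the homogeneous coordinates of two ideal points; it is `v - w` for
`v, w ∈ ℂ`. -/
def bracket (v w : OnePoint ℂ) : ℂ := (homog v).1 * (homog w).2 - (homog w).1 * (homog v).2

/-- The cross-ratio `(c - b) (d - a) / ((c - a) (d - b))`, equal to `c / d` for `a = ∞`,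
`b = 0`. -/
def crossRatio (a b c d : OnePoint ℂ) : ℂ :=
  bracket c b * bracket d a / (bracket c a * bracket d b)

/-- The dihedral angle, along the edge `ab`, of the ideal tetrahedron `abcd` with distinct
vertices: moving `a` to `∞` and `b` to `0` by a Möbius transformation, it is the angle at `0`
between the directions of `c` and `d`. -/
def dihedralAngle (a b c d : OnePoint ℂ) : ℝ := |(crossRatio a b c d).arg|

/-! ## The topological model of a drilled ananas -/

/-- The universal cover `ℝ² × [0, ∞) ∖ (ℤ² × {0})` of `T² × [0, ∞) ∖ {x}`, where
`T² = ℝ² / ℤ²` and `x ∈ T² × {0}` is the image of the lattice `ℤ²`. -/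
abbrev Cover : Type :=
  {p : (ℝ × ℝ) × ℝ // 0 ≤ p.2 ∧ ¬ (p.2 = 0 ∧ ∃ m n : ℤ, p.1 = ((m : ℝ), (n : ℝ)))}

/-- The coordinate in `[0, ∞)`. -/
def height (p : Cover) : ℝ := p.1.2

/-- The coordinate in `ℝ²`. -/
def plane (p : Cover) : ℝ × ℝ := p.1.1

/-- The action of `ℤ² = π₁(T²)` on the universal cover by deck transformations. -/
def deck (m : ℤ × ℤ) (p : Cover) : Cover :=
  ⟨((p.1.1.1 + m.1, p.1.1.2 + m.2), p.1.2), p.2.1, fun h => p.2.2 ⟨h.1, by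
    obtain ⟨-, k, l, h⟩ := h
    have h1 := congrArg Prod.fst h
    have h2 := congrArg Prod.snd h
    simp only at h1 h2
    refine ⟨k - m.1, l - m.2, Prod.ext ?_ ?_⟩
    · push_cast; linarith
    · push_cast; linarith⟩⟩

/-- Lattice vertices of the two triangles of the standard one-vertex triangulation of
`T² = ℝ² / ℤ²`, whose edges have slopes `0/1`, `1/0` and `1/1`. -/
def stdTriangle (k : Fin 2) : Fin 3 → ℝ × ℝ :=
  if k = 0 then ![(0, 0), (1, 0), (1, 1)] else ![(0, 0), (0, 1), (1, 1)]

/-- The open face of the triangle `stdTriangle k`, placed at height `0`, spanned by the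
vertices with index in `S`.  (A single vertex is a lattice point and contributes nothing.) -/
def bdryFace (k : Fin 2) (S : Finset (Fin 3)) : Set Cover :=
  {p | height p = 0 ∧ ∃ w : Fin 3 → ℝ, (∀ i ∈ S, 0 < w i) ∧ (∀ i ∉ S, w i = 0) ∧
    ∑ i, w i = 1 ∧ ∑ i, w i • stdTriangle k i = plane p}

/-- The closed triangle `stdTriangle k` minus its vertices, placed at height `0`. -/
def bdryTriangle (k : Fin 2) : Set Cover := ⋃ S : Finset (Fin 3), bdryFace k S

/-! ## Drilled ananas -/

/-- A drilled ananas: a complete hyperbolic structure on `N = T² × [0, ∞) ∖ {x}`, given by its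
developing map on the universal cover `Cover` of `N` together with its holonomy, such that an end
`T² × [y, ∞)` is a horocusp (by horotori `T² × {y'}`) and `∂N` is made up of two totally geodesic
ideal triangles.

The developing map, which is defined up to an isometry of `ℍ³`, is normalized so that the horocusp
develops to a horoball about `∞`; the holonomy, being a discrete group `≅ ℤ²` of
parabolics fixing `∞`, then acts by translations.  The homeomorphism from `N` to
`T² × [0, ∞) ∖ {x}` is chosen so that the triangulation of `∂N` is the straight one with edges
of slopes `0/1`, `1/0`, `1/1`. -/
structure DrilledAnanas where
  /-- the developing map -/
  dev : Cover → H3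
  /-- the holonomy: the deck transformation `m` acts on `ℍ³` as translation by `period m` -/
  period : ℤ × ℤ →+ ℂ
  dev_deck : ∀ m p, dev (deck m p) = (dev p).translate (period m)
  /-- the developing map pulls back the geometry of `ℍ³`: it is a local homeomorphism in the
  interior, and is continuous and locally injective up to the boundary -/
  dev_continuous : Continuous dev
  dev_interior : IsLocalHomeomorphOn dev {p | 0 < height p}
  dev_locallyInjective : ∀ p, ∃ U ∈ 𝓝 p, InjOn dev U
  /-- the path metric pulled back by the developing map is complete: every half-open path of
  finite hyperbolic length converges -/
  complete : ∀ γ : ℝ → Cover, ContinuousOn γ (Ico 0 1) →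
    eVariationOn (fun u => dev (γ u)) (Ico 0 1) ≠ ⊤ → ∃ p, Filter.Tendsto γ (𝓝[<] 1) (𝓝 p)
  /-- the periods generate a lattice -/
  period_indep : LinearIndependent ℝ ![period (1, 0), period (0, 1)]
  /-- some end `T² × [y, ∞)` is isometric to a horocusp, its cross-sections being horotori -/
  cusp : ∃ y > 0, InjOn dev {p | y ≤ height p} ∧
    (∃ c > 0, dev '' {p | y ≤ height p} = {q | c ≤ q.t}) ∧
    ∀ y' ≥ y, ∃ c, dev '' {p | height p = y'} = {q | q.t = c}
  /-- each of the two triangles of `∂N` develops homeomorphically to a totally geodesic ideal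
  triangle, with sides going to sides -/
  boundary : ∀ k : Fin 2, ∃ v : Fin 3 → OnePoint ℂ, Function.Injective v ∧
    IsEmbedding (fun p : bdryTriangle k => dev p) ∧
    ∀ S : Finset (Fin 3), dev '' bdryFace k S = openIdealHull (S.image v)

namespace DrilledAnanas

variable (N : DrilledAnanas)

/-- `σ` is a lift to the universal cover of a geometric ideal tetrahedron in `N`, developing to the
ideal tetrahedron of `ℍ³` with vertex set `s`: the image of a continuous section of the
developing map over that tetrahedron. -/
def IsTet (σ : Set Cover) (s : Finset (OnePoint ℂ)) : Prop :=
  IsTetVertexSet s ∧ ∃ f : H3 → Cover, ContinuousOn f (idealHull s) ∧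
    (∀ x ∈ idealHull s, N.dev (f x) = x) ∧ f '' idealHull s = σ

/-- The open face of the lifted tetrahedron `σ` that is spanned by the ideal vertices in `r`. -/
def cell (σ : Set Cover) (r : Finset (OnePoint ℂ)) : Set Cover := σ ∩ N.dev ⁻¹' openIdealHull r

/-- A geometric ideal triangulation of `N`, recorded as its preimage in the universal cover. -/
@[ext] structure GeometricTriangulation where
  /-- the lifts of the tetrahedra -/
  tets : Set (Set Cover)
  isTet : ∀ σ ∈ tets, ∃ s, N.IsTet σ s
  invariant : ∀ σ ∈ tets, ∀ m, deck m '' σ ∈ tets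
  /-- there are finitely many tetrahedra in `N` -/
  finite : ∃ F : Set (Set Cover), F.Finite ∧ ∀ σ ∈ tets, ∃ τ ∈ F, ∃ m, σ = deck m '' τ
  locallyFinite : LocallyFinite (fun σ : tets => (σ : Set Cover))
  covers : ⋃₀ tets = univ
  /-- the tetrahedra meet face to face: two open cells (of any dimension) of the decomposition
  are equal or disjoint -/
  faceToFace : ∀ σ ∈ tets, ∀ σ' ∈ tets, ∀ s s', N.IsTet σ s → N.IsTet σ' s' →
    ∀ r ⊆ s, ∀ r' ⊆ s', N.cell σ r = N.cell σ' r' ∨ Disjoint (N.cell σ r) (N.cell σ' r')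

namespace GeometricTriangulation

variable {N} (𝒯 𝒯' : N.GeometricTriangulation)

/-- The triangulation of `N` consists of exactly two tetrahedra. -/
def HasTwoTetrahedra : Prop :=
  ∃ σ ∈ 𝒯.tets, ∃ τ ∈ 𝒯.tets, (∀ m, deck m '' σ ≠ τ) ∧
    ∀ κ ∈ 𝒯.tets, ∃ m, κ = deck m '' σ ∨ κ = deck m '' τ

/-- All dihedral angles of all tetrahedra are acute. -/
def IsAcute : Prop :=
  ∀ σ ∈ 𝒯.tets, ∀ a b c d, N.IsTet σ {a, b, c, d} → dihedralAngle a b c d < Real.pi / 2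

/-- `𝒯'` is the result of a geometric 2-3 move on `𝒯`: two distinct tetrahedra of `N`, with lifts
`abcp` and `abcq` glued along the face `abc`, are replaced by the three tetrahedra `pqab`,
`pqbc`, `pqca` that have the same union and share the edge `pq`; all other tetrahedra stay the
same. -/
def IsTwoThreeMove : Prop :=
  ∃ (a b c p q : OnePoint ℂ) (σ σ' τ₁ τ₂ τ₃ : Set Cover),
    σ ∈ 𝒯.tets ∧ σ' ∈ 𝒯.tets ∧ (∀ m, deck m '' σ ≠ σ') ∧
    N.IsTet σ {a, b, c, p} ∧ N.IsTet σ' {a, b, c, q} ∧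
    N.cell σ {a, b, c} = N.cell σ' {a, b, c} ∧
    N.IsTet τ₁ {p, q, a, b} ∧ N.IsTet τ₂ {p, q, b, c} ∧ N.IsTet τ₃ {p, q, c, a} ∧
    N.cell τ₁ {p, q} = N.cell τ₂ {p, q} ∧ N.cell τ₂ {p, q} = N.cell τ₃ {p, q} ∧
    τ₁ ∪ τ₂ ∪ τ₃ = σ ∪ σ' ∧
    𝒯'.tets = {κ ∈ 𝒯.tets | ∀ m, κ ≠ deck m '' σ ∧ κ ≠ deck m '' σ'} ∪
      {κ | ∃ m, κ = deck m '' τ₁ ∨ κ = deck m '' τ₂ ∨ κ = deck m '' τ₃}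

end GeometricTriangulation

end DrilledAnanas

/-! ## The Farey complex -/

/-- Numerator of a slope in `ℚℙ¹ = ℚ ∪ {∞}`, where `∞ = 1/0`. -/
def slopeNum : OnePoint ℚ → ℤ
  | none => 1
  | some r => r.num

/-- Denominator of a slope in `ℚℙ¹ = ℚ ∪ {∞}`, where `∞ = 1/0`. -/
def slopeDen : OnePoint ℚ → ℤ
  | none => 0
  | some r => r.den

/-- The 1-skeleton of the Farey complex: slopes `a/b` and `c/d` (in lowest terms) are joined by an
edge, i.e. the geodesic arcs of these slopes on the torus based at the marked point are disjoint
away from it, when `|a d - b c| = 1`. -/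
def fareyGraph : SimpleGraph (OnePoint ℚ) where
  Adj r s := |slopeNum r * slopeDen s - slopeDen r * slopeNum s| = 1
  symm := ⟨fun r s h => by
    rw [← h, ← abs_neg]
    congr 1
    ring⟩
  loopless := ⟨fun r h => by
    rw [mul_comm, sub_self] at h
    simp at h⟩

/-- The triangles of the Farey complex: triples of pairwise adjacent slopes. -/
abbrev FareyTriangle : Type := {t : Finset (OnePoint ℚ) // fareyGraph.IsNClique 3 t}

/-- The dual 1-skeleton of the Farey complex: two triangles are adjacent when they are distinct and
share an edge. -/
def fareyDual : SimpleGraph FareyTriangle where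
  Adj t t' := t ≠ t' ∧ (t.1 ∩ t'.1).card = 2
  symm := ⟨fun t t' h => ⟨h.1.symm, by rw [Finset.inter_comm]; exact h.2⟩⟩
  loopless := ⟨fun t h => h.1 rfl⟩

/-- The slope `m₂ / m₁` of a nonzero vector `m ∈ ℤ²`. -/
def slopeOf (m : ℤ × ℤ) : OnePoint ℚ :=
  if m.1 = 0 then OnePoint.infty else (((m.2 : ℚ) / (m.1 : ℚ) : ℚ) : OnePoint ℚ)

/-! ## Cusp cellulations -/

/-- A subset of the universal cover goes out the cusp: it enters every end `[h, ∞)`. -/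
def EntersCusp (e : Set Cover) : Prop := ∀ h : ℝ, ∃ p ∈ e, h ≤ height p

namespace DrilledAnanas.GeometricTriangulation

variable {N : DrilledAnanas} (𝒯 : N.GeometricTriangulation)

/-- The lifts of edges of the triangulation that go out the cusp; they cut the cusp torus in
the vertices of the cusp cellulation. -/
def cuspEdges : Set (Set Cover) :=
  {e | ∃ σ ∈ 𝒯.tets, ∃ s, N.IsTet σ s ∧ ∃ u ∈ s, ∃ v ∈ s, u ≠ v ∧ e = N.cell σ {u, v} ∧
    EntersCusp e}

/-- The slopes of the edges of the cusp cellulation.  Such an edge is the cross-section of a face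
`uvw` of a tetrahedron near an ideal vertex `u` at the cusp.  It joins the lifted vertices
given by the edges `uv` and `uw`; when these differ by the deck transformation `m`, it
is an arc on the torus with slope that of `m`. -/
def cuspSlopes : Set (OnePoint ℚ) :=
  {r | ∃ σ ∈ 𝒯.tets, ∃ s, N.IsTet σ s ∧ ∃ u ∈ s, ∃ v ∈ s, ∃ w ∈ s, u ≠ v ∧ u ≠ w ∧ v ≠ w ∧
    EntersCusp (N.cell σ {u, v}) ∧ EntersCusp (N.cell σ {u, w}) ∧
    ∃ m : ℤ × ℤ, m ≠ 0 ∧ deck m '' N.cell σ {u, v} = N.cell σ {u, w} ∧ r = slopeOf m}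

/-- The cusp cellulation of `𝒯` is the one-vertex triangulation of the torus corresponding to
the Farey triangle `t`: it has exactly one vertex, and the slopes of its edges are the
vertices of `t`. -/
def InducesCuspTriangulation (t : FareyTriangle) : Prop :=
  𝒯.cuspEdges.Nonempty ∧ (∀ e ∈ 𝒯.cuspEdges, ∀ e' ∈ 𝒯.cuspEdges, ∃ m, deck m '' e = e') ∧
    𝒯.cuspSlopes = (t.1 : Set (OnePoint ℚ))

end DrilledAnanas.GeometricTriangulation

end Ananas

end

/-!
The developing map sends the cusp to a horoball about `∞`, so the cusp cellulation of a triangulation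
is seen on high horospheres, that is, in the vertical projection to `ℂ`, as a tiling invariant under
the lattice of periods.  If there are only two tetrahedra, this tiling has at most two orbits of
triangles, and a periodic triangulation of the plane with so few triangles is the standard one: its
vertices form one orbit `o + per ℤ²`, and its edges have the directions `x`, `y`, `x - y` for a basis
`x, y` of `ℤ²` (`IsTiling.exists_basis`).  Hence both tetrahedra are cones from `∞`, and the
developing map is an embedding, since a point is determined by the vertical ray going up from it to
the cusp (`structure_of_two`).  From then on a triangulation is the same as a decomposition of the
image of the developing map into ideal tetrahedra of `ℍ³` (`IsEmbedded.triangulation`), and meeting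
face to face means that the barycentric coordinates of a point with respect to light-like vectors do
not depend on the tetrahedron in which they are taken (`IsDecomposition`).

Next consider a decomposition that consists of the cones over the standard triangulation for `x, y`
and of tetrahedra without the vertex `∞`.  The parallelogram law
`p + q = a + b + 2 ⟪x, y⟫ ∞` holds among the light-like vectors of the corners `p, a, q, b` of a
parallelogram with sides `x, y` and of `∞`.  If `⟪x, y⟫ > 0`, it says that the geodesic `pq` pierces
the triangle `∞ab` (`isCircuit_flipRel`).  Therefore the two cones over the parallelogram can be
replaced by the three tetrahedra around `pq`: this is a geometric 2-3 move, which flips the diagonal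
`ab` of the cusp triangulation to `pq` and cuts off the tetrahedron `abpq` from the cusp
(`IsDecomposition.flip`, `IsEmbedded.isTwoThreeMove`).

It remains to see that `⟪x, y⟫ > 0` for all the flips that lead away from the root in the dual tree
of the Farey complex. For `rootForm`, the quadratic form in which the three edges of the root
triangle have the same length, the total squared length `fareyHeight` of a Farey triangle increases
along a flip exactly if the form is positive on the sides `x, y` of the parallelogram
(`fareyHeight_lt_iff`); each triangle but the root has exactly one lower neighbour, which shows also
that the dual graph is a tree (`isTree_of_descent`). For a fixed basis `x, y`, the products `det x k
* det y k`, where `k` is in the root triangle, never have opposite signs (`not_opposite_signs`), and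
by Selling's formula (`selling`) the Euclidean inner product is a combination of them whose
coefficients are the inner products of the sides of the root triangle. Those are positive because
the root is acute, so positivity for `rootForm` implies Euclidean positivity
(`cdot_pos_of_rootForm_pos`). Recursion along the dual tree then gives a decomposition `fareyTets`
for each Farey triangle. It induces the corresponding cusp triangulation, and this makes the
correspondence between triangulations of `N` and Farey triangles injective.
-/

noncomputable section

namespace Ananas

/-! ### The topology of hyperbolic space -/

namespace H3

theorem dist_eq_dist_toUHP (p q : H3) :
    dist p q = dist (toUHP 0 p) (toUHP ‖p.z - q.z‖ q) := by
  rw [dist_toUHP, dist_def]; simp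

theorem tendsto_coords (p : H3) :
    Filter.Tendsto (fun q : H3 => (‖p.z - q.z‖, q.t)) (𝓝 p) (𝓝 (0, p.t)) := by
  have h : Filter.Tendsto (fun q : H3 => toUHP ‖p.z - q.z‖ q) (𝓝 p) (𝓝 (toUHP 0 p)) := by
    rw [tendsto_iff_dist_tendsto_zero]
    have : (fun q : H3 => dist (toUHP ‖p.z - q.z‖ q) (toUHP 0 p)) = fun q => dist q p := by
      ext q; rw [dist_comm, ← dist_eq_dist_toUHP, dist_comm]
    rw [this]
    exact tendsto_iff_dist_tendsto_zero.1 Filter.tendsto_id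
  have h2 := (UpperHalfPlane.continuous_re.tendsto _).comp h
  have h3 := (UpperHalfPlane.continuous_im.tendsto _).comp h
  exact h2.prodMk_nhds h3

theorem continuous_t : Continuous H3.t :=
  continuous_iff_continuousAt.2 fun p => (continuous_snd.tendsto _).comp (tendsto_coords p)

theorem continuous_z : Continuous H3.z := by
  refine continuous_iff_continuousAt.2 fun p => ?_
  rw [ContinuousAt, tendsto_iff_norm_sub_tendsto_zero]
  have := (continuous_fst.tendsto _).comp (tendsto_coords p)
  refine this.congr fun q => ?_
  exact norm_sub_rev _ _

theorem continuous_mk {X : Type*} [TopologicalSpace X] {f : X → ℂ} {g : X → ℝ}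
    (hf : Continuous f) (hg : Continuous g) (h0 : ∀ x, 0 < g x) :
    Continuous fun x => (⟨f x, g x, h0 x⟩ : H3) := by
  refine continuous_iff_continuousAt.2 fun x => ?_
  rw [ContinuousAt, tendsto_iff_dist_tendsto_zero]
  have h1 : Continuous fun y => 2 * Real.arsinh
      (√(‖f y - f x‖ ^ 2 + (g y - g x) ^ 2) / (2 * √(g y * g x))) := by
    refine continuous_const.mul (Real.continuous_arsinh.comp ?_)
    refine Continuous.div (by fun_prop) (by fun_prop) fun y => ?_
    have := Real.sqrt_pos.2 (mul_pos (h0 y) (h0 x))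
    positivity
  have h2 := h1.tendsto x
  have h3 : 2 * Real.arsinh (√(‖f x - f x‖ ^ 2 + (g x - g x) ^ 2) / (2 * √(g x * g x))) = 0 := by
    simp
  rw [h3] at h2
  exact h2

theorem continuous_vec : Continuous H3.vec := by
  unfold H3.vec
  have := continuous_t
  have := continuous_z
  fun_prop

end H3

/-! ### Barycentric coordinates in ideal convex hulls -/

theorem nullVec_infty : nullVec OnePoint.infty = (0, 1, 0) := rfl

theorem nullVec_coe (v : ℂ) : nullVec (v : OnePoint ℂ) = (v, ‖v‖ ^ 2, 1) := rfl

/-- The linear combination of light-like vectors with coefficients `c`. -/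
def comb : (OnePoint ℂ →₀ ℝ) →ₗ[ℝ] ℂ × ℝ × ℝ := Finsupp.linearCombination ℝ nullVec

/-- `c` is a family of (unnormalized) barycentric coordinates of the point `p` with respect to
the ideal points in `s`. -/
def IsRep (s : Finset (OnePoint ℂ)) (c : OnePoint ℂ →₀ ℝ) (p : H3) : Prop :=
  (∀ v, 0 ≤ c v) ∧ c.support ⊆ s ∧ comb c = p.vec

theorem IsRep.mono {s s' : Finset (OnePoint ℂ)} {c p} (h : IsRep s c p) (hs : c.support ⊆ s') :
    IsRep s' c p := ⟨h.1, hs, h.2.2⟩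

theorem comb_eq_sum {s : Finset (OnePoint ℂ)} {c : OnePoint ℂ →₀ ℝ} (h : c.support ⊆ s) :
    comb c = ∑ v ∈ s, c v • nullVec v :=
  (Finsupp.linearCombination_apply ℝ c).trans
    (Finsupp.sum_of_support_subset _ h _ (fun _ _ => zero_smul _ _))

@[simp] theorem comb_single (v : OnePoint ℂ) (x : ℝ) :
    comb (Finsupp.single v x) = x • nullVec v := by simp [comb]

theorem map_comb {s : Finset (OnePoint ℂ)} {c : OnePoint ℂ →₀ ℝ} (h : c.support ⊆ s)
    (φ : ℂ × ℝ × ℝ →ₗ[ℝ] ℝ) : φ (comb c) = ∑ v ∈ s, c v * φ (nullVec v) := by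
  rw [comb_eq_sum h, map_sum]; simp

theorem mem_idealHull {s : Finset (OnePoint ℂ)} {p : H3} :
    p ∈ idealHull s ↔ ∃ c, IsRep s c p := by
  constructor
  · rintro ⟨c, h0, h⟩
    refine ⟨Finsupp.indicator s fun v _ => c v, fun v => ?_, Finsupp.support_indicator_subset _ _,
      ?_⟩
    · rw [Finsupp.indicator_apply]; split_ifs with hv
      · exact h0 v hv
      · exact le_rfl
    · rw [comb_eq_sum (Finsupp.support_indicator_subset _ _), ← h]
      exact Finset.sum_congr rfl fun v hv => by rw [Finsupp.indicator_of_mem hv]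
  · rintro ⟨c, h0, hs, h⟩
    exact ⟨c, fun v _ => h0 v, by rw [← comb_eq_sum hs, h]⟩

theorem mem_openIdealHull {r : Finset (OnePoint ℂ)} {p : H3} :
    p ∈ openIdealHull r ↔ ∃ c, IsRep r c p ∧ c.support = r := by
  constructor
  · rintro ⟨c, h0, h⟩
    have hs : (Finsupp.indicator r fun v _ => c v).support = r := by
      refine (Finsupp.support_indicator_subset _ _).antisymm fun v hv => ?_
      rw [Finsupp.mem_support_iff, Finsupp.indicator_of_mem hv]
      exact (h0 v hv).ne'
    refine ⟨Finsupp.indicator r fun v _ => c v, ⟨fun v => ?_, hs.subset, ?_⟩, hs⟩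
    · rw [Finsupp.indicator_apply]; split_ifs with hv
      · exact (h0 v hv).le
      · exact le_rfl
    · rw [comb_eq_sum hs.subset, ← h]
      exact Finset.sum_congr rfl fun v hv => by rw [Finsupp.indicator_of_mem hv]
  · rintro ⟨c, ⟨h0, hs, h⟩, hr⟩
    refine ⟨c, fun v hv => (h0 v).lt_of_ne' ?_, by rw [← comb_eq_sum hs, h]⟩
    rwa [← Finsupp.mem_support_iff, hr]

theorem openIdealHull_subset {r s : Finset (OnePoint ℂ)} (h : r ⊆ s) :
    openIdealHull r ⊆ idealHull s := by
  intro p hp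
  obtain ⟨c, hc, hr⟩ := mem_openIdealHull.1 hp
  exact mem_idealHull.2 ⟨c, hc.mono (hr.subset.trans h)⟩

theorem IsRep.mem_openIdealHull {s : Finset (OnePoint ℂ)} {c p} (h : IsRep s c p) :
    p ∈ openIdealHull c.support :=
  Ananas.mem_openIdealHull.2 ⟨c, h.mono subset_rfl, rfl⟩

/-- Linear independence of the light-like vectors of `s`, in terms of finitely supported
coefficient families. -/
theorem linearIndependent_iff_comb {s : Finset (OnePoint ℂ)} :
    LinearIndependent ℝ (fun v : s => nullVec v) ↔
      ∀ c : OnePoint ℂ →₀ ℝ, c.support ⊆ s → comb c = 0 → c = 0 := by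
  have h := linearIndepOn_iff (R := ℝ) (v := nullVec) (s := (s : Set (OnePoint ℂ)))
  refine Iff.trans Iff.rfl (h.trans ?_)
  simp only [Finsupp.mem_supported, Finset.coe_subset]
  rfl

theorem IsTetVertexSet.rep_unique {s : Finset (OnePoint ℂ)} (hs : IsTetVertexSet s)
    {c c' : OnePoint ℂ →₀ ℝ} (h : c.support ⊆ s) (h' : c'.support ⊆ s)
    (he : comb c = comb c') : c = c' := by
  refine sub_eq_zero.1 (linearIndependent_iff_comb.1 hs.2 (c - c') ?_ ?_)
  · exact Finsupp.support_sub.trans (Finset.union_subset h h')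
  · rw [map_sub, he, sub_self]

theorem IsTetVertexSet.isClosed_idealHull {s : Finset (OnePoint ℂ)} (hs : IsTetVertexSet s) :
    IsClosed (idealHull s) := by
  let f : (s → ℝ) →ₗ[ℝ] ℂ × ℝ × ℝ := Fintype.linearCombination ℝ (fun v : s => nullVec v)
  have hf : IsClosedEmbedding f := LinearMap.isClosedEmbedding_of_injective
    (LinearMap.ker_eq_bot.2 (linearIndependent_iff_injective_fintypeLinearCombination.1 hs.2))
  have h1 : IsClosed (f '' Ici 0) := hf.isClosedMap _ isClosed_Ici
  convert h1.preimage H3.continuous_vec using 1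
  ext p
  constructor
  · rintro ⟨c, h0, h⟩
    refine ⟨fun v => c v, fun v => h0 v v.2, ?_⟩
    rw [← h, ← Finset.sum_coe_sort]
    simp [f, Fintype.linearCombination_apply]
  · rintro ⟨c, h0, h⟩
    refine ⟨fun v => if hv : v ∈ s then c ⟨v, hv⟩ else 0, fun v hv => ?_, ?_⟩
    · simpa [hv] using h0 ⟨v, hv⟩
    · rw [← h, ← Finset.sum_coe_sort]
      simp [f, Fintype.linearCombination_apply]

/-! ### Horospherical coordinates -/

/-- For `v ∈ ℂ`, twice the Lorentzian product with the light-like vector of `v`. -/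
def busCoe (w : ℂ) : ℂ × ℝ × ℝ →ₗ[ℝ] ℝ where
  toFun X := X.2.1 - 2 * (X.1.re * w.re + X.1.im * w.im) + X.2.2 * ‖w‖ ^ 2
  map_add' X Y := by simp; ring
  map_smul' a X := by simp; ring

/-- Twice the Lorentzian product with the light-like vector `nullVec v`.  On a point of
hyperbolic space at height `t` its value is `t` times the exponential of a Busemann function
of `v`. -/
def bus : OnePoint ℂ → (ℂ × ℝ × ℝ →ₗ[ℝ] ℝ)
  | none => LinearMap.snd ℝ ℝ ℝ ∘ₗ LinearMap.snd ℝ ℂ (ℝ × ℝ)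
  | some w => busCoe w

theorem bus_infty_apply (X : ℂ × ℝ × ℝ) : bus OnePoint.infty X = X.2.2 := rfl

theorem bus_coe_apply (w : ℂ) (X : ℂ × ℝ × ℝ) : bus (w : OnePoint ℂ) X
    = X.2.1 - 2 * (X.1.re * w.re + X.1.im * w.im) + X.2.2 * ‖w‖ ^ 2 := rfl

theorem norm_sq_eq (z : ℂ) : ‖z‖ ^ 2 = z.re ^ 2 + z.im ^ 2 := by
  rw [Complex.sq_norm, Complex.normSq_apply]; ring

@[simp] theorem bus_infty_infty : bus OnePoint.infty (nullVec OnePoint.infty) = 0 := rfl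
@[simp] theorem bus_infty_coe (v : ℂ) : bus OnePoint.infty (nullVec v) = 1 := rfl
@[simp] theorem bus_coe_infty (w : ℂ) : bus (w : OnePoint ℂ) (nullVec OnePoint.infty) = 1 := by
  simp [bus_coe_apply, nullVec_infty]
@[simp] theorem bus_coe_coe (w v : ℂ) : bus (w : OnePoint ℂ) (nullVec v) = ‖v - w‖ ^ 2 := by
  simp [bus_coe_apply, norm_sq_eq, nullVec_coe]; ring
theorem bus_infty_vec (p : H3) : bus OnePoint.infty p.vec = 1 := rfl
theorem bus_coe_vec (w : ℂ) (p : H3) : bus (w : OnePoint ℂ) p.vec = ‖p.z - w‖ ^ 2 + p.t ^ 2 := by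
  simp [bus_coe_apply, norm_sq_eq, H3.vec]; ring

theorem bus_self (v : OnePoint ℂ) : bus v (nullVec v) = 0 := by
  induction v using OnePoint.rec with
  | infty => rfl
  | coe v => simp [bus_coe_coe]

theorem bus_pos {v w : OnePoint ℂ} (h : v ≠ w) : 0 < bus v (nullVec w) := by
  induction v using OnePoint.rec with
  | infty =>
    induction w using OnePoint.rec with
    | infty => exact absurd rfl h
    | coe w => simp [bus_infty_coe]
  | coe v =>
    induction w using OnePoint.rec with
    | infty => simp [bus_coe_infty]
    | coe w =>
      rw [bus_coe_coe]
      have : w - v ≠ 0 := fun e => h (by rw [sub_eq_zero.1 e])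
      have := norm_pos_iff.2 this
      positivity

theorem bus_nonneg (v w : OnePoint ℂ) : 0 ≤ bus v (nullVec w) := by
  by_cases h : v = w
  · rw [h, bus_self]
  · exact (bus_pos h).le

/-- The Lorentzian quadratic form. -/
def lorentz (X : ℂ × ℝ × ℝ) : ℝ := X.2.1 * X.2.2 - ‖X.1‖ ^ 2

theorem lorentz_smul_nullVec_add (a : ℝ) (v : OnePoint ℂ) (Y : ℂ × ℝ × ℝ) :
    lorentz (a • nullVec v + Y) = lorentz Y + a * bus v Y := by
  induction v using OnePoint.rec with
  | infty => simp [lorentz, bus_infty_apply, nullVec_infty]; ring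
  | coe v => simp [lorentz, bus_coe_apply, norm_sq_eq, nullVec_coe]; ring

theorem lorentz_sum_nonneg (s : Finset (OnePoint ℂ)) : 0 ≤ lorentz (∑ v ∈ s, nullVec v) := by
  induction s using Finset.induction_on with
  | empty => simp [lorentz]
  | insert v s hv ih =>
    rw [Finset.sum_insert hv]
    have := lorentz_smul_nullVec_add 1 v (∑ v ∈ s, nullVec v)
    rw [one_smul] at this
    rw [this, map_sum, one_mul]
    exact add_nonneg ih (Finset.sum_nonneg fun w _ => bus_nonneg v w)

theorem exists_vec_eq {X : ℂ × ℝ × ℝ} (h : 0 < lorentz X) (hB : 0 < X.2.2) :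
    ∃ p : H3, p.vec = X.2.2⁻¹ • X ∧ p.t = √(lorentz X) / X.2.2 := by
  refine ⟨⟨X.2.2⁻¹ • X.1, √(lorentz X) / X.2.2, div_pos (Real.sqrt_pos.2 h) hB⟩, ?_, rfl⟩
  have hB' := hB.ne'
  refine Prod.ext rfl (Prod.ext ?_ (by simp [H3.vec, hB']))
  simp only [H3.vec, norm_smul, div_pow, Real.sq_sqrt h.le]
  simp only [lorentz, Prod.smul_fst, Prod.smul_snd, smul_eq_mul, mul_pow, norm_inv,
    Real.norm_eq_abs, inv_pow, sq_abs]
  field_simp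
  ring

/-- Away from its ideal vertices, an ideal convex hull does not enter small horoballs. -/
theorem exists_le_bus {s : Finset (OnePoint ℂ)} {v : OnePoint ℂ} (hv : v ∉ s) :
    ∃ δ > 0, ∀ p ∈ idealHull s, δ * p.t ≤ bus v p.vec := by
  -- The height is at most the linear functional `τ`, which is positive on light-like vectors.
  let τ : ℂ × ℝ × ℝ →ₗ[ℝ] ℝ := bus OnePoint.infty + bus ((0 : ℂ) : OnePoint ℂ)
  have hτ : ∀ w, 0 < τ (nullVec w) := fun w => by
    induction w using OnePoint.rec with
    | infty => simp [τ]
    | coe w => simp only [τ, LinearMap.add_apply, bus_infty_coe, bus_coe_coe]; positivity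
  have hδ : ∃ δ > 0, ∀ w ∈ s, δ * τ (nullVec w) ≤ bus v (nullVec w) := by
    clear_value τ
    induction s using Finset.induction_on with
    | empty => exact ⟨1, one_pos, by simp⟩
    | insert u s hu ih =>
      obtain ⟨δ, h0, h⟩ := ih fun h => hv (Finset.mem_insert_of_mem h)
      have hpos := bus_pos fun e : v = u => hv (e ▸ Finset.mem_insert_self v s)
      refine ⟨min δ (bus v (nullVec u) / τ (nullVec u)), lt_min h0 (div_pos hpos (hτ u)),
        fun w hw => ?_⟩
      rcases Finset.mem_insert.1 hw with rfl | hw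
      · calc _ ≤ bus v (nullVec w) / τ (nullVec w) * τ (nullVec w) :=
            mul_le_mul_of_nonneg_right (min_le_right _ _) (hτ w).le
          _ = _ := div_mul_cancel₀ _ (hτ w).ne'
      · exact (mul_le_mul_of_nonneg_right (min_le_left _ _) (hτ w).le).trans (h w hw)
  obtain ⟨δ, h0, h⟩ := hδ
  refine ⟨δ, h0, fun p hp => ?_⟩
  obtain ⟨c, hc⟩ := mem_idealHull.1 hp
  have h1 : p.t ≤ τ p.vec := by
    simp only [τ, LinearMap.add_apply, bus_infty_vec, bus_coe_vec]
    nlinarith [sq_nonneg (p.t - 1), sq_nonneg ‖p.z - 0‖, p.t_pos]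
  refine (mul_le_mul_of_nonneg_left h1 h0.le).trans ?_
  rw [← hc.2.2, map_comb hc.2.1, map_comb hc.2.1, Finset.mul_sum]
  refine Finset.sum_le_sum fun w hw => ?_
  have := mul_le_mul_of_nonneg_left (h w hw) (hc.1 w)
  linarith

/-- An open ideal simplex enters every horoball at each of its vertices. -/
theorem exists_bus_lt {r : Finset (OnePoint ℂ)} (hr : 2 ≤ r.card) {v : OnePoint ℂ} (hv : v ∈ r)
    {δ : ℝ} (hδ : 0 < δ) : ∃ p ∈ openIdealHull r, bus v p.vec < δ * p.t := by
  set W := ∑ w ∈ r.erase v, nullVec w with hW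
  have hne : (r.erase v).Nonempty := by
    rw [← Finset.card_pos, Finset.card_erase_of_mem hv]; omega
  have hK : 0 < bus v W := by
    rw [hW, map_sum]
    exact Finset.sum_pos (fun w hw => bus_pos (Finset.ne_of_mem_erase hw).symm) hne
  set K := bus v W
  set ε := δ ^ 2 / (4 * K) with hε
  have hε0 : 0 < ε := by positivity
  set X := (1 : ℝ) • nullVec v + ε • W with hX
  have hQ : ε * K ≤ lorentz X := by
    rw [hX, lorentz_smul_nullVec_add, map_smul, smul_eq_mul, one_mul, le_add_iff_nonneg_left]
    have : lorentz (ε • W) = ε ^ 2 * lorentz W := by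
      simp [lorentz, mul_pow]; ring
    rw [this]
    exact mul_nonneg (sq_nonneg ε) (lorentz_sum_nonneg _)
  have hQ0 : 0 < lorentz X := (mul_pos hε0 hK).trans_le hQ
  have hB : 0 < X.2.2 := by
    rw [← bus_infty_apply, hX, map_add, map_smul, map_smul, hW, map_sum, smul_eq_mul, smul_eq_mul]
    by_cases h : v = OnePoint.infty
    · subst h
      refine add_pos_of_nonneg_of_pos (by simp) (mul_pos hε0 ?_)
      rwa [← map_sum]
    · refine add_pos_of_pos_of_nonneg (mul_pos one_pos (bus_pos (Ne.symm h))) ?_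
      exact mul_nonneg hε0.le (Finset.sum_nonneg fun w _ => bus_nonneg _ w)
  obtain ⟨p, hp, ht⟩ := exists_vec_eq hQ0 hB
  refine ⟨p, ⟨fun w => X.2.2⁻¹ * if w = v then 1 else ε, fun w _ => ?_, ?_⟩, ?_⟩
  · have := inv_pos.2 hB
    beta_reduce
    split_ifs <;> positivity
  · rw [hp, hX, ← Finset.add_sum_erase r _ hv, smul_add, hW, Finset.smul_sum, Finset.smul_sum]
    congr 1
    · simp
    · refine Finset.sum_congr rfl fun w hw => ?_
      beta_reduce
      rw [if_neg (Finset.ne_of_mem_erase hw), smul_smul]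
  · rw [hp, ht, map_smul, hX, map_add, map_smul, map_smul, bus_self, ← hX, smul_zero, zero_add,
      smul_eq_mul, smul_eq_mul]
    have h1 : ε * K < δ * √(lorentz X) := by
      have h2 : √(ε * K) ≤ √(lorentz X) := Real.sqrt_le_sqrt hQ
      have h3 : √(ε * K) = δ / 2 := by
        have : ε * K = (δ / 2) ^ 2 := by rw [hε]; field_simp; ring
        rw [this, Real.sqrt_sq (by positivity)]
      have h4 : ε * K = (δ / 2) ^ 2 := by rw [hε]; field_simp; ring
      rw [h4]; rw [h3] at h2
      nlinarith
    have := (div_lt_div_iff_of_pos_right hB).2 h1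
    calc _ = ε * K / X.2.2 := by ring
      _ < _ := this
      _ = _ := by ring

theorem subset_of_openIdealHull_subset {r s : Finset (OnePoint ℂ)} (hr : 2 ≤ r.card)
    (h : openIdealHull r ⊆ idealHull s) : r ⊆ s := by
  intro v hv
  by_contra hvs
  obtain ⟨δ, h0, hδ⟩ := exists_le_bus hvs
  obtain ⟨p, hp, hlt⟩ := exists_bus_lt hr hv h0
  exact (hδ p (h hp)).not_gt hlt

theorem eq_of_openIdealHull_eq {r r' : Finset (OnePoint ℂ)} (hr : 2 ≤ r.card)
    (hr' : 2 ≤ r'.card) (h : openIdealHull r = openIdealHull r') : r = r' :=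
  (subset_of_openIdealHull_subset hr (h.subset.trans (openIdealHull_subset subset_rfl))).antisymm
    (subset_of_openIdealHull_subset hr' (h.symm.subset.trans (openIdealHull_subset subset_rfl)))

theorem eq_of_idealHull_eq {s s' : Finset (OnePoint ℂ)} (hs : 2 ≤ s.card)
    (hs' : 2 ≤ s'.card) (h : idealHull s = idealHull s') : s = s' :=
  (subset_of_openIdealHull_subset hs ((openIdealHull_subset subset_rfl).trans h.subset)).antisymm
    (subset_of_openIdealHull_subset hs' ((openIdealHull_subset subset_rfl).trans h.symm.subset))

/-- A point of hyperbolic space is not a combination of fewer than two ideal points. -/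
theorem IsRep.two_le_card {s : Finset (OnePoint ℂ)} {c p} (h : IsRep s c p) :
    2 ≤ c.support.card := by
  by_contra hc
  have h1 : c.support.card ≤ 1 := by omega
  have key : lorentz p.vec = p.t ^ 2 := by simp [lorentz, H3.vec]
  have hpos : 0 < lorentz p.vec := by rw [key]; exact pow_pos p.t_pos 2
  have h0 : lorentz p.vec = 0 := by
    obtain ⟨v, a, rfl⟩ := Finsupp.card_support_le_one'.1 h1
    rw [← h.2.2, comb_single]
    have := lorentz_smul_nullVec_add a v 0
    simpa [lorentz] using this
  exact hpos.ne' h0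

/-! ### Translations -/

/-- The action on ideal points of the translation by `a`. -/
def shift (a : ℂ) : OnePoint ℂ → OnePoint ℂ := OnePoint.map (· + a)

@[simp] theorem shift_infty (a : ℂ) : shift a OnePoint.infty = OnePoint.infty := rfl
@[simp] theorem shift_coe (a v : ℂ) : shift a v = ((v + a : ℂ) : OnePoint ℂ) := rfl

theorem shift_shift (a b : ℂ) (v : OnePoint ℂ) : shift a (shift b v) = shift (b + a) v := by
  induction v using OnePoint.rec with
  | infty => rfl
  | coe v => simp [add_assoc]

@[simp] theorem shift_zero (v : OnePoint ℂ) : shift 0 v = v := by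
  induction v using OnePoint.rec with
  | infty => rfl
  | coe v => simp

theorem shift_injective (a : ℂ) : Function.Injective (shift a) := fun v w h => by
  have := congrArg (shift (-a)) h
  simpa [shift_shift] using this

/-- The linear map of the projective model given by the translation by `a`. -/
def shiftLin (a : ℂ) : ℂ × ℝ × ℝ →ₗ[ℝ] ℂ × ℝ × ℝ where
  toFun X := (X.1 + X.2.2 • a, X.2.1 + 2 * (X.1.re * a.re + X.1.im * a.im) + X.2.2 * ‖a‖ ^ 2, X.2.2)
  map_add' X Y := by
    refine Prod.ext ?_ (Prod.ext ?_ rfl)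
    · simp; ring
    · simp; ring
  map_smul' r X := by
    refine Prod.ext ?_ (Prod.ext ?_ rfl)
    · simp; ring
    · simp; ring

theorem shiftLin_nullVec (a : ℂ) (v : OnePoint ℂ) :
    shiftLin a (nullVec v) = nullVec (shift a v) := by
  induction v using OnePoint.rec with
  | infty => simp [shiftLin, nullVec_infty]
  | coe v =>
    refine Prod.ext ?_ (Prod.ext ?_ rfl)
    · simp [shiftLin, nullVec_coe]
    · simp [shiftLin, norm_sq_eq, nullVec_coe]; ring

theorem shiftLin_vec (a : ℂ) (p : H3) : shiftLin a p.vec = (p.translate a).vec := by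
  refine Prod.ext ?_ (Prod.ext ?_ rfl)
  · simp [shiftLin, H3.vec, H3.translate]
  · simp [shiftLin, norm_sq_eq, H3.vec, H3.translate]; ring

@[simp] theorem translate_translate (a b : ℂ) (p : H3) :
    (p.translate a).translate b = p.translate (a + b) := by
  simp [H3.translate, add_assoc]

@[simp] theorem translate_zero (p : H3) : p.translate 0 = p := by simp [H3.translate]

theorem continuous_translate (a : ℂ) : Continuous fun p : H3 => p.translate a :=
  H3.continuous_mk (by have := H3.continuous_z; fun_prop) H3.continuous_t fun p => p.t_pos

/-- The translate by `a` of a set of ideal points. -/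
def shiftSet (a : ℂ) (s : Finset (OnePoint ℂ)) : Finset (OnePoint ℂ) := s.image (shift a)

theorem shiftSet_shiftSet (a b : ℂ) (s) : shiftSet a (shiftSet b s) = shiftSet (b + a) s := by
  rw [shiftSet, shiftSet, Finset.image_image]
  exact Finset.image_congr fun v _ => shift_shift a b v

@[simp] theorem shiftSet_zero (s) : shiftSet 0 s = s := by
  simp [shiftSet, funext shift_zero]

@[simp] theorem card_shiftSet (a s) : (shiftSet a s).card = s.card :=
  Finset.card_image_of_injective _ (shift_injective a)

theorem shiftLin_comb (a : ℂ) (c : OnePoint ℂ →₀ ℝ) :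
    shiftLin a (comb c) = comb (c.mapDomain (shift a)) := by
  rw [comb, Finsupp.linearCombination_mapDomain, ← LinearMap.comp_apply]
  congr 1
  ext v : 2
  simp [shiftLin_nullVec]

theorem IsRep.shift {s c p} (h : IsRep s c p) (a : ℂ) :
    IsRep (shiftSet a s) (c.mapDomain (shift a)) (p.translate a) := by
  refine ⟨fun v => ?_, ?_, ?_⟩
  · by_cases hv : v ∈ Set.range (Ananas.shift a)
    · obtain ⟨w, rfl⟩ := hv
      rw [Finsupp.mapDomain_apply (shift_injective a)]
      exact h.1 w
    · rw [Finsupp.mapDomain_of_notMem_range _ _ hv]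
  · exact Finsupp.mapDomain_support.trans (Finset.image_subset_image h.2.1)
  · rw [← shiftLin_comb, h.2.2, shiftLin_vec]

theorem translate_mem_idealHull {a : ℂ} {s p} :
    H3.translate a p ∈ idealHull (shiftSet a s) ↔ p ∈ idealHull s := by
  simp only [mem_idealHull]
  constructor
  · rintro ⟨c, hc⟩
    have := hc.shift (-a)
    rw [shiftSet_shiftSet, translate_translate, add_neg_cancel, shiftSet_zero,
      translate_zero] at this
    exact ⟨_, this⟩
  · rintro ⟨c, hc⟩
    exact ⟨_, hc.shift a⟩

theorem isTetVertexSet_shiftSet {s} (h : IsTetVertexSet s) (a : ℂ) :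
    IsTetVertexSet (shiftSet a s) := by
  refine ⟨by rw [card_shiftSet, h.1], linearIndependent_iff_comb.2 fun c hc h0 => ?_⟩
  have h1 : c.mapDomain (shift (-a)) = 0 := by
    refine linearIndependent_iff_comb.1 h.2 _ ?_ ?_
    · refine Finsupp.mapDomain_support.trans ((Finset.image_subset_image hc).trans ?_)
      have : shiftSet (-a) (shiftSet a s) = s := by rw [shiftSet_shiftSet]; simp
      exact this.subset
    · rw [← shiftLin_comb, h0, map_zero]
  exact Finsupp.mapDomain_injective (shift_injective _) (h1.trans Finsupp.mapDomain_zero.symm)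

/-! ### Hulls of ideal points, in the upper half-space -/

theorem IsRep.sum_busemann {s c p} (h : IsRep s c p) (v : OnePoint ℂ) :
    ∑ w ∈ s, c w * bus v (nullVec w) = bus v p.vec := by
  rw [← h.2.2, map_comb h.2.1]

/-- Raising a point by a coefficient at the ideal point `∞`. -/
theorem IsRep.raise {s c p} (h : IsRep s c p) (hs : OnePoint.infty ∈ s) {q : H3} (hz : q.z = p.z)
    (ht : p.t ≤ q.t) :
    IsRep s (c + Finsupp.single OnePoint.infty (q.t ^ 2 - p.t ^ 2)) q := by
  have h0 : 0 ≤ q.t ^ 2 - p.t ^ 2 := by nlinarith [p.t_pos]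
  refine ⟨fun v => ?_, ?_, ?_⟩
  · rw [Finsupp.add_apply]
    refine add_nonneg (h.1 v) ?_
    rw [Finsupp.single_apply]; split_ifs
    · exact h0
    · exact le_rfl
  · refine Finsupp.support_add.trans (Finset.union_subset h.2.1 ?_)
    exact Finsupp.support_single_subset.trans (Finset.singleton_subset_iff.2 hs)
  · rw [map_add, h.2.2, comb_single]
    simp [H3.vec, hz, nullVec_infty]

theorem mem_idealHull_of_le {s} {p q : H3} (hp : p ∈ idealHull s) (hs : OnePoint.infty ∈ s)
    (hz : q.z = p.z) (ht : p.t ≤ q.t) : q ∈ idealHull s := by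
  obtain ⟨c, hc⟩ := mem_idealHull.1 hp
  exact mem_idealHull.2 ⟨_, hc.raise hs hz ht⟩

theorem IsRep.norm_sub_le {s c p} (h : IsRep s c p) {w : ℂ} {D : ℝ}
    (hD : ∀ v : ℂ, (v : OnePoint ℂ) ∈ s → ‖v - w‖ ≤ D) : ‖p.z - w‖ ≤ D := by
  have h1 := h.sum_busemann OnePoint.infty
  have h2 : p.z - w = ∑ v ∈ s, c v • ((nullVec v).1 - bus OnePoint.infty (nullVec v) • w) := by
    have h3 := congrArg Prod.fst ((comb_eq_sum h.2.1).symm.trans h.2.2)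
    rw [Prod.fst_sum] at h3
    simp only [Prod.smul_fst] at h3
    simp only [smul_sub, Finset.sum_sub_distrib, smul_smul]
    rw [h3, ← Finset.sum_smul, h1, bus_infty_vec, one_smul]
    rfl
  calc ‖p.z - w‖ ≤ ∑ v ∈ s, ‖c v • ((nullVec v).1 - bus OnePoint.infty (nullVec v) • w)‖ := by
        rw [h2]; exact norm_sum_le _ _
    _ ≤ ∑ v ∈ s, c v * bus OnePoint.infty (nullVec v) * D := by
        refine Finset.sum_le_sum fun v hv => ?_
        rw [norm_smul, Real.norm_of_nonneg (h.1 v), mul_assoc]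
        refine mul_le_mul_of_nonneg_left ?_ (h.1 v)
        induction v using OnePoint.rec with
        | infty => simp [nullVec_infty, bus_infty_apply]
        | coe v => simpa [nullVec_coe, bus_infty_apply] using hD v hv
    _ = D := by rw [← Finset.sum_mul, h1, bus_infty_vec, one_mul]

theorem IsRep.sq_le {s c p} (h : IsRep s c p) (hs : OnePoint.infty ∉ s) {w : ℂ} {D : ℝ}
    (hD : ∀ v : ℂ, (v : OnePoint ℂ) ∈ s → ‖v - w‖ ≤ D) : p.t ^ 2 ≤ D ^ 2 := by
  have h1 := h.sum_busemann OnePoint.infty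
  have h2 := h.sum_busemann w
  rw [bus_coe_vec] at h2
  have h3 : ∑ v ∈ s, c v * bus w (nullVec v) ≤
      ∑ v ∈ s, c v * bus OnePoint.infty (nullVec v) * D ^ 2 := by
    refine Finset.sum_le_sum fun v hv => ?_
    rw [mul_assoc]
    refine mul_le_mul_of_nonneg_left ?_ (h.1 v)
    induction v using OnePoint.rec with
    | infty => exact absurd hv hs
    | coe v =>
      rw [bus_infty_coe, bus_coe_coe, one_mul]
      exact pow_le_pow_left₀ (norm_nonneg _) (hD v hv) 2
  rw [← Finset.sum_mul, h1, bus_infty_vec, one_mul, h2] at h3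
  nlinarith [sq_nonneg ‖p.z - w‖]

/-! ### Lattices -/

theorem exists_norm_le_mul_norm_period {per : ℤ × ℤ →+ ℂ}
    (hper : LinearIndependent ℝ ![per (1, 0), per (0, 1)]) :
    ∃ K : ℝ, ∀ m : ℤ × ℤ, |(m.1 : ℝ)| ≤ K * ‖per m‖ ∧ |(m.2 : ℝ)| ≤ K * ‖per m‖ := by
  let f : (Fin 2 → ℝ) →ₗ[ℝ] ℂ := Fintype.linearCombination ℝ ![per (1, 0), per (0, 1)]
  obtain ⟨K, -, hK⟩ := LinearMap.exists_antilipschitzWith f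
    (LinearMap.ker_eq_bot.2 (linearIndependent_iff_injective_fintypeLinearCombination.1 hper))
  refine ⟨K, fun m => ?_⟩
  have hf : f ![(m.1 : ℝ), (m.2 : ℝ)] = per m := by
    have : m = m.1 • ((1, 0) : ℤ × ℤ) + m.2 • ((0, 1) : ℤ × ℤ) := by ext <;> simp
    conv_rhs => rw [this, map_add, map_zsmul, map_zsmul]
    simp [f, Fintype.linearCombination_apply]
  have h := hK.le_mul_dist ![(m.1 : ℝ), (m.2 : ℝ)] 0
  rw [map_zero, hf, dist_zero_right, dist_zero_right] at h
  exact ⟨(norm_le_pi_norm ![(m.1 : ℝ), (m.2 : ℝ)] 0).trans h,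
    (norm_le_pi_norm ![(m.1 : ℝ), (m.2 : ℝ)] 1).trans h⟩

theorem finite_norm_period_le {per : ℤ × ℤ →+ ℂ}
    (hper : LinearIndependent ℝ ![per (1, 0), per (0, 1)]) (R : ℝ) :
    {m : ℤ × ℤ | ‖per m‖ ≤ R}.Finite := by
  obtain ⟨K, hK⟩ := exists_norm_le_mul_norm_period hper
  obtain ⟨n, hn⟩ := exists_nat_ge (|K| * |R|)
  refine (Set.finite_Icc ((-n, -n) : ℤ × ℤ) (n, n)).subset fun m hm => ?_
  have hm' : K * ‖per m‖ ≤ n := by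
    refine (le_abs_self _).trans (le_trans ?_ hn)
    rw [abs_mul, abs_norm]
    exact mul_le_mul_of_nonneg_left (le_trans hm (le_abs_self R)) (abs_nonneg K)
  have h1 := abs_le.1 ((hK m).1.trans hm')
  have h2 := abs_le.1 ((hK m).2.trans hm')
  have e1 : -(n : ℤ) ≤ m.1 := by exact_mod_cast h1.1
  have e2 : m.1 ≤ n := by exact_mod_cast h1.2
  have e3 : -(n : ℤ) ≤ m.2 := by exact_mod_cast h2.1
  have e4 : m.2 ≤ n := by exact_mod_cast h2.2
  exact ⟨⟨e1, e3⟩, ⟨e2, e4⟩⟩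

theorem period_injective {per : ℤ × ℤ →+ ℂ}
    (hper : LinearIndependent ℝ ![per (1, 0), per (0, 1)]) : Function.Injective per := by
  rw [injective_iff_map_eq_zero]
  intro m hm
  obtain ⟨K, hK⟩ := exists_norm_le_mul_norm_period hper
  have h := hK m
  rw [hm, norm_zero, mul_zero] at h
  ext
  · exact_mod_cast abs_nonpos_iff.1 h.1
  · exact_mod_cast abs_nonpos_iff.1 h.2

/-- The translates by a lattice of finitely many ideal hulls form a locally finite family. -/
theorem locallyFinite_idealHull {per : ℤ × ℤ →+ ℂ}
    (hper : LinearIndependent ℝ ![per (1, 0), per (0, 1)]) {𝒮 F : Set (Finset (OnePoint ℂ))}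
    (hF : F.Finite) (h : ∀ s ∈ 𝒮, ∃ s' ∈ F, ∃ m, s = shiftSet (per m) s') :
    LocallyFinite fun s : 𝒮 => idealHull (s : Finset (OnePoint ℂ)) := by
  obtain ⟨D, hD⟩ : ∃ D : ℝ, ∀ s ∈ F, ∀ v : ℂ, (v : OnePoint ℂ) ∈ s → ‖v‖ ≤ D := by
    have hfin : {v : ℂ | ∃ s ∈ F, (v : OnePoint ℂ) ∈ s}.Finite := by
      have : {v : ℂ | ∃ s ∈ F, (v : OnePoint ℂ) ∈ s} =
          ⋃ s ∈ F, (fun v : ℂ => (v : OnePoint ℂ)) ⁻¹' (s : Set (OnePoint ℂ)) := by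
        ext v; simp
      rw [this]
      exact hF.biUnion fun s _ => s.finite_toSet.preimage OnePoint.coe_injective.injOn
    obtain ⟨D, hD⟩ := (hfin.image norm).bddAbove
    exact ⟨D, fun s hs v hv => hD ⟨v, ⟨s, hs, hv⟩, rfl⟩⟩
  intro x
  refine ⟨{p | ‖p.z - x.z‖ < 1}, ?_, ?_⟩
  · refine IsOpen.mem_nhds ?_ (by simp)
    have := H3.continuous_z
    exact isOpen_lt (by fun_prop) continuous_const
  · have hfin := (hF.prod (finite_norm_period_le hper (D + 1 + ‖x.z‖))).image
      fun q => shiftSet (per q.2) q.1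
    refine Set.Finite.of_finite_image (f := Subtype.val) (hfin.subset ?_)
      Subtype.val_injective.injOn
    rintro _ ⟨⟨s, hs⟩, ⟨p, hp, hpx⟩, rfl⟩
    obtain ⟨s', hs', m, rfl⟩ := h s hs
    refine ⟨(s', m), ⟨hs', ?_⟩, rfl⟩
    obtain ⟨c, hc⟩ := mem_idealHull.1 hp
    have h1 : ‖p.z - per m‖ ≤ D := hc.norm_sub_le fun v hv => by
      obtain ⟨u, hu, e⟩ := Finset.mem_image.1 hv
      induction u using OnePoint.rec with
      | infty => simp at e
      | coe u =>
        rw [shift_coe, OnePoint.coe_eq_coe] at e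
        rw [← e]
        simpa using hD s' hs' u hu
    have e : per m = (p.z - x.z) - (p.z - per m) + x.z := by ring
    change ‖per m‖ ≤ _
    rw [e]
    refine (norm_add_le _ _).trans (add_le_add_left ((norm_sub_le _ _).trans ?_) _)
    have : ‖p.z - x.z‖ < 1 := hpx
    linarith

/-! ### Periodic triangulations of the plane with two orbits of triangles -/

/-- `w` is the family of barycentric coordinates of `z` in the simplex with vertex set `Δ`. -/
def IsBary (Δ : Finset ℂ) (w : ℂ → ℝ) (z : ℂ) : Prop :=
  (∀ v, 0 ≤ w v) ∧ (∀ v ∉ Δ, w v = 0) ∧ ∑ v ∈ Δ, w v = 1 ∧ ∑ v ∈ Δ, w v • v = z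

/-- A family of triangles of the plane, invariant under the lattice `per`, that covers the plane
and meets face to face: each point has unique barycentric coordinates.  There are at most two
orbits of triangles. -/
structure IsTiling (per : ℤ × ℤ →+ ℂ) (𝒟 : Set (Finset ℂ)) : Prop where
  card : ∀ Δ ∈ 𝒟, Δ.card = 3
  cover : ∀ z, ∃ Δ ∈ 𝒟, ∃ w, IsBary Δ w z
  unique : ∀ Δ ∈ 𝒟, ∀ Δ' ∈ 𝒟, ∀ w w' z, IsBary Δ w z → IsBary Δ' w' z → w = w'
  invariant : ∀ Δ ∈ 𝒟, ∀ m, Δ.image (· + per m) ∈ 𝒟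
  two : ∃ Δ₁ Δ₂ : Finset ℂ, ∀ Δ ∈ 𝒟, ∃ m, Δ = Δ₁.image (· + per m) ∨ Δ = Δ₂.image (· + per m)

/-- The function with values `α, β, γ` at three points, and `0` elsewhere. -/
def weight₃ (a b c : ℂ) (α β γ : ℝ) (v : ℂ) : ℝ :=
  if v = a then α else if v = b then β else if v = c then γ else 0

theorem isBary_weight₃ {a b c z : ℂ} {α β γ : ℝ} (hab : a ≠ b) (hac : a ≠ c) (hbc : b ≠ c)
    (hα : 0 ≤ α) (hβ : 0 ≤ β) (hγ : 0 ≤ γ) (h1 : α + β + γ = 1) (hz : α * a + β * b + γ * c = z) :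
    IsBary {a, b, c} (weight₃ a b c α β γ) z := by
  refine ⟨fun v => ?_, fun v hv => ?_, ?_, ?_⟩
  · unfold weight₃; split_ifs <;> first | assumption | exact le_rfl
  · simp only [Finset.mem_insert, Finset.mem_singleton, not_or] at hv
    simp [weight₃, hv]
  · rw [Finset.sum_insert (by simp [hab, hac]), Finset.sum_insert (by simp [hbc]),
      Finset.sum_singleton]
    simp only [weight₃, if_true, if_neg hab.symm, if_neg hac.symm, if_neg hbc.symm]
    linarith
  · rw [Finset.sum_insert (by simp [hab, hac]), Finset.sum_insert (by simp [hbc]),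
      Finset.sum_singleton, ← hz]
    simp only [weight₃, if_true, if_neg hab.symm, if_neg hac.symm, if_neg hbc.symm,
      Complex.real_smul]
    ring

theorem IsBary.of_triple {a b c z : ℂ} {w : ℂ → ℝ} (hab : a ≠ b) (hac : a ≠ c) (hbc : b ≠ c)
    (h : IsBary {a, b, c} w z) : w a + w b + w c = 1 ∧ (w a : ℂ) * a + w b * b + w c * c = z := by
  obtain ⟨-, -, h1, h2⟩ := h
  rw [Finset.sum_insert (by simp [hab, hac]), Finset.sum_insert (by simp [hbc]),
      Finset.sum_singleton] at h1 h2
  simp only [Complex.real_smul] at h2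
  exact ⟨by linarith, by rw [← h2]; ring⟩

theorem IsBary.mem_convexHull {Δ : Finset ℂ} {w z} (h : IsBary Δ w z) :
    z ∈ convexHull ℝ (Δ : Set ℂ) :=
  Finset.mem_convexHull'.2 ⟨w, fun v _ => h.1 v, h.2.2.1, h.2.2.2⟩

theorem exists_isBary {Δ : Finset ℂ} {z} (h : z ∈ convexHull ℝ (Δ : Set ℂ)) :
    ∃ w, IsBary Δ w z := by
  obtain ⟨w, h0, h1, h2⟩ := Finset.mem_convexHull'.1 h
  refine ⟨fun v => if v ∈ Δ then w v else 0, fun v => ?_, fun v hv => if_neg hv, ?_, ?_⟩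
  · beta_reduce
    split_ifs with hv
    · exact h0 v hv
    · exact le_rfl
  · rw [← h1]; exact Finset.sum_congr rfl fun v hv => if_pos hv
  · rw [← h2]; exact Finset.sum_congr rfl fun v hv => by beta_reduce; rw [if_pos hv]

namespace IsTiling

variable {per : ℤ × ℤ →+ ℂ} {𝒟 : Set (Finset ℂ)}

theorem locallyFinite (hper : LinearIndependent ℝ ![per (1, 0), per (0, 1)])
    (h : IsTiling per 𝒟) : LocallyFinite fun Δ : 𝒟 => convexHull ℝ ((Δ : Finset ℂ) : Set ℂ) := by
  obtain ⟨Δ₁, Δ₂, h2⟩ := h.two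
  obtain ⟨D, hD⟩ := ((Δ₁ ∪ Δ₂).finite_toSet.image norm).bddAbove
  have hD' : ∀ v ∈ Δ₁ ∪ Δ₂, ‖v‖ ≤ D := fun v hv => hD ⟨v, hv, rfl⟩
  intro x
  refine ⟨Metric.ball x 1, Metric.ball_mem_nhds x one_pos, ?_⟩
  have hfin := ((finite_norm_period_le hper (D + 1 + ‖x‖)).image
    fun m => Δ₁.image (· + per m)).union ((finite_norm_period_le hper (D + 1 + ‖x‖)).image
    fun m => Δ₂.image (· + per m))
  refine Set.Finite.of_finite_image (f := Subtype.val) (hfin.subset ?_)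
    Subtype.val_injective.injOn
  rintro _ ⟨⟨Δ, hΔ⟩, ⟨p, hp, hpx⟩, rfl⟩
  obtain ⟨m, hm⟩ := h2 Δ hΔ
  have hsub : (Δ : Set ℂ) ⊆ Metric.closedBall (per m) D := by
    intro v hv
    rw [mem_closedBall_iff_norm]
    rcases hm with rfl | rfl <;>
    · obtain ⟨u, hu, rfl⟩ := Finset.mem_image.1 hv
      simpa using hD' u (by simp [hu])
  have h1 : ‖p - per m‖ ≤ D := by
    have := convexHull_min hsub (convex_closedBall _ _) hp
    rwa [mem_closedBall_iff_norm] at this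
  have h3 : ‖per m‖ ≤ D + 1 + ‖x‖ := by
    have e : per m = (p - x) - (p - per m) + x := by ring
    rw [e]
    refine (norm_add_le _ _).trans (add_le_add_left ((norm_sub_le _ _).trans ?_) _)
    have : ‖p - x‖ < 1 := by rwa [mem_ball_iff_norm] at hpx
    linarith
  rcases hm with rfl | rfl
  · exact Or.inl ⟨m, h3, rfl⟩
  · exact Or.inr ⟨m, h3, rfl⟩

/-- A vertex of a triangle of a tiling is not the midpoint of the other two: such a vertex would have two
families of barycentric coordinates. -/
theorem ne_midpoint (h : IsTiling per 𝒟) {a b c : ℂ} (hab : a ≠ b) (hac : a ≠ c) (hbc : b ≠ c)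
    (hΔ : {a, b, c} ∈ 𝒟) : a + b ≠ 2 * c := by
  intro e
  have h1 := isBary_weight₃ (z := c) hab hac hbc (α := 1 / 2) (β := 1 / 2) (γ := 0)
    (by norm_num) (by norm_num) le_rfl (by norm_num) (by push_cast; linear_combination e / 2)
  have h2 := isBary_weight₃ (z := c) hab hac hbc (α := 0) (β := 0) (γ := 1)
    le_rfl le_rfl (by norm_num) (by norm_num) (by simp)
  have := congrFun (h.unique _ hΔ _ hΔ _ _ _ h1 h2) a
  simp [weight₃] at this

/-- The triangle on the other side of an edge. -/
theorem exists_neighbour (hper : LinearIndependent ℝ ![per (1, 0), per (0, 1)])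
    (h : IsTiling per 𝒟) {a b c : ℂ} (hab : a ≠ b) (hac : a ≠ c) (hbc : b ≠ c)
    (hΔ : {a, b, c} ∈ 𝒟) : ∃ c', c' ≠ a ∧ c' ≠ b ∧ c' ≠ c ∧ {a, b, c'} ∈ 𝒟 := by
  set m : ℂ := (a + b) / 2 with hm
  have hbm := isBary_weight₃ (z := m) hab hac hbc (α := 1 / 2) (β := 1 / 2) (γ := 0)
    (by norm_num) (by norm_num) le_rfl (by norm_num) (by push_cast; rw [hm]; ring)
  -- Near the midpoint of the edge `ab` only triangles through this midpoint are met.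
  have hclosed : IsClosed (⋃ Δ : {Δ : 𝒟 // m ∉ convexHull ℝ ((Δ : Finset ℂ) : Set ℂ)},
      convexHull ℝ ((Δ.1 : Finset ℂ) : Set ℂ)) :=
    ((h.locallyFinite hper).comp_injective Subtype.val_injective).isClosed_iUnion
      fun Δ => (Δ.1.1.finite_toSet.isCompact_convexHull (𝕜 := ℝ)).isClosed
  have hmem : m ∉ (⋃ Δ : {Δ : 𝒟 // m ∉ convexHull ℝ ((Δ : Finset ℂ) : Set ℂ)},
      convexHull ℝ ((Δ.1 : Finset ℂ) : Set ℂ)) := by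
    simp only [mem_iUnion, not_exists]
    exact fun Δ => Δ.2
  have hev := hclosed.isOpen_compl.mem_nhds hmem
  have ht : Filter.Tendsto (fun η : ℝ => m + η * (m - c)) (𝓝[>] 0) (𝓝 m) := by
    have : Continuous fun η : ℝ => m + η * (m - c) := by fun_prop
    have := this.tendsto 0
    simp only [Complex.ofReal_zero, zero_mul, add_zero] at this
    exact this.mono_left nhdsWithin_le_nhds
  obtain ⟨η, hη, hpos⟩ := ((ht.eventually hev).and self_mem_nhdsWithin).exists
  have hη0 : (0 : ℝ) < η := hpos
  obtain ⟨Δ', hΔ', w, hw⟩ := h.cover (m + η * (m - c))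
  have hmΔ : m ∈ convexHull ℝ (Δ' : Set ℂ) := by
    by_contra hcon
    exact hη (mem_iUnion.2 ⟨⟨⟨Δ', hΔ'⟩, hcon⟩, hw.mem_convexHull⟩)
  obtain ⟨w', hw'⟩ := exists_isBary hmΔ
  have hww := h.unique _ hΔ' _ hΔ _ _ _ hw' hbm
  have ha : a ∈ Δ' := by
    by_contra hcon
    have := hw'.2.1 a hcon
    rw [hww] at this
    simp [weight₃] at this
  have hb : b ∈ Δ' := by
    by_contra hcon
    have := hw'.2.1 b hcon
    rw [hww] at this
    simp [weight₃, hab.symm] at this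
  have hcard : ((Δ'.erase a).erase b).card = 1 := by
    rw [Finset.card_erase_of_mem (Finset.mem_erase.2 ⟨hab.symm, hb⟩),
      Finset.card_erase_of_mem ha, h.card _ hΔ']
  obtain ⟨c', hc'⟩ := Finset.card_eq_one.1 hcard
  have hc'mem : c' ∈ (Δ'.erase a).erase b := by rw [hc']; simp
  have hca : c' ≠ a := (Finset.mem_erase.1 (Finset.mem_erase.1 hc'mem).2).1
  have hcb : c' ≠ b := (Finset.mem_erase.1 hc'mem).1
  have heq : Δ' = {a, b, c'} := by
    rw [← hc', Finset.insert_erase (Finset.mem_erase.2 ⟨hab.symm, hb⟩), Finset.insert_erase ha]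
  refine ⟨c', hca, hcb, ?_, heq ▸ hΔ'⟩
  -- The points beyond the midpoint are not in the triangle `abc`.
  rintro rfl
  subst heq
  obtain ⟨hs1, hs2⟩ := hw.of_triple hab hac hbc
  have hη1 : (1 + η : ℂ) ≠ 0 := by
    have : (1 + η : ℝ) ≠ 0 := by positivity
    exact_mod_cast this
  have h3 := isBary_weight₃ (z := m) hab hac hbc (α := w a / (1 + η)) (β := w b / (1 + η))
    (γ := (w c' + η) / (1 + η)) (div_nonneg (hw.1 a) (by positivity))
    (div_nonneg (hw.1 b) (by positivity)) (div_nonneg (add_nonneg (hw.1 c') hη0.le) (by positivity))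
    (by field_simp; linarith) (by push_cast; field_simp; linear_combination hs2)
  have h4 := congrFun (h.unique _ hΔ _ hΔ _ _ _ h3 hbm) c'
  simp only [weight₃, if_neg hca, if_neg hcb, if_true] at h4
  have h5 : 0 < (w c' + η) / (1 + η) := div_pos (by linarith [hw.1 c']) (by positivity)
  linarith

/-- A triangle is not adjacent to its translates. -/
theorem eq_zero_of_mem_translate (h : IsTiling per 𝒟) {a b c l : ℂ} (hab : a ≠ b) (hac : a ≠ c)
    (hbc : b ≠ c) (hΔ : {a, b, c} ∈ 𝒟) (ha : a ∈ ({a, b, c} : Finset ℂ).image (· + l))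
    (hb : b ∈ ({a, b, c} : Finset ℂ).image (· + l)) : l = 0 := by
  have m1 := h.ne_midpoint hab hac hbc hΔ
  have m2 := h.ne_midpoint hac hab hbc.symm (c := b) (by rwa [Finset.pair_comm])
  have m3 := h.ne_midpoint hbc hab.symm hac.symm (c := a) (by
    rwa [show ({b, c, a} : Finset ℂ) = {a, b, c} by ext; simp; tauto])
  simp only [Finset.image_insert, Finset.image_singleton, Finset.mem_insert,
    Finset.mem_singleton] at ha hb
  by_contra hl
  rcases ha with ha | ha | ha
  · exact hl (by linear_combination -ha)
  · rcases hb with hb | hb | hb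
    · exact hl (by linear_combination (-ha - hb) / 2)
    · exact hl (by linear_combination -hb)
    · exact m2 (by linear_combination ha - hb)
  · rcases hb with hb | hb | hb
    · exact m3 (by linear_combination hb - ha)
    · exact hl (by linear_combination -hb)
    · exact hab (by linear_combination ha - hb)

/-- The possible positions of the apex `c'` of the triangle on the edge `ab` if a translate of that
triangle contains the edge `bc` and `b` is not the midpoint of `ac`. -/
theorem opposite_vertex_cases {a b c c' l : ℂ} (hac : a ≠ c) (hc : c' ≠ c)
    (hbc : b ≠ c) (m : a + c ≠ 2 * b)
    (hb : b ∈ ({a, b, c'} : Finset ℂ).image (· + l))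
    (hcm : c ∈ ({a, b, c'} : Finset ℂ).image (· + l)) :
    c' = a + c - b ∨ (c' = a + b - c ∧ l = c - a) ∨ c' = 2 * b - c := by
  simp only [Finset.image_insert, Finset.image_singleton, Finset.mem_insert,
    Finset.mem_singleton] at hb hcm
  rcases hb with hb | hb | hb <;> rcases hcm with h | h | h
  · exact absurd (hb.trans h.symm) hbc
  · exact absurd (by linear_combination h - hb) m
  · exact Or.inl (by linear_combination hb - h)
  · exact absurd (by linear_combination hb - h) hac
  · exact absurd (hb.trans h.symm) hbc
  · exact absurd (by linear_combination hb - h) hc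
  · exact Or.inr (Or.inl ⟨by linear_combination h - hb, by linear_combination -h⟩)
  · exact Or.inr (Or.inr (by linear_combination h - hb))
  · exact absurd (hb.trans h.symm) hbc

/-- The fourth vertex of the parallelogram formed by two adjacent triangles. -/
theorem opposite_vertex {a b c c' l l' : ℂ} (hab : a ≠ b) (hac : a ≠ c) (hbc : b ≠ c)
    (hc : c' ≠ c) (m1 : a + b ≠ 2 * c) (m2 : a + c ≠ 2 * b) (m3 : b + c ≠ 2 * a)
    (hb : b ∈ ({a, b, c'} : Finset ℂ).image (· + l))
    (hcm : c ∈ ({a, b, c'} : Finset ℂ).image (· + l))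
    (ha' : a ∈ ({a, b, c'} : Finset ℂ).image (· + l'))
    (hcm' : c ∈ ({a, b, c'} : Finset ℂ).image (· + l')) :
    c' = a + b - c ∧ l = c - a ∧ l' = c - b := by
  have e1 := opposite_vertex_cases hac hc hbc m2 hb hcm
  have e2 := opposite_vertex_cases hbc hc hac m3
    (by rwa [show ({b, a, c'} : Finset ℂ) = {a, b, c'} by ext; simp; tauto])
    (l := l') (by rwa [show ({b, a, c'} : Finset ℂ) = {a, b, c'} by ext; simp; tauto])
  rcases e1 with e1 | ⟨e1, f1⟩ | e1 <;> rcases e2 with e2 | ⟨e2, f2⟩ | e2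
  · exact absurd (by linear_combination (e2 - e1) / 2) hab
  · exact absurd (by linear_combination (e1 - e2) / 2) hbc
  · exact absurd (by linear_combination (e1 - e2)) m1
  · exact absurd (by linear_combination (e2 - e1) / 2) hac
  · exact ⟨e1, f1, f2⟩
  · exact absurd (by linear_combination (e1 - e2)) hab
  · exact absurd (by linear_combination (e2 - e1)) m1
  · exact absurd (by linear_combination (e1 - e2)) hab
  · exact absurd (by linear_combination (e1 - e2) / 2) hab

/-- The triangles of a tiling are nondegenerate. -/
theorem linearIndependent_sides (h : IsTiling per 𝒟) {a b c : ℂ} (hab : a ≠ b) (hac : a ≠ c)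
    (hbc : b ≠ c) (hΔ : {a, b, c} ∈ 𝒟) : LinearIndependent ℝ ![a - c, b - c] := by
  rw [LinearIndependent.pair_iff]
  intro s t hst
  simp only [Complex.real_smul] at hst
  -- A relation would yield a second family of barycentric coordinates of the centroid.
  set M : ℝ := 3 * (1 + |s| + |t|) with hM
  have hM0 : 0 < M := by positivity
  have b1 : |s / M| ≤ 1 / 3 := by
    rw [abs_div, abs_of_pos hM0, div_le_div_iff₀ hM0 (by norm_num)]
    nlinarith [abs_nonneg s, abs_nonneg t]
  have b2 : |t / M| ≤ 1 / 3 := by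
    rw [abs_div, abs_of_pos hM0, div_le_div_iff₀ hM0 (by norm_num)]
    nlinarith [abs_nonneg s, abs_nonneg t]
  have b3 : |s / M + t / M| ≤ 1 / 3 := by
    rw [← add_div, abs_div, abs_of_pos hM0, div_le_div_iff₀ hM0 (by norm_num)]
    nlinarith [abs_nonneg s, abs_nonneg t, abs_add_le s t]
  rw [abs_le] at b1 b2 b3
  have hMc : (M : ℂ) ≠ 0 := by exact_mod_cast hM0.ne'
  have h1 := isBary_weight₃ (z := (a + b + c) / 3) hab hac hbc (α := 1 / 3) (β := 1 / 3)
    (γ := 1 / 3) (by norm_num) (by norm_num) (by norm_num) (by norm_num) (by push_cast; ring)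
  have h2 := isBary_weight₃ (z := (a + b + c) / 3) hab hac hbc (α := 1 / 3 + s / M)
    (β := 1 / 3 + t / M) (γ := 1 / 3 - (s / M + t / M)) (by linarith) (by linarith) (by linarith)
    (by ring) (by push_cast; field_simp; linear_combination 3 * hst)
  have h3 := h.unique _ hΔ _ hΔ _ _ _ h1 h2
  have ea := congrFun h3 a
  have eb := congrFun h3 b
  simp only [weight₃, if_true, if_neg hab.symm] at ea eb
  exact ⟨by simpa [hM0.ne'] using ea, by simpa [hM0.ne'] using eb⟩

/-- A periodic triangulation of the plane with two orbits of triangles is the standard one: its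
vertices form one orbit, and a parallelogram spanned by a basis of the lattice is cut into two
triangles by a diagonal. -/
theorem exists_basis (hper : LinearIndependent ℝ ![per (1, 0), per (0, 1)])
    (h : IsTiling per 𝒟) : ∃ (o : ℂ) (x y : ℤ × ℤ),
      (x.1 * y.2 - x.2 * y.1 = 1 ∨ x.1 * y.2 - x.2 * y.1 = -1) ∧
      (∀ Δ, Δ ∈ 𝒟 ↔ ∃ k, Δ = {o + per k, o + per (k + x), o + per (k + y)} ∨
        Δ = {o + per (k + x), o + per (k + y), o + per (k + x + y)}) ∧
      ∀ k l, ({o + per k, o + per (k + x), o + per (k + y)} : Finset ℂ) ≠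
        {o + per (l + x), o + per (l + y), o + per (l + x + y)} := by
  obtain ⟨Δ, hΔ, -⟩ := h.cover 0
  obtain ⟨a, b, c, hab, hac, hbc, rfl⟩ := Finset.card_eq_three.1 (h.card Δ hΔ)
  have hΔ2 : {b, c, a} ∈ 𝒟 := by
    rwa [show ({b, c, a} : Finset ℂ) = {a, b, c} by ext; simp; tauto]
  have hΔ3 : {a, c, b} ∈ 𝒟 := by
    rwa [show ({a, c, b} : Finset ℂ) = {a, b, c} by ext; simp; tauto]
  have m1 := h.ne_midpoint hab hac hbc hΔ
  have m2 := h.ne_midpoint hac hab hbc.symm hΔ3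
  have m3 := h.ne_midpoint hbc hab.symm hac.symm hΔ2
  obtain ⟨c', hca, hcb, hcc, hc'⟩ := h.exists_neighbour hper hab hac hbc hΔ
  obtain ⟨a', hab', hac', haa, ha'⟩ := h.exists_neighbour hper hbc hab.symm hac.symm hΔ2
  obtain ⟨b', hba', hbc', hbb, hb'⟩ := h.exists_neighbour hper hac hab hbc.symm hΔ3
  -- No neighbour is a translate of the triangle, so all are translates of each other.
  have nt1 : ∀ m, ({a, b, c'} : Finset ℂ) ≠ ({a, b, c} : Finset ℂ).image (· + per m) := by
    intro m e
    have h0 := h.eq_zero_of_mem_translate hab hac hbc hΔ (l := per m) (by simp [← e])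
      (by simp [← e])
    rw [h0] at e
    have : c' ∈ ({a, b, c} : Finset ℂ) := by
      have : c' ∈ ({a, b, c'} : Finset ℂ) := by simp
      rw [e] at this; simpa using this
    simp [hca, hcb, hcc] at this
  have nt2 : ∀ m, ({b, c, a'} : Finset ℂ) ≠ ({a, b, c} : Finset ℂ).image (· + per m) := by
    intro m e
    rw [show ({a, b, c} : Finset ℂ) = {b, c, a} by ext; simp; tauto] at e
    have h0 := h.eq_zero_of_mem_translate hbc hab.symm hac.symm hΔ2 (l := per m) (by simp [← e])
      (by simp [← e])
    rw [h0] at e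
    have : a' ∈ ({b, c, a} : Finset ℂ) := by
      have : a' ∈ ({b, c, a'} : Finset ℂ) := by simp
      rw [e] at this; simpa using this
    simp [hab', hac', haa] at this
  have nt3 : ∀ m, ({a, c, b'} : Finset ℂ) ≠ ({a, b, c} : Finset ℂ).image (· + per m) := by
    intro m e
    rw [show ({a, b, c} : Finset ℂ) = {a, c, b} by ext; simp; tauto] at e
    have h0 := h.eq_zero_of_mem_translate hac hab hbc.symm hΔ3 (l := per m) (by simp [← e])
      (by simp [← e])
    rw [h0] at e
    have : b' ∈ ({a, c, b} : Finset ℂ) := by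
      have : b' ∈ ({a, c, b'} : Finset ℂ) := by simp
      rw [e] at this; simpa using this
    simp [hba', hbc', hbb] at this
  have tr : ∀ (E F G : Finset ℂ) (m n : ℤ × ℤ), E = G.image (· + per m) → F = G.image (· + per n) →
      F = E.image (· + per (n - m)) := by
    rintro E F G m n rfl rfl
    rw [Finset.image_image]
    refine Finset.image_congr fun v _ => ?_
    simp
  have tr' : ∀ (E F : Finset ℂ) (m n : ℤ × ℤ), E.image (· + per m) = F.image (· + per n) →
      F = E.image (· + per (m - n)) := by
    intro E F m n hEF
    have e0 : F = (F.image (· + per n)).image (· + per (-n)) := by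
      rw [Finset.image_image]; simp
    rw [e0, ← hEF, Finset.image_image]
    refine Finset.image_congr fun v _ => ?_
    simp [sub_eq_add_neg, add_assoc]
  have key : ∀ E ∈ 𝒟, ∀ F ∈ 𝒟,
      (∀ m, E ≠ ({a, b, c} : Finset ℂ).image (· + per m)) →
      (∀ m, F ≠ ({a, b, c} : Finset ℂ).image (· + per m)) → ∃ m, F = E.image (· + per m) := by
    intro E hE F hF nE nF
    obtain ⟨Δ₁, Δ₂, h2⟩ := h.two
    obtain ⟨m, hm⟩ := h2 _ hΔ
    obtain ⟨n, hn⟩ := h2 _ hE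
    obtain ⟨l, hl⟩ := h2 _ hF
    rcases hm with hm | hm <;> rcases hn with hn | hn <;> rcases hl with hl | hl
    · exact absurd (tr _ _ _ _ _ hm hn) (nE _)
    · exact absurd (tr _ _ _ _ _ hm hn) (nE _)
    · exact absurd (tr _ _ _ _ _ hm hl) (nF _)
    · exact ⟨_, tr _ _ _ _ _ hn hl⟩
    · exact ⟨_, tr _ _ _ _ _ hn hl⟩
    · exact absurd (tr _ _ _ _ _ hm hl) (nF _)
    · exact absurd (tr _ _ _ _ _ hm hn) (nE _)
    · exact absurd (tr _ _ _ _ _ hm hn) (nE _)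
  obtain ⟨l, hl⟩ := key _ hc' _ ha' nt1 nt2
  obtain ⟨l', hl'⟩ := key _ hc' _ hb' nt1 nt3
  obtain ⟨e, hl1, hl1'⟩ := opposite_vertex hab hac hbc hcc m1 m2 m3 (l := per l) (l' := per l')
    (by simp [← hl]) (by simp [← hl]) (by simp [← hl']) (by simp [← hl'])
  obtain ⟨x, hx⟩ : ∃ x : ℤ × ℤ, per x = a - c := ⟨-l, by rw [map_neg, hl1]; ring⟩
  obtain ⟨y, hy⟩ : ∃ y : ℤ × ℤ, per y = b - c := ⟨-l', by rw [map_neg, hl1']; ring⟩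
  have up : ∀ k, ({c + per k, c + per (k + x), c + per (k + y)} : Finset ℂ) =
      ({a, b, c} : Finset ℂ).image (· + per k) := by
    intro k
    rw [show ({a, b, c} : Finset ℂ) = {c, a, b} by ext; simp; tauto]
    simp only [Finset.image_insert, Finset.image_singleton, map_add, hx, hy]
    congr 2
    · ring
    · congr 1; ring
  have down : ∀ k, ({c + per (k + x), c + per (k + y), c + per (k + x + y)} : Finset ℂ) =
      ({a, b, c'} : Finset ℂ).image (· + per k) := by
    intro k
    simp only [Finset.image_insert, Finset.image_singleton, map_add, hx, hy, e]
    congr 1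
    · ring
    · congr 1
      · ring
      · congr 1; ring
  have hup : ∀ k, {c + per k, c + per (k + x), c + per (k + y)} ∈ 𝒟 := fun k => by
    rw [up]; exact h.invariant _ hΔ k
  have hdown : ∀ k, {c + per (k + x), c + per (k + y), c + per (k + x + y)} ∈ 𝒟 := fun k => by
    rw [down]; exact h.invariant _ hc' k
  have hne : ∀ k l, ({c + per k, c + per (k + x), c + per (k + y)} : Finset ℂ) ≠
      {c + per (l + x), c + per (l + y), c + per (l + x + y)} := by
    intro k l e'
    rw [up, down] at e'
    exact nt1 _ (tr' _ _ _ _ e')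
  -- The sublattice spanned by `x` and `y` already moves the two triangles over the whole plane.
  have hcov : ∀ E ∈ 𝒟, ∃ i j : ℤ,
      E = ({a, b, c} : Finset ℂ).image (· + per (i • x + j • y)) ∨
      E = ({a, b, c'} : Finset ℂ).image (· + per (i • x + j • y)) := by
    intro E hE
    obtain ⟨a₁, b₁, c₁, h12, h13, h23, rfl⟩ := Finset.card_eq_three.1 (h.card E hE)
    set g : ℂ := (a₁ + b₁ + c₁) / 3 with hg
    have hbg := isBary_weight₃ (z := g) h12 h13 h23 (α := 1 / 3) (β := 1 / 3)
      (γ := 1 / 3) (by norm_num) (by norm_num) (by norm_num) (by norm_num)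
      (by push_cast; rw [hg]; ring)
    have hspan := (h.linearIndependent_sides hab hac hbc hΔ).span_eq_top_of_card_eq_finrank
      (by simp)
    rw [Matrix.range_cons, Matrix.range_cons, Matrix.range_empty, union_empty,
      singleton_union] at hspan
    obtain ⟨α, β, hαβ⟩ := Submodule.mem_span_pair.1 (hspan ▸ Submodule.mem_top (x := g - c))
    simp only [Complex.real_smul] at hαβ
    set k := ⌊α⌋ • x + ⌊β⌋ • y with hk
    have hpk : per k = ⌊α⌋ * (a - c) + ⌊β⌋ * (b - c) := by
      rw [hk, map_add, map_zsmul, map_zsmul, hx, hy]; simp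
    have fa0 := Int.fract_nonneg α
    have fa1 := (Int.fract_lt_one α).le
    have fb0 := Int.fract_nonneg β
    have fb1 := (Int.fract_lt_one β).le
    have hα : (α : ℂ) = ⌊α⌋ + (Int.fract α : ℝ) := by
      exact_mod_cast (Int.floor_add_fract α).symm
    have hβ : (β : ℂ) = ⌊β⌋ + (Int.fract β : ℝ) := by
      exact_mod_cast (Int.floor_add_fract β).symm
    have fin : ∀ F ∈ 𝒟, ∀ w, IsBary F w g → ({a₁, b₁, c₁} : Finset ℂ) = F := by
      intro F hF w hw
      have hww := h.unique _ hF _ hE _ _ _ hw hbg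
      refine Finset.eq_of_subset_of_card_le (fun v hv => ?_) (by rw [h.card _ hF, h.card _ hE])
      by_contra hcon
      have h0 := hw.2.1 v hcon
      rw [hww] at h0
      simp only [Finset.mem_insert, Finset.mem_singleton] at hv
      rcases hv with rfl | rfl | rfl
      · simp [weight₃] at h0
      · simp [weight₃, h12.symm] at h0
      · simp [weight₃, h13.symm, h23.symm] at h0
    refine ⟨⌊α⌋, ⌊β⌋, ?_⟩
    by_cases hle : Int.fract α + Int.fract β ≤ 1
    · left
      refine fin _ (h.invariant _ hΔ _) (weight₃ (a + per k) (b + per k) (c + per k)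
        (Int.fract α) (Int.fract β) (1 - Int.fract α - Int.fract β)) ?_
      · simp only [Finset.image_insert, Finset.image_singleton]
        refine isBary_weight₃ (by simpa using hab) (by simpa using hac) (by simpa using hbc)
          fa0 fb0 (by linarith) (by ring) ?_
        rw [hα, hβ] at hαβ
        push_cast
        linear_combination hαβ + hpk
    · right
      refine fin _ (h.invariant _ hc' _) (weight₃ (a + per k) (b + per k) (c' + per k)
        (1 - Int.fract β) (1 - Int.fract α) (Int.fract α + Int.fract β - 1)) ?_
      · simp only [Finset.image_insert, Finset.image_singleton]
        refine isBary_weight₃ (by simpa using hab) (by simpa using hca.symm)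
          (by simpa using hcb.symm) (by linarith) (by linarith) (by linarith) (by ring) ?_
        rw [hα, hβ] at hαβ
        push_cast
        rw [e]
        linear_combination hαβ + hpk
  have hgen : ∀ m : ℤ × ℤ, ∃ i j : ℤ, m = i • x + j • y := by
    intro m
    obtain ⟨i, j, hij | hij⟩ := hcov _ (h.invariant _ hΔ m)
    · refine ⟨i, j, period_injective hper ?_⟩
      have h2 := tr' _ _ _ _ hij.symm
      have h0 := h.eq_zero_of_mem_translate hab hac hbc hΔ (l := per (i • x + j • y - m))
        (by rw [← h2]; simp) (by rw [← h2]; simp)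
      rw [map_sub, sub_eq_zero] at h0
      exact h0.symm
    · exact absurd (tr' _ _ _ _ hij) (nt1 _)
  refine ⟨c, x, y, ?_, ?_, hne⟩
  · obtain ⟨i, j, hij⟩ := hgen (1, 0)
    obtain ⟨i', j', hij'⟩ := hgen (0, 1)
    have e1 := congrArg Prod.fst hij
    have e2 := congrArg Prod.snd hij
    have e3 := congrArg Prod.fst hij'
    have e4 := congrArg Prod.snd hij'
    simp only [Prod.fst_add, Prod.snd_add, Prod.smul_fst, Prod.smul_snd, smul_eq_mul]
      at e1 e2 e3 e4
    have hdet : (i * j' - j * i') * (x.1 * y.2 - x.2 * y.1) = 1 := by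
      have : (i * x.1 + j * y.1) * (i' * x.2 + j' * y.2)
          - (i * x.2 + j * y.2) * (i' * x.1 + j' * y.1) = 1 := by
        rw [← e1, ← e2, ← e3, ← e4]; norm_num
      linear_combination this
    exact Int.isUnit_iff.1 (IsUnit.of_mul_eq_one_right _ hdet)
  · intro E
    constructor
    · intro hE
      obtain ⟨i, j, hij⟩ := hcov E hE
      refine ⟨i • x + j • y, ?_⟩
      rw [up, down]
      exact hij
    · rintro ⟨k, rfl | rfl⟩
      · exact hup k
      · exact hdown k

end IsTiling

/-! ### Cones over finite sets of the plane -/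

/-- The finite set `Δ ⊆ ℂ` of ideal points, together with `∞`. -/
def cone (Δ : Finset ℂ) : Finset (OnePoint ℂ) :=
  insert OnePoint.infty (Δ.image fun v : ℂ => (v : OnePoint ℂ))

theorem infty_mem_cone (Δ : Finset ℂ) : OnePoint.infty ∈ cone Δ := Finset.mem_insert_self _ _

@[simp] theorem coe_mem_cone {Δ : Finset ℂ} {v : ℂ} : (v : OnePoint ℂ) ∈ cone Δ ↔ v ∈ Δ := by
  simp [cone]

theorem cone_injective : Function.Injective cone := fun Δ Δ' h => by
  ext v; rw [← coe_mem_cone, h, coe_mem_cone]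

theorem infty_notMem_image (Δ : Finset ℂ) :
    OnePoint.infty ∉ Δ.image fun v : ℂ => (v : OnePoint ℂ) := by simp

theorem card_cone (Δ : Finset ℂ) : (cone Δ).card = Δ.card + 1 := by
  rw [cone, Finset.card_insert_of_notMem (infty_notMem_image Δ),
    Finset.card_image_of_injective _ OnePoint.coe_injective]

theorem exists_eq_cone {s : Finset (OnePoint ℂ)} (h : OnePoint.infty ∈ s) : ∃ Δ, s = cone Δ := by
  refine ⟨s.preimage (fun v : ℂ => (v : OnePoint ℂ)) OnePoint.coe_injective.injOn, ?_⟩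
  ext v
  induction v using OnePoint.rec with
  | infty => simp [h, infty_mem_cone]
  | coe v => simp

theorem shiftSet_cone (a : ℂ) (Δ : Finset ℂ) : shiftSet a (cone Δ) = cone (Δ.image (· + a)) := by
  rw [shiftSet, cone, cone, Finset.image_insert, Finset.image_image, Finset.image_image]
  rfl

theorem sum_cone {M : Type*} [AddCommMonoid M] (Δ : Finset ℂ) (g : OnePoint ℂ → M) :
    ∑ v ∈ cone Δ, g v = g OnePoint.infty + ∑ v ∈ Δ, g v := by
  rw [cone, Finset.sum_insert (infty_notMem_image Δ),
    Finset.sum_image OnePoint.coe_injective.injOn]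

theorem isBary_of_isRep {Δ : Finset ℂ} {c p} (h : IsRep (cone Δ) c p) :
    IsBary Δ (fun v => c v) p.z := by
  refine ⟨fun v => h.1 v, fun v hv => ?_, ?_, ?_⟩
  · by_contra hc
    exact hv (coe_mem_cone.1 (h.2.1 (Finsupp.mem_support_iff.2 hc)))
  · have := h.sum_busemann OnePoint.infty
    rw [sum_cone, bus_infty_vec] at this
    simpa only [bus_infty_infty, bus_infty_coe, mul_zero, zero_add, mul_one] using this
  · have := congrArg Prod.fst ((comb_eq_sum h.2.1).symm.trans h.2.2)
    rw [Prod.fst_sum, sum_cone] at this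
    simpa [nullVec_infty, nullVec_coe, H3.vec] using this

/-- Above the diameter of `Δ` the ideal hull of `Δ` and `∞` is a vertical prism. -/
theorem exists_isRep_cone {Δ : Finset ℂ} {T : ℝ} (hΔ : ∀ v ∈ Δ, ∀ w ∈ Δ, ‖v - w‖ < T)
    {p : H3} (hT : T ≤ p.t) {w : ℂ → ℝ} (hw : IsBary Δ w p.z) :
    ∃ c, IsRep (cone Δ) c p ∧ (∀ v : ℂ, c v = w v) ∧ 0 < c OnePoint.infty := by
  obtain ⟨h0, hout, h1, hz⟩ := hw
  have hne : Δ.Nonempty := by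
    by_contra h
    rw [Finset.not_nonempty_iff_eq_empty] at h
    simp [h] at h1
  obtain ⟨u, hu⟩ := hne
  have hlt : ∑ v ∈ Δ, w v * ‖v - u‖ ^ 2 < p.t ^ 2 := by
    have hlt' : ∑ v ∈ Δ, w v * ‖v - u‖ ^ 2 < ∑ v ∈ Δ, w v * p.t ^ 2 := by
      obtain ⟨v₀, hv₀, hpos⟩ : ∃ v ∈ Δ, 0 < w v := by
        by_contra! hcon
        have := Finset.sum_nonpos hcon
        linarith
      have hsq : ∀ v ∈ Δ, ‖v - u‖ ^ 2 < p.t ^ 2 := fun v hv =>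
        pow_lt_pow_left₀ ((hΔ v hv u hu).trans_le hT) (norm_nonneg _) two_ne_zero
      exact Finset.sum_lt_sum (fun v hv => mul_le_mul_of_nonneg_left (hsq v hv).le (h0 v))
        ⟨v₀, hv₀, mul_lt_mul_of_pos_left (hsq v₀ hv₀) hpos⟩
    rwa [← Finset.sum_mul, h1, one_mul] at hlt'
  have hexp : ∑ v ∈ Δ, w v * ‖v - u‖ ^ 2
      = ∑ v ∈ Δ, w v * ‖v‖ ^ 2 - ‖p.z‖ ^ 2 + ‖p.z - u‖ ^ 2 := by
    have hre : ∑ v ∈ Δ, w v * v.re = p.z.re := by rw [← hz, Complex.re_sum]; simp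
    have him : ∑ v ∈ Δ, w v * v.im = p.z.im := by rw [← hz, Complex.im_sum]; simp
    have : ∀ v ∈ Δ, w v * ‖v - u‖ ^ 2 = w v * ‖v‖ ^ 2 - 2 * u.re * (w v * v.re)
        - 2 * u.im * (w v * v.im) + w v * ‖u‖ ^ 2 := fun v _ => by
      simp only [norm_sq_eq, Complex.sub_re, Complex.sub_im]; ring
    rw [Finset.sum_congr rfl this, Finset.sum_add_distrib, Finset.sum_sub_distrib,
      Finset.sum_sub_distrib, ← Finset.mul_sum, ← Finset.mul_sum, ← Finset.sum_mul, hre, him, h1]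
    simp only [norm_sq_eq, Complex.sub_re, Complex.sub_im]; ring
  have hκ : 0 < ‖p.z‖ ^ 2 + p.t ^ 2 - ∑ v ∈ Δ, w v * ‖v‖ ^ 2 := by
    nlinarith [sq_nonneg ‖p.z - u‖]
  let g : OnePoint ℂ → ℝ := fun v => Option.elim v
    (‖p.z‖ ^ 2 + p.t ^ 2 - ∑ v ∈ Δ, w v * ‖v‖ ^ 2) w
  have hgI : g OnePoint.infty = ‖p.z‖ ^ 2 + p.t ^ 2 - ∑ v ∈ Δ, w v * ‖v‖ ^ 2 := rfl
  have hgc : ∀ v : ℂ, g v = w v := fun v => rfl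
  clear_value g
  have hsupp : ∀ v, g v ≠ 0 → v ∈ cone Δ := fun v hv => by
    induction v using OnePoint.rec with
    | infty => exact infty_mem_cone Δ
    | coe v =>
      rw [coe_mem_cone]
      by_contra hc
      exact hv ((hgc v).trans (hout v hc))
  refine ⟨Finsupp.onFinset (cone Δ) g hsupp, ⟨fun v => ?_, Finsupp.support_onFinset_subset, ?_⟩,
    fun v => ?_, ?_⟩
  · rw [Finsupp.onFinset_apply]
    induction v using OnePoint.rec with
    | infty => rw [hgI]; exact hκ.le
    | coe v => rw [hgc]; exact h0 v
  · rw [comb_eq_sum Finsupp.support_onFinset_subset]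
    simp only [Finsupp.onFinset_apply]
    rw [sum_cone, hgI]
    simp only [hgc, nullVec_infty, nullVec_coe]
    refine Prod.ext ?_ (Prod.ext ?_ ?_)
    · rw [Prod.fst_add, Prod.fst_sum]
      simpa [H3.vec] using hz
    · rw [Prod.snd_add, Prod.fst_add, Prod.snd_sum, Prod.fst_sum]
      simp [H3.vec]
    · rw [Prod.snd_add, Prod.snd_add, Prod.snd_sum, Prod.snd_sum]
      simpa [H3.vec] using h1
  · rw [Finsupp.onFinset_apply, hgc]
  · rw [Finsupp.onFinset_apply, hgI]; exact hκ

theorem mem_idealHull_cone {Δ : Finset ℂ} {T : ℝ} (hΔ : ∀ v ∈ Δ, ∀ w ∈ Δ, ‖v - w‖ < T)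
    {p : H3} (hT : T ≤ p.t) : p ∈ idealHull (cone Δ) ↔ p.z ∈ convexHull ℝ (Δ : Set ℂ) := by
  constructor
  · intro h
    obtain ⟨c, hc⟩ := mem_idealHull.1 h
    exact (isBary_of_isRep hc).mem_convexHull
  · intro h
    obtain ⟨w, hw⟩ := exists_isBary h
    obtain ⟨c, hc, -⟩ := exists_isRep_cone hΔ hT hw
    exact mem_idealHull.2 ⟨c, hc⟩

/-- The part of a cone above its base is a prism over a convex set. -/
theorem isPreconnected_slab {Δ : Finset ℂ} {T : ℝ} (hT0 : 0 < T)
    (hΔ : ∀ v ∈ Δ, ∀ w ∈ Δ, ‖v - w‖ < T) :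
    IsPreconnected {p : H3 | p ∈ idealHull (cone Δ) ∧ T ≤ p.t} := by
  have h1 : IsPreconnected ((convexHull ℝ (Δ : Set ℂ)) ×ˢ Ici T) :=
    (convex_convexHull ℝ _).isPreconnected.prod isPreconnected_Ici
  have h2 := h1.image (fun q : ℂ × ℝ => (⟨q.1, max q.2 T, lt_max_of_lt_right hT0⟩ : H3))
    (H3.continuous_mk continuous_fst (by fun_prop) _).continuousOn
  convert h2 using 1
  ext p
  constructor
  · rintro ⟨hp, ht⟩
    exact ⟨(p.z, p.t), ⟨(mem_idealHull_cone hΔ ht).1 hp, ht⟩, H3.ext rfl (max_eq_left ht)⟩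
  · rintro ⟨q, ⟨hq, -⟩, rfl⟩
    exact ⟨(mem_idealHull_cone hΔ (le_max_right _ _)).2 hq, le_max_right _ _⟩

/-! ### Deck transformations -/

@[simp] theorem deck_deck (m n : ℤ × ℤ) (p : Cover) : deck m (deck n p) = deck (n + m) p := by
  refine Subtype.ext (Prod.ext (Prod.ext ?_ ?_) rfl) <;> simp [deck, add_assoc]

@[simp] theorem deck_zero (p : Cover) : deck 0 p = p := by
  refine Subtype.ext (Prod.ext (Prod.ext ?_ ?_) rfl) <;> simp [deck]

theorem continuous_deck (m : ℤ × ℤ) : Continuous (deck m) := by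
  unfold deck
  fun_prop

theorem deck_image_deck_image (m n : ℤ × ℤ) (σ : Set Cover) :
    deck m '' (deck n '' σ) = deck (n + m) '' σ := by
  rw [image_image]; simp

namespace DrilledAnanas

variable {N : DrilledAnanas}

theorem isLocallyInjective_dev : IsLocallyInjective N.dev := fun p => by
  obtain ⟨U, hU, hinj⟩ := N.dev_locallyInjective p
  obtain ⟨V, hVU, hV, hp⟩ := mem_nhds_iff.1 hU
  exact ⟨V, hV, hp, hinj.mono hVU⟩

theorem isSeparatedMap_dev : IsSeparatedMap N.dev := T2Space.isSeparatedMap _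

/-! ### The cusp end -/

/-- The end `y ≤ height` develops bijectively to a horoball about `∞`; the height above the
horosphere is the increasing function `φ` of the height in the topological model. -/
structure IsCuspEnd (N : DrilledAnanas) (y : ℝ) (φ : ℝ → ℝ) : Prop where
  injOn : InjOn N.dev {p | y ≤ height p}
  strictMono : StrictMonoOn φ (Ici y)
  dev_t : ∀ p, y ≤ height p → (N.dev p).t = φ (height p)
  surj : ∀ q : H3, φ y ≤ q.t → ∃ p, y ≤ height p ∧ N.dev p = q
  unbounded : ∀ T, ∃ h, y ≤ h ∧ T ≤ φ h

theorem exists_isCuspEnd (N : DrilledAnanas) : ∃ y φ, N.IsCuspEnd y φ := by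
  obtain ⟨y, hy, hinj, ⟨c, -, hc⟩, hlev⟩ := N.cusp
  let P : ℝ → Cover := fun u => ⟨((0, 0), max u y), (hy.le.trans (le_max_right _ _)),
    fun h => (hy.trans_le (le_max_right u y)).ne' h.1⟩
  have hP : ∀ u, y ≤ u → height (P u) = u := fun u hu => max_eq_left hu
  have hPc : Continuous P := by fun_prop
  set φ : ℝ → ℝ := fun u => (N.dev (P u)).t with hφ
  have hφc : Continuous φ := H3.continuous_t.comp (N.dev_continuous.comp hPc)
  have hdev : ∀ p, y ≤ height p → (N.dev p).t = φ (height p) := by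
    intro p hp
    obtain ⟨d, hd⟩ := hlev _ hp
    have h1 : N.dev p ∈ {q : H3 | q.t = d} := hd ▸ mem_image_of_mem _ rfl
    have h2 : N.dev (P (height p)) ∈ {q : H3 | q.t = d} :=
      hd ▸ mem_image_of_mem _ (hP _ hp)
    exact h1.trans h2.symm
  have hφinj : InjOn φ (Ici y) := by
    intro u hu u' hu' h
    obtain ⟨d, hd⟩ := hlev u' hu'
    have h2 : (N.dev (P u')).t = d := by
      have : N.dev (P u') ∈ {q : H3 | q.t = d} := hd ▸ mem_image_of_mem _ (hP _ hu')
      exact this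
    have h1 : N.dev (P u) ∈ N.dev '' {p | height p = u'} := by
      rw [hd]; exact h.trans h2
    obtain ⟨p, hp, hpe⟩ := h1
    have hp' : height p = u' := hp
    have h3 := hinj (show y ≤ height p by rw [hp']; exact hu')
      (show y ≤ height (P u) by rw [hP u hu]; exact hu) hpe
    rw [← hP u hu, ← h3, hp']
  have hsurj : ∀ t, c ≤ t → 0 < t → ∃ u, y ≤ u ∧ φ u = t := by
    intro t ht h0
    have : (⟨0, t, h0⟩ : H3) ∈ N.dev '' {p | y ≤ height p} := by rw [hc]; exact ht
    obtain ⟨p, hp, hpe⟩ := this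
    exact ⟨height p, hp, by rw [← hdev p hp, hpe]⟩
  have hmem : ∀ u, y ≤ u → c ≤ φ u := fun u hu => by
    have : N.dev (P u) ∈ {q : H3 | c ≤ q.t} := by
      rw [← hc]; exact mem_image_of_mem _ (show y ≤ height (P u) by rwa [hP u hu])
    exact this
  have hpos : ∀ u, 0 < φ u := fun u => (N.dev (P u)).t_pos
  obtain ⟨w, hw, hwe⟩ := hsurj (φ y + 1) (by linarith [hmem y le_rfl]) (by linarith [hpos y])
  have hmono : StrictMonoOn φ (Ici y) := by
    intro u hu u' hu' huu'
    have hle : y ≤ max w u' := hw.trans (le_max_left _ _)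
    rcases ContinuousOn.strictMonoOn_of_injOn_Icc' hle hφc.continuousOn
      (hφinj.mono Icc_subset_Ici_self) with h | h
    · exact h ⟨hu, huu'.le.trans (le_max_right _ _)⟩ ⟨hu', le_max_right _ _⟩ huu'
    · have hyw : y < w := lt_of_le_of_ne hw fun e => by rw [← e] at hwe; linarith
      have := h ⟨le_rfl, hle⟩ ⟨hw, le_max_left _ _⟩ hyw
      linarith
  refine ⟨y, φ, hinj, hmono, hdev, fun q hq => ?_, fun T => ?_⟩
  · have : q ∈ N.dev '' {p | y ≤ height p} := by rw [hc]; exact (hmem y le_rfl).trans hq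
    exact this
  · obtain ⟨u, hu, hue⟩ := hsurj (max T (φ y)) ((hmem y le_rfl).trans (le_max_right _ _))
      ((hpos y).trans_le (le_max_right _ _))
    exact ⟨u, hu, by rw [hue]; exact le_max_left _ _⟩

/-! ### Lifts of tetrahedra -/

theorem IsTet.dev_image {σ : Set Cover} {s} (h : N.IsTet σ s) : N.dev '' σ = idealHull s := by
  obtain ⟨-, f, -, hf, rfl⟩ := h
  rw [image_image]
  exact (image_congr fun x hx => hf x hx).trans (image_id' _)

theorem IsTet.exists_section {σ : Set Cover} {s} (h : N.IsTet σ s) :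
    ∃ f : H3 → Cover, ContinuousOn f (idealHull s) ∧ (∀ x ∈ idealHull s, N.dev (f x) = x) ∧
      (∀ x ∈ idealHull s, f x ∈ σ) ∧ ∀ p ∈ σ, f (N.dev p) = p := by
  obtain ⟨-, f, hc, hf, rfl⟩ := h
  refine ⟨f, hc, hf, fun x hx => mem_image_of_mem _ hx, ?_⟩
  rintro _ ⟨x, hx, rfl⟩
  rw [hf x hx]

theorem IsTet.vertexSet_unique {σ : Set Cover} {s s'} (h : N.IsTet σ s) (h' : N.IsTet σ s') :
    s = s' :=
  eq_of_idealHull_eq (by rw [h.1.1]; norm_num) (by rw [h'.1.1]; norm_num)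
    (h.dev_image.symm.trans h'.dev_image)

theorem IsTet.deck {σ : Set Cover} {s} (h : N.IsTet σ s) (m : ℤ × ℤ) :
    N.IsTet (deck m '' σ) (shiftSet (N.period m) s) := by
  obtain ⟨hs, f, hc, hf, rfl⟩ := h
  have hmem : ∀ x, x ∈ idealHull (shiftSet (N.period m) s) ↔
      H3.translate (-N.period m) x ∈ idealHull s := fun x => by
    rw [← translate_mem_idealHull (a := N.period m) (p := x.translate _), translate_translate,
      neg_add_cancel, translate_zero]
  refine ⟨isTetVertexSet_shiftSet hs _, fun x => Ananas.deck m (f (x.translate (-N.period m))),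
    ?_, fun x hx => ?_, ?_⟩
  · exact (continuous_deck m).comp_continuousOn
      (hc.comp (continuous_translate _).continuousOn fun x hx => (hmem x).1 hx)
  · rw [N.dev_deck, hf _ ((hmem x).1 hx), translate_translate, neg_add_cancel, translate_zero]
  · ext p
    constructor
    · rintro ⟨x, hx, rfl⟩
      exact mem_image_of_mem _ (mem_image_of_mem _ ((hmem x).1 hx))
    · rintro ⟨_, ⟨x, hx, rfl⟩, rfl⟩
      refine ⟨x.translate (N.period m), translate_mem_idealHull.2 hx, ?_⟩
      simp

theorem IsTet.dev_cell {σ : Set Cover} {s r} (h : N.IsTet σ s) (hr : r ⊆ s) :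
    N.dev '' N.cell σ r = openIdealHull r := by
  rw [cell, image_inter_preimage, h.dev_image, inter_eq_right]
  exact openIdealHull_subset hr

namespace GeometricTriangulation

variable {𝒯 : N.GeometricTriangulation}

/-- Two tetrahedra of a triangulation that share a point assign it the same barycentric
coordinates. -/
theorem rep_unique {σ σ' : Set Cover} (hσ : σ ∈ 𝒯.tets) (hσ' : σ' ∈ 𝒯.tets) {s s'}
    (h : N.IsTet σ s) (h' : N.IsTet σ' s') {p : Cover} (hp : p ∈ σ) (hp' : p ∈ σ')
    {c c'} (hc : IsRep s c (N.dev p)) (hc' : IsRep s' c' (N.dev p)) : c = c' := by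
  have hr : c.support = c'.support := by
    rcases 𝒯.faceToFace σ hσ σ' hσ' s s' h h' _ hc.2.1 _ hc'.2.1 with he | hd
    · have := congrArg (N.dev '' ·) he
      simp only [h.dev_cell hc.2.1, h'.dev_cell hc'.2.1] at this
      exact eq_of_openIdealHull_eq hc.two_le_card hc'.two_le_card this
    · exact absurd ⟨hp', hc'.mem_openIdealHull⟩
        (disjoint_left.1 hd ⟨hp, hc.mem_openIdealHull⟩)
  exact h.1.rep_unique hc.2.1 (hr ▸ hc.2.1) (hc.2.2.trans hc'.2.2.symm)

/-- The tetrahedra form finitely many orbits under translations, so that the distances between their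
vertices in `ℂ`, and the heights of the tetrahedra without the vertex `∞`, are bounded. -/
theorem exists_bound (h_two : 𝒯.HasTwoTetrahedra) (B : ℝ) : ∃ T, B < T ∧ 0 < T ∧
    ∀ σ ∈ 𝒯.tets, ∀ s, N.IsTet σ s →
      (∀ v w : ℂ, (v : OnePoint ℂ) ∈ s → (w : OnePoint ℂ) ∈ s → ‖v - w‖ < T) ∧
      (OnePoint.infty ∉ s → ∀ p ∈ idealHull s, p.t < T) := by
  obtain ⟨σ, hσ, τ, hτ, -, hall⟩ := h_two
  obtain ⟨s, hs⟩ := 𝒯.isTet σ hσ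
  obtain ⟨t, ht⟩ := 𝒯.isTet τ hτ
  have hbd : ∀ s : Finset (OnePoint ℂ), ∃ D : ℝ, ∀ v w : ℂ, (v : OnePoint ℂ) ∈ s →
      (w : OnePoint ℂ) ∈ s → ‖v - w‖ ≤ D := fun s => by
    let Δ := s.preimage (fun v : ℂ => (v : OnePoint ℂ)) OnePoint.coe_injective.injOn
    obtain ⟨D, hD⟩ := ((Δ ×ˢ Δ).finite_toSet.image fun q => ‖q.1 - q.2‖).bddAbove
    refine ⟨D, fun v w hv hw => hD ⟨(v, w), ?_, rfl⟩⟩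
    simp [Δ, hv, hw]
  obtain ⟨D, hD⟩ := hbd s
  obtain ⟨D', hD'⟩ := hbd t
  set M := max (max D D') 0 with hM
  have hsh : ∀ (a : ℂ) (s : Finset (OnePoint ℂ)), (∀ v w : ℂ, (v : OnePoint ℂ) ∈ s →
      (w : OnePoint ℂ) ∈ s → ‖v - w‖ ≤ M) → ∀ v w : ℂ, (v : OnePoint ℂ) ∈ shiftSet a s →
      (w : OnePoint ℂ) ∈ shiftSet a s → ‖v - w‖ ≤ M := by
    intro a s h v w hv hw
    have key : ∀ v : ℂ, (v : OnePoint ℂ) ∈ shiftSet a s → ((v - a : ℂ) : OnePoint ℂ) ∈ s := by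
      intro v hv
      obtain ⟨u, hu, e⟩ := Finset.mem_image.1 hv
      induction u using OnePoint.rec with
      | infty => simp at e
      | coe u =>
        rw [shift_coe, OnePoint.coe_eq_coe] at e
        rw [← e]; simpa using hu
    have := h _ _ (key v hv) (key w hw)
    simpa using this
  have hall' : ∀ κ ∈ 𝒯.tets, ∀ k, N.IsTet κ k → ∀ v w : ℂ, (v : OnePoint ℂ) ∈ k →
      (w : OnePoint ℂ) ∈ k → ‖v - w‖ ≤ M := by
    intro κ hκ k hk
    obtain ⟨m, rfl | rfl⟩ := hall κ hκ
    · rw [hk.vertexSet_unique (hs.deck m)]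
      exact hsh _ _ fun v w hv hw => (hD v w hv hw).trans (by simp [hM])
    · rw [hk.vertexSet_unique (ht.deck m)]
      exact hsh _ _ fun v w hv hw => (hD' v w hv hw).trans (by simp [hM])
  have hM0 : 0 ≤ M := le_max_right _ _
  refine ⟨max B M + 1, by linarith [le_max_left B M], by linarith [le_max_right B M],
    fun κ hκ k hk => ⟨fun v w hv hw => ?_, fun hinf p hp => ?_⟩⟩
  · have := hall' κ hκ k hk v w hv hw
    linarith [le_max_right B M]
  · have hne : k.Nonempty := by rw [← Finset.card_pos, hk.1.1]; norm_num
    obtain ⟨u, hu⟩ := hne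
    induction u using OnePoint.rec with
    | infty => exact absurd hu hinf
    | coe u =>
      obtain ⟨c, hc⟩ := mem_idealHull.1 hp
      have h1 := hc.sq_le hinf (w := u) (D := M) fun v hv => hall' κ hκ k hk v u hv hu
      have h2 := abs_le_of_sq_le_sq' h1 hM0
      linarith [le_max_right B M]

/-- The vertex sets `Δ` in the plane of the tetrahedra `cone Δ` whose part above the height `T` lies
in the end `y ≤ height`. -/
def cuspTriangles (𝒯 : N.GeometricTriangulation) (y T : ℝ) : Set (Finset ℂ) :=
  {Δ | ∃ σ ∈ 𝒯.tets, N.IsTet σ (cone Δ) ∧ ∀ p ∈ σ, T ≤ (N.dev p).t → y ≤ height p}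

/-- The part of the lift of a cone above the height `T` is connected and does not meet the boundary of
the end `y ≤ height`, so it lies in the end as soon as one of its points does. -/
theorem above_mem_end {y φ} (E : N.IsCuspEnd y φ) {T : ℝ} (hT0 : 0 < T) (hT : φ y < T)
    {σ : Set Cover} {Δ : Finset ℂ} (hσ : N.IsTet σ (cone Δ))
    (hΔ : ∀ v ∈ Δ, ∀ w ∈ Δ, ‖v - w‖ < T) {p p' : Cover} (hp : p ∈ σ) (hpT : T ≤ (N.dev p).t)
    (hpy : y ≤ height p) (hp' : p' ∈ σ) (hpT' : T ≤ (N.dev p').t) : y ≤ height p' := by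
  obtain ⟨f, hfc, hf, hfσ, hfd⟩ := hσ.exists_section
  have hpre := (isPreconnected_slab hT0 hΔ).image f (hfc.mono fun x hx => hx.1)
  have hh : Continuous height := by unfold height; fun_prop
  have hgt : ∀ q : Cover, y ≤ height q → T ≤ (N.dev q).t → y < height q := by
    intro q hq hqT
    refine lt_of_le_of_ne hq fun e => ?_
    rw [E.dev_t q hq, ← e] at hqT
    exact hT.not_ge hqT
  have hcov : f '' {p : H3 | p ∈ idealHull (cone Δ) ∧ T ≤ p.t} ⊆
      {q | y < height q} ∪ {q | height q < y} := by
    rintro _ ⟨x, ⟨hx, hxT⟩, rfl⟩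
    rcases lt_or_ge (height (f x)) y with h | h
    · exact Or.inr h
    · exact Or.inl (hgt _ h (by rwa [hf x hx]))
  have hmem : ∀ q ∈ σ, T ≤ (N.dev q).t →
      q ∈ f '' {p : H3 | p ∈ idealHull (cone Δ) ∧ T ≤ p.t} := fun q hq hqT =>
    ⟨N.dev q, ⟨hσ.dev_image ▸ mem_image_of_mem _ hq, hqT⟩, hfd q hq⟩
  have := hpre.subset_left_of_subset_union (isOpen_lt continuous_const hh)
    (isOpen_lt hh continuous_const)
    (disjoint_left.2 fun q (h1 : y < height q) (h2 : height q < y) => h1.not_gt h2) hcov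
    ⟨p, hmem p hp hpT, hgt p hpy hpT⟩
  exact (show y < height p' from this (hmem p' hp' hpT')).le

theorem mem_of_cone {s : Finset (OnePoint ℂ)} {T : ℝ} {Δ : Finset ℂ} (hs : s = cone Δ)
    (h : ∀ v w : ℂ, (v : OnePoint ℂ) ∈ s → (w : OnePoint ℂ) ∈ s → ‖v - w‖ < T) :
    ∀ v ∈ Δ, ∀ w ∈ Δ, ‖v - w‖ < T := fun v hv w hw =>
  h v w (by rw [hs]; simpa using hv) (by rw [hs]; simpa using hw)

/-- The cross-section of a triangulation with two tetrahedra by a high horosphere is a periodic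
triangulation of the plane. -/
theorem isTiling_cuspTriangles (h_two : 𝒯.HasTwoTetrahedra) {y φ} (E : N.IsCuspEnd y φ) {T : ℝ}
    (hT0 : 0 < T) (hT : φ y < T) (hb : ∀ σ ∈ 𝒯.tets, ∀ s, N.IsTet σ s →
      (∀ v w : ℂ, (v : OnePoint ℂ) ∈ s → (w : OnePoint ℂ) ∈ s → ‖v - w‖ < T) ∧
      (OnePoint.infty ∉ s → ∀ p ∈ idealHull s, p.t < T)) :
    IsTiling N.period (𝒯.cuspTriangles y T) where
  card := by
    rintro Δ ⟨σ, -, hσ, -⟩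
    have := hσ.1.1
    rw [card_cone] at this
    omega
  cover z := by
    obtain ⟨p, hp, hpe⟩ := E.surj ⟨z, T, hT0⟩ hT.le
    obtain ⟨σ, hσ, hpσ⟩ : ∃ σ ∈ 𝒯.tets, p ∈ σ := by
      have := mem_univ p
      rwa [← 𝒯.covers, mem_sUnion] at this
    obtain ⟨s, hs⟩ := 𝒯.isTet σ hσ
    have hmem : N.dev p ∈ idealHull s := hs.dev_image ▸ mem_image_of_mem _ hpσ
    have hinf : OnePoint.infty ∈ s := by
      by_contra hcon
      have := (hb σ hσ s hs).2 hcon _ hmem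
      rw [hpe] at this
      exact lt_irrefl T this
    obtain ⟨Δ, rfl⟩ := exists_eq_cone hinf
    have hΔ := mem_of_cone rfl (hb σ hσ _ hs).1
    have hpT : T ≤ (N.dev p).t := by rw [hpe]
    refine ⟨Δ, ⟨σ, hσ, hs, fun p' hp' hpT' => above_mem_end E hT0 hT hs hΔ hpσ hpT hp hp' hpT'⟩,
      ?_⟩
    rw [mem_idealHull_cone hΔ hpT, hpe] at hmem
    exact exists_isBary hmem
  unique := by
    rintro Δ ⟨σ, hσ, hs, hab⟩ Δ' ⟨σ', hσ', hs', hab'⟩ w w' z hw hw'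
    have hΔ := mem_of_cone rfl (hb σ hσ _ hs).1
    have hΔ' := mem_of_cone rfl (hb σ' hσ' _ hs').1
    obtain ⟨c, hc, hcw, -⟩ := exists_isRep_cone hΔ (p := ⟨z, T, hT0⟩) le_rfl hw
    obtain ⟨c', hc', hcw', -⟩ := exists_isRep_cone hΔ' (p := ⟨z, T, hT0⟩) le_rfl hw'
    obtain ⟨p, hp, hpe⟩ := hs.dev_image.symm ▸ mem_idealHull.2 ⟨c, hc⟩
    obtain ⟨p', hp', hpe'⟩ := hs'.dev_image.symm ▸ mem_idealHull.2 ⟨c', hc'⟩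
    have hpp : p = p' := E.injOn (hab p hp (by rw [hpe])) (hab' p' hp' (by rw [hpe']))
      (hpe.trans hpe'.symm)
    subst hpp
    have hcc := rep_unique hσ hσ' hs hs' hp hp' (hpe ▸ hc) (hpe ▸ hc')
    ext v
    rw [← hcw, hcc, hcw']
  invariant := by
    rintro Δ ⟨σ, hσ, hs, hab⟩ m
    refine ⟨deck m '' σ, 𝒯.invariant σ hσ m, shiftSet_cone _ _ ▸ hs.deck m, ?_⟩
    rintro _ ⟨p, hp, rfl⟩ hpT
    rw [N.dev_deck] at hpT
    exact hab p hp hpT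
  two := by
    obtain ⟨σ, hσ, τ, hτ, -, hall⟩ := h_two
    obtain ⟨s, hs⟩ := 𝒯.isTet σ hσ
    obtain ⟨t, ht⟩ := 𝒯.isTet τ hτ
    have key : ∀ s : Finset (OnePoint ℂ), ∃ Δ₁ : Finset ℂ, ∀ Δ a, cone Δ = shiftSet a s →
        Δ = Δ₁.image (· + a) := by
      intro s
      by_cases hinf : OnePoint.infty ∈ s
      · obtain ⟨Δ₁, rfl⟩ := exists_eq_cone hinf
        refine ⟨Δ₁, fun Δ a h => cone_injective ?_⟩
        rw [h, shiftSet_cone]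
      · refine ⟨∅, fun Δ a h => absurd (h ▸ infty_mem_cone Δ) fun hcon => hinf ?_⟩
        obtain ⟨u, hu, e⟩ := Finset.mem_image.1 hcon
        induction u using OnePoint.rec with
        | infty => exact hu
        | coe u => simp at e
    obtain ⟨Δ₁, h₁⟩ := key s
    obtain ⟨Δ₂, h₂⟩ := key t
    refine ⟨Δ₁, Δ₂, ?_⟩
    rintro Δ ⟨κ, hκ, hk, -⟩
    obtain ⟨m, rfl | rfl⟩ := hall κ hκ
    · exact ⟨m, Or.inl (h₁ _ _ (hk.vertexSet_unique (hs.deck m)))⟩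
    · exact ⟨m, Or.inr (h₂ _ _ (hk.vertexSet_unique (ht.deck m)))⟩

/-- Points of two tetrahedra of the cusp with the same developed image are equal: the vertical
ray above the image lifts to both tetrahedra, and the lifts agree near the cusp. -/
theorem eq_of_dev_eq {y φ} (E : N.IsCuspEnd y φ) {T : ℝ} {σ σ' : Set Cover} {Δ Δ' : Finset ℂ}
    (hs : N.IsTet σ (cone Δ)) (hs' : N.IsTet σ' (cone Δ'))
    (hab : ∀ p ∈ σ, T ≤ (N.dev p).t → y ≤ height p)
    (hab' : ∀ p ∈ σ', T ≤ (N.dev p).t → y ≤ height p)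
    {p p' : Cover} (hp : p ∈ σ) (hp' : p' ∈ σ') (h : N.dev p = N.dev p') : p = p' := by
  obtain ⟨f, hfc, hf, hfσ, hfd⟩ := hs.exists_section
  obtain ⟨f', hfc', hf', hfσ', hfd'⟩ := hs'.exists_section
  have hx : N.dev p ∈ idealHull (cone Δ) := hs.dev_image ▸ mem_image_of_mem _ hp
  have hx' : N.dev p ∈ idealHull (cone Δ') := h ▸ hs'.dev_image ▸ mem_image_of_mem _ hp'
  rw [← hfd p hp, ← hfd' p' hp', ← h]
  generalize N.dev p = x at *
  have hpos : ∀ u : ℝ, 0 < x.t + max u 0 := fun u =>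
    add_pos_of_pos_of_nonneg x.t_pos (le_max_right _ _)
  let g : ℝ → H3 := fun u => ⟨x.z, x.t + max u 0, hpos u⟩
  have hg : Continuous g := H3.continuous_mk continuous_const (by fun_prop) hpos
  have hgm : ∀ u, g u ∈ idealHull (cone Δ) := fun u =>
    mem_idealHull_of_le hx (infty_mem_cone _) rfl (by simp [g])
  have hgm' : ∀ u, g u ∈ idealHull (cone Δ') := fun u =>
    mem_idealHull_of_le hx' (infty_mem_cone _) rfl (by simp [g])
  have hg0 : g 0 = x := H3.ext rfl (by simp [g])
  have hgT : T ≤ (g T).t := by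
    have := x.t_pos
    have := le_max_left T 0
    change T ≤ x.t + max T 0
    linarith
  have htop : f (g T) = f' (g T) := E.injOn (hab _ (hfσ _ (hgm T)) (by rwa [hf _ (hgm T)]))
    (hab' _ (hfσ' _ (hgm' T)) (by rwa [hf' _ (hgm' T)])) (by rw [hf _ (hgm T), hf' _ (hgm' T)])
  have hcomp : N.dev ∘ f ∘ g = N.dev ∘ f' ∘ g := by
    ext1 u; simp only [Function.comp_apply, hf _ (hgm u), hf' _ (hgm' u)]
  have heq := (isSeparatedMap_dev (N := N)).eq_of_comp_eq isLocallyInjective_dev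
    (hfc.comp_continuous hg hgm) (hfc'.comp_continuous hg hgm') hcomp T htop
  have := congrFun heq 0
  rwa [Function.comp_apply, Function.comp_apply, hg0] at this

/-- The structure of a triangulation with two tetrahedra: both are cones from the cusp over the
triangles of a one-vertex triangulation of the torus, and the developing map is a homeomorphism
onto its image. -/
theorem structure_of_two (h_two : 𝒯.HasTwoTetrahedra) :
    ∃ (o : ℂ) (x y : ℤ × ℤ), (x.1 * y.2 - x.2 * y.1 = 1 ∨ x.1 * y.2 - x.2 * y.1 = -1) ∧
      (∀ σ, σ ∈ 𝒯.tets ↔ ∃ k Δ,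
        (Δ = {o + N.period k, o + N.period (k + x), o + N.period (k + y)} ∨
          Δ = {o + N.period (k + x), o + N.period (k + y), o + N.period (k + x + y)}) ∧
        N.IsTet σ (cone Δ)) ∧
      (∀ Δ k, (Δ = {o + N.period k, o + N.period (k + x), o + N.period (k + y)} ∨
          Δ = {o + N.period (k + x), o + N.period (k + y), o + N.period (k + x + y)}) →
        N.IsTet (N.dev ⁻¹' idealHull (cone Δ)) (cone Δ)) ∧
      Function.Injective N.dev ∧
      (∃ g : H3 → Cover, (∀ p, g (N.dev p) = p) ∧ ContinuousOn g (range N.dev)) ∧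
      (∀ h, ∃ T, ∀ p, T ≤ (N.dev p).t → h ≤ height p) ∧
      (∀ T, ∃ h, ∀ p, h ≤ height p → T ≤ (N.dev p).t) := by
  obtain ⟨y₀, φ, E⟩ := exists_isCuspEnd N
  obtain ⟨T, hT, hT0, hb⟩ := exists_bound h_two (φ y₀)
  have tiling := isTiling_cuspTriangles h_two E hT0 hT hb
  obtain ⟨o, x, y, hdet, hmem, hne⟩ := tiling.exists_basis N.period_indep
  have himg : ∀ k m : ℤ × ℤ, ({o + N.period k, o + N.period (k + x), o + N.period (k + y)} :
      Finset ℂ).image (· + N.period m) = {o + N.period (k + m), o + N.period (k + m + x),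
        o + N.period (k + m + y)} := by
    intro k m
    simp only [Finset.image_insert, Finset.image_singleton, map_add]
    congr 1
    · ring
    · congr 1
      · ring
      · congr 1; ring
  have hall : ∀ κ ∈ 𝒯.tets, ∃ Δ ∈ 𝒯.cuspTriangles y₀ T, N.IsTet κ (cone Δ) ∧
      ∀ p ∈ κ, T ≤ (N.dev p).t → y₀ ≤ height p := by
    have hcl : ∀ κ m, (∃ Δ ∈ 𝒯.cuspTriangles y₀ T, N.IsTet κ (cone Δ) ∧
        ∀ p ∈ κ, T ≤ (N.dev p).t → y₀ ≤ height p) →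
        ∃ Δ ∈ 𝒯.cuspTriangles y₀ T, N.IsTet (deck m '' κ) (cone Δ) ∧
        ∀ p ∈ deck m '' κ, T ≤ (N.dev p).t → y₀ ≤ height p := by
      rintro κ m ⟨Δ, hΔ, hk, hab⟩
      refine ⟨_, tiling.invariant Δ hΔ m, shiftSet_cone _ _ ▸ hk.deck m, ?_⟩
      rintro _ ⟨p, hp, rfl⟩ hpT
      rw [N.dev_deck] at hpT
      exact hab p hp hpT
    have hmU := (hmem _).2 ⟨0, Or.inl rfl⟩
    have hmD := (hmem _).2 ⟨0, Or.inr rfl⟩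
    obtain ⟨U, hU, hUt, hUab⟩ := id hmU
    obtain ⟨D, hD, hDt, hDab⟩ := id hmD
    -- `U` and `D` are not equivalent, hence they represent the two orbits of tetrahedra.
    have hUD : ∀ m, deck m '' U ≠ D := by
      rintro m rfl
      have h1 := (hUt.deck m).vertexSet_unique hDt
      rw [shiftSet_cone] at h1
      have h2 := cone_injective h1
      rw [himg] at h2
      exact hne _ _ h2
    obtain ⟨σ, hσ, τ, hτ, -, hst⟩ := h_two
    have hrep : ∀ κ ∈ 𝒯.tets, ∃ m, κ = deck m '' U ∨ κ = deck m '' D := by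
      have hst' : ∀ κ κ' ρ : Set Cover, ∀ a b, κ = deck a '' ρ → κ' = deck b '' ρ →
          κ' = deck (b - a) '' κ := by
        rintro κ κ' ρ a b rfl rfl
        rw [deck_image_deck_image, add_sub_cancel]
      intro κ hκ
      obtain ⟨m, hm⟩ := hst κ hκ
      obtain ⟨a, ha⟩ := hst U hU
      obtain ⟨b, hb'⟩ := hst D hD
      rcases ha with ha | ha <;> rcases hb' with hb' | hb'
      · exact absurd (hst' _ _ _ _ _ ha hb').symm (hUD _)
      · rcases hm with hm | hm
        · exact ⟨_, Or.inl (hst' _ _ _ _ _ ha hm)⟩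
        · exact ⟨_, Or.inr (hst' _ _ _ _ _ hb' hm)⟩
      · rcases hm with hm | hm
        · exact ⟨_, Or.inr (hst' _ _ _ _ _ hb' hm)⟩
        · exact ⟨_, Or.inl (hst' _ _ _ _ _ ha hm)⟩
      · exact absurd (hst' _ _ _ _ _ ha hb').symm (hUD _)
    intro κ hκ
    obtain ⟨m, rfl | rfl⟩ := hrep κ hκ
    · exact hcl _ _ ⟨_, hmU, hUt, hUab⟩
    · exact hcl _ _ ⟨_, hmD, hDt, hDab⟩
  have hinj : Function.Injective N.dev := by
    have hcov : ∀ p : Cover, ∃ σ ∈ 𝒯.tets, p ∈ σ := fun p => by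
      have := mem_univ p
      rwa [← 𝒯.covers, mem_sUnion] at this
    intro p p' h
    obtain ⟨σ, hσ, hp⟩ := hcov p
    obtain ⟨σ', hσ', hp'⟩ := hcov p'
    obtain ⟨Δ, -, hs, hab⟩ := hall σ hσ
    obtain ⟨Δ', -, hs', hab'⟩ := hall σ' hσ'
    exact eq_of_dev_eq E hs hs' hab hab' hp hp' h
  have hpre : ∀ σ s, N.IsTet σ s → σ = N.dev ⁻¹' idealHull s := fun σ s h => by
    rw [← h.dev_image, preimage_image_eq _ hinj]
  refine ⟨o, x, y, hdet, fun σ => ⟨fun hσ => ?_, ?_⟩, fun Δ k h => ?_, hinj, ?_, fun h => ?_,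
    fun T' => ?_⟩
  · obtain ⟨Δ, hΔ, hs, -⟩ := hall σ hσ
    obtain ⟨k, hk⟩ := (hmem Δ).1 hΔ
    exact ⟨k, Δ, hk, hs⟩
  · rintro ⟨k, Δ, hk, hs⟩
    obtain ⟨σ', hσ', hs', -⟩ := (hmem Δ).2 ⟨k, hk⟩
    rwa [hpre _ _ hs, ← hpre _ _ hs']
  · obtain ⟨σ', hσ', hs', -⟩ := (hmem Δ).2 ⟨k, h⟩
    rwa [← hpre _ _ hs']
  -- The inverse is continuous on each cone, and the cones are a locally finite closed cover.
  · have hlf : LocallyFinite fun s : cone '' 𝒯.cuspTriangles y₀ T =>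
        idealHull (s : Finset (OnePoint ℂ)) := by
      obtain ⟨Δ₁, Δ₂, h12⟩ := tiling.two
      refine locallyFinite_idealHull N.period_indep (F := {cone Δ₁, cone Δ₂})
        (by simp) ?_
      rintro _ ⟨Δ, hΔ, rfl⟩
      obtain ⟨m, rfl | rfl⟩ := h12 Δ hΔ
      · exact ⟨_, Or.inl rfl, m, (shiftSet_cone _ _).symm⟩
      · exact ⟨_, Or.inr rfl, m, (shiftSet_cone _ _).symm⟩
    have hne : Nonempty Cover := by
      obtain ⟨p, -⟩ := E.surj ⟨0, max (φ y₀) 1, by positivity⟩ (le_max_left _ _)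
      exact ⟨p⟩
    have hg : ∀ p, Function.invFun N.dev (N.dev p) = p := Function.leftInverse_invFun hinj
    refine ⟨Function.invFun N.dev, hg, ?_⟩
    refine (hlf.continuousOn_iUnion ?_ ?_).mono ?_
    · rintro ⟨_, Δ, ⟨σ, -, hs, -⟩, rfl⟩
      exact hs.1.isClosed_idealHull
    · rintro ⟨_, Δ, ⟨σ, -, hs, -⟩, rfl⟩
      obtain ⟨f, hfc, hf, -⟩ := hs.exists_section
      refine hfc.congr fun x hx => ?_
      conv_lhs => rw [← hf x hx]
      exact hg _
    · rintro _ ⟨p, rfl⟩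
      have := mem_univ p
      rw [← 𝒯.covers, mem_sUnion] at this
      obtain ⟨σ, hσ, hp⟩ := this
      obtain ⟨Δ, hΔ, hs, -⟩ := hall σ hσ
      refine mem_iUnion.2 ⟨⟨cone Δ, Δ, hΔ, rfl⟩, ?_⟩
      exact hs.dev_image ▸ mem_image_of_mem _ hp
  · refine ⟨φ (max h y₀), fun p hp => ?_⟩
    obtain ⟨q, hq, hqe⟩ := E.surj (N.dev p)
      ((E.strictMono.monotoneOn self_mem_Ici (mem_Ici.2 (le_max_right h y₀))
        (le_max_right h y₀)).trans hp)
    rw [hinj hqe] at hq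
    rw [E.dev_t p hq, E.strictMono.le_iff_le (mem_Ici.2 (le_max_right h y₀)) hq] at hp
    exact (le_max_left _ _).trans hp
  · obtain ⟨h, hh, hle⟩ := E.unbounded T'
    refine ⟨h, fun p hp => hle.trans ?_⟩
    rw [E.dev_t p (hh.trans hp)]
    exact E.strictMono.monotoneOn hh (hh.trans hp) hp

end GeometricTriangulation

end DrilledAnanas

/-! ### Trees from a height function -/

section Tree

variable {V : Type*} {G : SimpleGraph V} {h : V → ℕ} {root : V}

theorem reachable_of_descent (hdesc : ∀ v, v ≠ root → ∃ w, G.Adj v w ∧ h w < h v) (v : V) :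
    G.Reachable root v := by
  induction hn : h v using Nat.strong_induction_on generalizing v with
  | _ n ih =>
    by_cases hv : v = root
    · rw [hv]
    · obtain ⟨w, hvw, hlt⟩ := hdesc v hv
      exact (ih (h w) (hn ▸ hlt) w rfl).trans hvw.symm.reachable

/-- A graph in which adjacent vertices have different heights and in which every vertex other than
the root has exactly one lower neighbour is a tree. -/
theorem isTree_of_descent (hne : ∀ v w, G.Adj v w → h v ≠ h w)
    (hdesc : ∀ v, v ≠ root → ∃ w, G.Adj v w ∧ h w < h v)
    (huniq : ∀ v w w', G.Adj v w → G.Adj v w' → h w < h v → h w' < h v → w = w') :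
    G.IsTree := by
  have : Nonempty V := ⟨root⟩
  refine ⟨⟨fun v w => (reachable_of_descent hdesc v).symm.trans (reachable_of_descent hdesc w)⟩,
    fun v c hc => ?_⟩
  classical
  -- Both neighbours of a highest vertex of a cycle would be lower neighbours.
  obtain ⟨u, hu, hmax⟩ := c.support.toFinset.exists_max_image h
    ⟨v, by simp⟩
  rw [List.mem_toFinset] at hu
  have hc' := hc.rotate hu
  have hmem : ∀ w ∈ (c.rotate u hu).support, h w ≤ h u := fun w hw => by
    refine hmax w ?_
    rw [List.mem_toFinset]
    exact (SimpleGraph.Walk.mem_support_rotate_iff c u hu).1 hw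
  set d := c.rotate u hu
  have hnn : ¬ d.Nil := hc'.not_nil
  have h1 := d.adj_snd hnn
  have h2 := d.adj_penultimate hnn
  have l1 := lt_of_le_of_ne (hmem _ (d.getVert_mem_support _)) (hne _ _ h1).symm
  have l2 := lt_of_le_of_ne (hmem _ (d.getVert_mem_support _)) (hne _ _ h2)
  exact hc'.snd_ne_penultimate (huniq u _ _ h1 h2.symm l1 l2)

/-- Descending from `v` to the root gives a path on which `v` is a highest vertex. -/
theorem exists_low_path (hdesc : ∀ v, v ≠ root → ∃ w, G.Adj v w ∧ h w < h v) (v : V) :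
    ∃ q : G.Walk root v, q.IsPath ∧ ∀ x ∈ q.support, h x ≤ h v := by
  induction hn : h v using Nat.strong_induction_on generalizing v with
  | _ n ih =>
    subst hn
    by_cases hv : v = root
    · subst hv
      exact ⟨SimpleGraph.Walk.nil, by simp, by simp⟩
    · obtain ⟨w, hvw, hlt⟩ := hdesc v hv
      obtain ⟨q, hq, hqm⟩ := ih _ hlt w rfl
      refine ⟨q.concat hvw.symm, hq.concat (fun hmem => (hqm v hmem).not_gt hlt) _, ?_⟩
      intro x hx
      rw [SimpleGraph.Walk.support_concat, List.mem_append, List.mem_singleton] at hx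
      rcases hx with hx | rfl
      · exact (hqm x hx).trans hlt.le
      · exact le_rfl

/-- Heights are compared in the same way as distances from the root. -/
theorem height_lt_of_dist_lt (hne : ∀ v w, G.Adj v w → h v ≠ h w)
    (hdesc : ∀ v, v ≠ root → ∃ w, G.Adj v w ∧ h w < h v)
    (huniq : ∀ v w w', G.Adj v w → G.Adj v w' → h w < h v → h w' < h v → w = w')
    {v w : V} (hvw : G.Adj v w) (hd : G.dist root v < G.dist root w) : h v < h w := by
  by_contra hcon
  have hwv : h w < h v := lt_of_le_of_ne (not_lt.1 hcon) (hne v w hvw).symm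
  have htree := isTree_of_descent hne hdesc huniq
  have hlen : ∀ u (q : G.Walk root u), q.IsPath → G.dist root u = q.length := fun u q hq => by
    obtain ⟨p, hp, hpl⟩ := (reachable_of_descent hdesc u).exists_path_of_dist
    have := (htree.isAcyclic.subsingleton_path root u).elim ⟨p, hp⟩ ⟨q, hq⟩
    have h' : p = q := congrArg Subtype.val this
    rw [← hpl, h']
  obtain ⟨q, hq, hqm⟩ := exists_low_path hdesc w
  have hqc : (q.concat hvw.symm).IsPath := hq.concat (fun hmem => (hqm v hmem).not_gt hwv) _
  rw [hlen _ _ hq, hlen _ _ hqc, SimpleGraph.Walk.length_concat] at hd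
  omega

end Tree

/-! ### Primitive vectors and slopes -/

/-- The determinant of two vectors of the lattice `ℤ²`. -/
def det (m n : ℤ × ℤ) : ℤ := m.1 * n.2 - m.2 * n.1

theorem det_add_left (m m' n : ℤ × ℤ) : det (m + m') n = det m n + det m' n := by
  simp [det]; ring
theorem det_sub_left (m m' n : ℤ × ℤ) : det (m - m') n = det m n - det m' n := by
  simp [det]; ring
theorem det_neg_left (m n : ℤ × ℤ) : det (-m) n = -det m n := by
  simp only [det, Prod.fst_neg, Prod.snd_neg]; ring
theorem det_add_right (m n n' : ℤ × ℤ) : det m (n + n') = det m n + det m n' := by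
  simp [det]; ring
theorem det_sub_right (m n n' : ℤ × ℤ) : det m (n - n') = det m n - det m n' := by
  simp [det]; ring
theorem det_neg_right (m n : ℤ × ℤ) : det m (-n) = -det m n := by
  simp only [det, Prod.fst_neg, Prod.snd_neg]; ring
theorem det_self (m : ℤ × ℤ) : det m m = 0 := by simp [det]; ring
theorem det_swap (m n : ℤ × ℤ) : det n m = -det m n := by simp only [det]; ring

/-- `x, y` is a basis of the lattice `ℤ²`. -/
def IsUnimodular (x y : ℤ × ℤ) : Prop := det x y = 1 ∨ det x y = -1

theorem isUnimodular_iff {x y} : IsUnimodular x y ↔ |det x y| = 1 := by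
  rw [IsUnimodular, abs_eq (by norm_num)]

namespace IsUnimodular

variable {x y : ℤ × ℤ} (h : IsUnimodular x y)
include h

theorem symm : IsUnimodular y x := by
  unfold IsUnimodular at *; rw [det_swap x y]; omega

theorem neg_right : IsUnimodular x (-y) := by
  unfold IsUnimodular at *; rw [det_neg_right]; omega

theorem neg_left : IsUnimodular (-x) y := by
  unfold IsUnimodular at *; rw [det_neg_left]; omega

theorem sub_right : IsUnimodular x (x - y) := by
  unfold IsUnimodular at *; rw [det_sub_right, det_self]; omega

theorem add_right : IsUnimodular x (x + y) := by
  unfold IsUnimodular at *; rw [det_add_right, det_self]; omega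

theorem isCoprime : IsCoprime x.1 x.2 := by
  rcases h with h | h <;> unfold det at h
  · exact ⟨y.2, -y.1, by linarith⟩
  · exact ⟨-y.2, y.1, by linarith⟩

theorem mul_self : det x y * det x y = 1 := by rcases h with h | h <;> rw [h] <;> norm_num

theorem cramer (m : ℤ × ℤ) : m = (det x y * det m y) • x - (det x y * det m x) • y := by
  have h2 := h.mul_self
  have e1 : det m y * x.1 - det m x * y.1 = det x y * m.1 := by simp only [det]; ring
  have e2 : det m y * x.2 - det m x * y.2 = det x y * m.2 := by simp only [det]; ring
  ext
  · simp only [Prod.fst_sub, Prod.smul_fst, smul_eq_mul]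
    linear_combination -m.1 * h2 - det x y * e1
  · simp only [Prod.snd_sub, Prod.smul_snd, smul_eq_mul]
    linear_combination -m.2 * h2 - det x y * e2

end IsUnimodular

/-- The primitive vector `(q, p)` of a slope `p / q`. -/
def slopeVec (r : OnePoint ℚ) : ℤ × ℤ := (slopeDen r, slopeNum r)

theorem slopeOf_slopeVec (r : OnePoint ℚ) : slopeOf (slopeVec r) = r := by
  induction r using OnePoint.rec with
  | infty => rfl
  | coe r =>
    have h : slopeVec (r : OnePoint ℚ) = ((r.den : ℤ), r.num) := rfl
    rw [h, slopeOf, if_neg (by simp)]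
    simp [Rat.num_div_den]

theorem isCoprime_slopeVec (r : OnePoint ℚ) : IsCoprime (slopeVec r).1 (slopeVec r).2 := by
  induction r using OnePoint.rec with
  | infty => exact isCoprime_one_right
  | coe r =>
    have h : slopeVec (r : OnePoint ℚ) = ((r.den : ℤ), r.num) := rfl
    rw [h, isCoprime_comm, Int.isCoprime_iff_nat_coprime]
    exact r.reduced

theorem slopeOf_neg (m : ℤ × ℤ) : slopeOf (-m) = slopeOf m := by
  simp [slopeOf]

theorem slopeVec_slopeOf {m : ℤ × ℤ} (h : IsCoprime m.1 m.2) :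
    slopeVec (slopeOf m) = m ∨ slopeVec (slopeOf m) = -m := by
  have pos : ∀ m : ℤ × ℤ, IsCoprime m.1 m.2 → 0 < m.1 → slopeVec (slopeOf m) = m := by
    intro m h h0
    have h1 : slopeVec (slopeOf m) =
        ((((m.2 : ℚ) / (m.1 : ℚ)).den : ℤ), ((m.2 : ℚ) / (m.1 : ℚ)).num) := by
      rw [slopeOf, if_neg h0.ne']; rfl
    have h2 : m.2.natAbs.Coprime m.1.natAbs := Int.isCoprime_iff_nat_coprime.1 h.symm
    rw [h1, Rat.num_div_eq_of_coprime h0 h2, Rat.den_div_eq_of_coprime h0 h2]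
  rcases lt_trichotomy m.1 0 with h0 | h0 | h0
  · right
    rw [← slopeOf_neg]
    exact pos (-m) h.neg_neg (by simpa using h0)
  · have h2 : IsUnit m.2 := by rw [h0] at h; exact isCoprime_zero_left.1 h
    have h1 : slopeVec (slopeOf m) = (0, 1) := by rw [slopeOf, if_pos h0]; rfl
    rw [h1]
    rcases Int.isUnit_iff.1 h2 with h2 | h2
    · left; ext <;> simp [h0, h2]
    · right; ext <;> simp [h0, h2]
  · exact Or.inl (pos m h h0)

theorem fareyGraph_adj {r s : OnePoint ℚ} :
    fareyGraph.Adj r s ↔ IsUnimodular (slopeVec r) (slopeVec s) := by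
  rw [isUnimodular_iff, ← abs_neg]
  have : -det (slopeVec r) (slopeVec s) = slopeNum r * slopeDen s - slopeDen r * slopeNum s := by
    simp [det, slopeVec]
  rw [this]
  rfl

theorem isUnimodular_slopeVec {x y : ℤ × ℤ} (h : IsUnimodular x y) :
    IsUnimodular (slopeVec (slopeOf x)) (slopeVec (slopeOf y)) := by
  rcases slopeVec_slopeOf h.isCoprime with e | e <;>
  rcases slopeVec_slopeOf h.symm.isCoprime with e' | e' <;> rw [e, e']
  · exact h
  · exact h.neg_right
  · exact h.neg_left
  · exact h.neg_left.neg_right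

theorem fareyGraph_adj_slopeOf {x y : ℤ × ℤ} (h : IsUnimodular x y) :
    fareyGraph.Adj (slopeOf x) (slopeOf y) := fareyGraph_adj.2 (isUnimodular_slopeVec h)

/-- Parallel primitive vectors have the same slope. -/
theorem slopeOf_eq_of_det_eq_zero {m : ℤ × ℤ} {r : OnePoint ℚ} (hm : IsCoprime m.1 m.2)
    (h : det m (slopeVec r) = 0) : slopeOf m = r := by
  have h' : m.1 * (slopeVec r).2 = m.2 * (slopeVec r).1 := by unfold det at h; linarith
  have hr := isCoprime_slopeVec r
  have d1 : m.1 ∣ (slopeVec r).1 :=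
    hm.dvd_of_dvd_mul_left ⟨(slopeVec r).2, by linarith⟩
  have d2 : (slopeVec r).1 ∣ m.1 :=
    hr.dvd_of_dvd_mul_right ⟨m.2, by linarith⟩
  rw [← slopeOf_slopeVec r]
  by_cases h0 : m.1 = 0
  · have : (slopeVec r).1 = 0 := by rw [h0] at d1; exact zero_dvd_iff.1 d1
    rw [slopeOf, slopeOf, if_pos h0, if_pos this]
  · have h1 : (slopeVec r).1 ≠ 0 := fun e => h0 (by rw [e] at d2; exact zero_dvd_iff.1 d2)
    rw [slopeOf, slopeOf, if_neg h0, if_neg h1, OnePoint.coe_eq_coe]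
    have e1 : (m.1 : ℚ) ≠ 0 := by exact_mod_cast h0
    have e2 : ((slopeVec r).1 : ℚ) ≠ 0 := by exact_mod_cast h1
    rw [div_eq_div_iff e1 e2]
    have : (m.2 : ℚ) * (slopeVec r).1 = m.1 * (slopeVec r).2 := by exact_mod_cast h'.symm
    rw [this]; ring

/-! ### Farey triangles -/

/-- The Farey triangle with vertices the slopes of `x`, `y` and `x - y`. -/
def fareyTri (x y : ℤ × ℤ) (h : IsUnimodular x y) : FareyTriangle :=
  ⟨{slopeOf x, slopeOf y, slopeOf (x - y)}, by
    rw [SimpleGraph.is3Clique_iff]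
    refine ⟨_, _, _, fareyGraph_adj_slopeOf h, fareyGraph_adj_slopeOf h.sub_right,
      fareyGraph_adj_slopeOf ?_, rfl⟩
    have := h.symm.sub_right.neg_right
    rwa [neg_sub] at this⟩

theorem fareyTri_val {x y : ℤ × ℤ} (h : IsUnimodular x y) :
    (fareyTri x y h).1 = {slopeOf x, slopeOf y, slopeOf (x - y)} := rfl

/-- An edge of the Farey complex lies in at most two triangles. -/
theorem eq_of_common_neighbour {x y : ℤ × ℤ} (h : IsUnimodular x y) {r : OnePoint ℚ}
    (hx : fareyGraph.Adj r (slopeOf x)) (hy : fareyGraph.Adj r (slopeOf y)) :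
    r = slopeOf (x + y) ∨ r = slopeOf (x - y) := by
  have key : ∀ z : ℤ × ℤ, IsCoprime z.1 z.2 → fareyGraph.Adj r (slopeOf z) →
      det (slopeVec r) z = 1 ∨ det (slopeVec r) z = -1 := by
    intro z hz hr
    have := fareyGraph_adj.1 hr
    rcases slopeVec_slopeOf hz with e | e <;> rw [e] at this
    · exact this
    · have := this.neg_right; rwa [neg_neg] at this
  have ex := key x h.isCoprime hx
  have ey := key y h.symm.isCoprime hy
  have hc := h.cramer (slopeVec r)
  rw [← slopeOf_slopeVec r]
  have aux : ∀ a b : ℤ, (a = 1 ∨ a = -1) → (b = 1 ∨ b = -1) → slopeVec r = a • x - b • y →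
      slopeOf (slopeVec r) = slopeOf (x + y) ∨ slopeOf (slopeVec r) = slopeOf (x - y) := by
    rintro a b (rfl | rfl) (rfl | rfl) e <;> rw [e]
    · right; simp
    · left; simp
    · left; rw [← slopeOf_neg]; congr 1; simp; abel
    · right; rw [← slopeOf_neg]; congr 1; simp; abel
  refine aux _ _ ?_ ?_ hc
  · rcases h with h | h <;> rcases ey with e | e <;> rw [h, e] <;> norm_num
  · rcases h with h | h <;> rcases ex with e | e <;> rw [h, e] <;> norm_num

/-- Every Farey triangle is of the form `fareyTri x y`, with any given vertex in the place of `x - y`. -/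
theorem exists_fareyTri (t : FareyTriangle) {r : OnePoint ℚ} (hr : r ∈ t.1) :
    ∃ x y h, t = fareyTri x y h ∧ r = slopeOf (x - y) := by
  obtain ⟨t, ht⟩ := t
  obtain ⟨a, b, hne, hab⟩ : ∃ a b, a ≠ b ∧ t.erase r = {a, b} := by
    apply Finset.card_eq_two.1
    rw [Finset.card_erase_of_mem hr, ht.2]
  have ha : a ∈ t.erase r := by rw [hab]; simp
  have hb : b ∈ t.erase r := by rw [hab]; simp
  rw [Finset.mem_erase] at ha hb
  have ht' : t = {a, b, r} := by
    change r ∈ t at hr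
    rw [← Finset.insert_erase hr, hab]
    ext; simp; tauto
  have hadj : IsUnimodular (slopeVec a) (slopeVec b) := fareyGraph_adj.1 (ht.1 ha.2 hb.2 hne)
  have hra : fareyGraph.Adj r (slopeOf (slopeVec a)) := by
    rw [slopeOf_slopeVec]; exact ht.1 hr ha.2 ha.1.symm
  have hrb : fareyGraph.Adj r (slopeOf (slopeVec b)) := by
    rw [slopeOf_slopeVec]; exact ht.1 hr hb.2 hb.1.symm
  rcases eq_of_common_neighbour hadj hra hrb with e | e
  · refine ⟨_, _, hadj.neg_right, Subtype.ext ?_, by rw [e, sub_neg_eq_add]⟩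
    rw [fareyTri_val, slopeOf_neg, sub_neg_eq_add, ← e, slopeOf_slopeVec, slopeOf_slopeVec]
    exact ht'
  · refine ⟨_, _, hadj, Subtype.ext ?_, e⟩
    rw [fareyTri_val, ← e, slopeOf_slopeVec, slopeOf_slopeVec]
    exact ht'

theorem card_fareyTriangle (t : FareyTriangle) : t.1.card = 3 := t.2.2

theorem slopeOf_ne {x y : ℤ × ℤ} (h : IsUnimodular x y) : slopeOf x ≠ slopeOf y :=
  (fareyGraph_adj_slopeOf h).ne

theorem slopeOf_sub_ne_add {x y : ℤ × ℤ} (h : IsUnimodular x y) :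
    slopeOf (x - y) ≠ slopeOf (x + y) := by
  intro e
  have h1 : IsCoprime (x - y).1 (x - y).2 := h.sub_right.symm.isCoprime
  have h2 : IsCoprime (x + y).1 (x + y).2 := h.add_right.symm.isCoprime
  have h3 : det (x - y) (x + y) = 2 * det x y := by simp [det]; ring
  have h4 : det (x - y) (x + y) = 0 := by
    have e1 := slopeVec_slopeOf h1
    have e2 := slopeVec_slopeOf h2
    rw [e] at e1
    rcases e1 with e1 | e1 <;> rcases e2 with e2 | e2 <;> rw [e1] at e2
    · rw [e2, det_self]
    · rw [e2, det_neg_left, det_self, neg_zero]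
    · rw [← e2, det_neg_right, det_self, neg_zero]
    · rw [neg_inj.1 e2, det_self]
  rcases h with h | h <;> rw [h] at h3 <;> omega

theorem notMem_fareyTri_neg {x y : ℤ × ℤ} (h : IsUnimodular x y) :
    slopeOf (x - y) ∉ (fareyTri x (-y) h.neg_right).1 := by
  rw [fareyTri_val, slopeOf_neg, sub_neg_eq_add]
  have h1 := slopeOf_ne h.sub_right
  have h2 : slopeOf (x - y) ≠ slopeOf y := by
    have := slopeOf_ne h.symm.sub_right
    rw [← slopeOf_neg (y - x), neg_sub] at this
    exact this.symm
  simp [h1.symm, h2, slopeOf_sub_ne_add h]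

/-- Changing the sign of `y` replaces the vertex `x - y` by the vertex `x + y`: it is the flip across
the edge opposite to `x - y`. -/
theorem fareyDual_adj_neg {x y : ℤ × ℤ} (h : IsUnimodular x y) :
    fareyDual.Adj (fareyTri x y h) (fareyTri x (-y) h.neg_right) := by
  have hn := notMem_fareyTri_neg h
  refine ⟨fun e => ?_, ?_⟩
  · rw [← e] at hn
    exact hn (by simp [fareyTri_val])
  · have : (fareyTri x y h).1 ∩ (fareyTri x (-y) h.neg_right).1 = {slopeOf x, slopeOf y} := by
      rw [fareyTri_val, Finset.insert_inter_of_mem (by simp [fareyTri_val]),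
        Finset.insert_inter_of_mem (by simp [fareyTri_val, slopeOf_neg]),
        Finset.singleton_inter_of_notMem hn]
      rfl
    rw [this, Finset.card_pair (slopeOf_ne h)]

theorem eq_fareyTri_neg {x y : ℤ × ℤ} (h : IsUnimodular x y) {t : FareyTriangle}
    (hadj : fareyDual.Adj (fareyTri x y h) t) (hn : slopeOf (x - y) ∉ t.1) :
    t = fareyTri x (-y) h.neg_right := by
  have hsub : (fareyTri x y h).1 ∩ t.1 ⊆ {slopeOf x, slopeOf y} := by
    intro r hr
    rw [Finset.mem_inter, fareyTri_val] at hr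
    simp only [Finset.mem_insert, Finset.mem_singleton] at hr ⊢
    rcases hr with ⟨hr | hr | hr, hrt⟩
    · exact Or.inl hr
    · exact Or.inr hr
    · rw [hr] at hrt; exact absurd hrt hn
  have heq := Finset.eq_of_subset_of_card_le hsub
    (by rw [hadj.2]; exact Finset.card_le_two)
  have hx : slopeOf x ∈ t.1 :=
    (Finset.mem_inter.1 (heq ▸ (by simp : slopeOf x ∈ ({slopeOf x, slopeOf y} : Finset _)))).2
  have hy : slopeOf y ∈ t.1 :=
    (Finset.mem_inter.1 (heq ▸ (by simp : slopeOf y ∈ ({slopeOf x, slopeOf y} : Finset _)))).2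
  obtain ⟨r, hr⟩ : ∃ r, (t.1.erase (slopeOf x)).erase (slopeOf y) = {r} := by
    apply Finset.card_eq_one.1
    rw [Finset.card_erase_of_mem (Finset.mem_erase.2 ⟨(slopeOf_ne h).symm, hy⟩),
      Finset.card_erase_of_mem hx, card_fareyTriangle]
  have hrm : r ∈ (t.1.erase (slopeOf x)).erase (slopeOf y) := by rw [hr]; simp
  simp only [Finset.mem_erase] at hrm
  have ht : t.1 = {slopeOf x, slopeOf y, r} := by
    rw [← hr, Finset.insert_erase (Finset.mem_erase.2 ⟨(slopeOf_ne h).symm, hy⟩),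
      Finset.insert_erase hx]
  refine Subtype.ext ?_
  rw [fareyTri_val, slopeOf_neg, sub_neg_eq_add, ht]
  rcases eq_of_common_neighbour h (t.2.1 hrm.2.2 hx hrm.2.1) (t.2.1 hrm.2.2 hy hrm.1) with e | e
  · rw [e]
  · exact absurd hrm.2.2 (e ▸ hn)

theorem exists_of_fareyDual_adj {t t' : FareyTriangle} (h : fareyDual.Adj t t') :
    ∃ x y, ∃ hxy : IsUnimodular x y, t = fareyTri x y hxy ∧ t' = fareyTri x (-y) hxy.neg_right := by
  obtain ⟨r, hr, hr'⟩ : ∃ r ∈ t.1, r ∉ t'.1 := by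
    by_contra! hcon
    have : t.1 = t'.1 := Finset.eq_of_subset_of_card_le hcon
      (by rw [card_fareyTriangle, card_fareyTriangle])
    exact h.1 (Subtype.ext this)
  obtain ⟨x, y, hxy, rfl, rfl⟩ := exists_fareyTri t hr
  exact ⟨x, y, hxy, rfl, eq_fareyTri_neg hxy h hr'⟩

theorem fareyTri_rotate {x y : ℤ × ℤ} (h : IsUnimodular x y) :
    fareyTri x y h = fareyTri y (y - x) h.symm.sub_right := by
  refine Subtype.ext ?_
  rw [fareyTri_val, fareyTri_val, sub_sub_cancel, ← slopeOf_neg (y - x), neg_sub]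
  ext; simp; tauto

theorem fareyTri_rotate' {x y : ℤ × ℤ} (h : IsUnimodular x y) :
    fareyTri x y h = fareyTri x (x - y) h.sub_right := by
  refine Subtype.ext ?_
  rw [fareyTri_val, fareyTri_val, sub_sub_cancel]
  ext; simp; tauto

theorem encard_neighborSet (t : FareyTriangle) : (fareyDual.neighborSet t).encard = 3 := by
  obtain ⟨r, hr⟩ : t.1.Nonempty := by rw [← Finset.card_pos, card_fareyTriangle]; norm_num
  obtain ⟨x, y, h, rfl, -⟩ := exists_fareyTri t hr
  have a1 := fareyDual_adj_neg h
  have a2 := fareyDual_adj_neg h.symm.sub_right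
  have a3 := fareyDual_adj_neg h.sub_right
  have n1 := notMem_fareyTri_neg h
  have n2 := notMem_fareyTri_neg h.symm.sub_right
  have n3 := notMem_fareyTri_neg h.sub_right
  rw [sub_sub_cancel] at n2 n3
  rw [← fareyTri_rotate] at a2
  rw [← fareyTri_rotate'] at a3
  have hset : fareyDual.neighborSet (fareyTri x y h) = {fareyTri x (-y) h.neg_right,
      fareyTri y (-(y - x)) h.symm.sub_right.neg_right,
      fareyTri x (-(x - y)) h.sub_right.neg_right} := by
    ext t
    rw [SimpleGraph.mem_neighborSet]
    constructor
    · intro hadj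
      obtain ⟨r, hr, hr'⟩ : ∃ r ∈ (fareyTri x y h).1, r ∉ t.1 := by
        by_contra! hcon
        have : (fareyTri x y h).1 = t.1 := Finset.eq_of_subset_of_card_le hcon
          (by rw [card_fareyTriangle, card_fareyTriangle])
        exact hadj.1 (Subtype.ext this)
      rw [fareyTri_val] at hr
      simp only [Finset.mem_insert, Finset.mem_singleton] at hr
      rcases hr with rfl | rfl | rfl
      · right; left
        rw [fareyTri_rotate] at hadj
        exact eq_fareyTri_neg _ hadj (by rwa [sub_sub_cancel])
      · right; right
        rw [fareyTri_rotate'] at hadj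
        exact eq_fareyTri_neg _ hadj (by rwa [sub_sub_cancel])
      · left
        exact eq_fareyTri_neg _ hadj hr'
    · rintro (rfl | rfl | rfl)
      · exact a1
      · exact a2
      · exact a3
  rw [hset]
  have e12 : fareyTri x (-y) h.neg_right ≠ fareyTri y (-(y - x)) h.symm.sub_right.neg_right := by
    intro e; rw [← e] at n2; exact n2 (by simp [fareyTri_val])
  have e13 : fareyTri x (-y) h.neg_right ≠ fareyTri x (-(x - y)) h.sub_right.neg_right := by
    intro e; rw [← e] at n3; exact n3 (by simp [fareyTri_val, slopeOf_neg])
  have e23 : fareyTri y (-(y - x)) h.symm.sub_right.neg_right ≠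
      fareyTri x (-(x - y)) h.sub_right.neg_right := by
    intro e; rw [← e] at n3; exact n3 (by simp [fareyTri_val])
  rw [Set.encard_insert_of_notMem (by rintro (e | e); exacts [e12 e, e13 e]), Set.encard_pair e23]
  norm_num

/-! ### The height of a Farey triangle over a root -/

/-- The symmetric bilinear form on `ℤ²` for which the three slopes of the root triangle `t₀` have
equal length. -/
def rootForm (t₀ : FareyTriangle) (m n : ℤ × ℤ) : ℤ :=
  ∑ k ∈ t₀.1, det m (slopeVec k) * det n (slopeVec k)

/-- The sum of the squared lengths of the three slopes of a triangle, for the quadratic form that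
makes the three slopes of the root triangle equally long. -/
def fareyHeight (t₀ t : FareyTriangle) : ℕ :=
  ∑ r ∈ t.1, (rootForm t₀ (slopeVec r) (slopeVec r)).toNat

variable {t₀ : FareyTriangle}

theorem rootForm_self_nonneg (m : ℤ × ℤ) : 0 ≤ rootForm t₀ m m :=
  Finset.sum_nonneg fun _ _ => mul_self_nonneg _

theorem cast_fareyHeight (t : FareyTriangle) :
    (fareyHeight t₀ t : ℤ) = ∑ r ∈ t.1, rootForm t₀ (slopeVec r) (slopeVec r) := by
  rw [fareyHeight, Nat.cast_sum]
  exact Finset.sum_congr rfl fun r _ => Int.toNat_of_nonneg (rootForm_self_nonneg _)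

theorem rootForm_slopeVec_slopeOf {m : ℤ × ℤ} (h : IsCoprime m.1 m.2) :
    rootForm t₀ (slopeVec (slopeOf m)) (slopeVec (slopeOf m)) = rootForm t₀ m m := by
  rcases slopeVec_slopeOf h with e | e <;> rw [e]
  exact Finset.sum_congr rfl fun k _ => by rw [det_neg_left]; ring

theorem rootForm_sub_self (x y : ℤ × ℤ) : rootForm t₀ (x - y) (x - y) =
    rootForm t₀ x x + rootForm t₀ y y - 2 * rootForm t₀ x y := by
  simp only [rootForm, Finset.mul_sum, ← Finset.sum_add_distrib, ← Finset.sum_sub_distrib]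
  exact Finset.sum_congr rfl fun k _ => by rw [det_sub_left]; ring

theorem rootForm_neg_right (x y : ℤ × ℤ) : rootForm t₀ x (-y) = -rootForm t₀ x y := by
  simp only [rootForm, ← Finset.sum_neg_distrib]
  exact Finset.sum_congr rfl fun k _ => by rw [det_neg_left]; ring

theorem rootForm_neg_neg (y : ℤ × ℤ) : rootForm t₀ (-y) (-y) = rootForm t₀ y y := by
  simp only [rootForm]
  exact Finset.sum_congr rfl fun k _ => by rw [det_neg_left]; ring

theorem fareyHeight_fareyTri {x y : ℤ × ℤ} (h : IsUnimodular x y) :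
    (fareyHeight t₀ (fareyTri x y h) : ℤ) =
      2 * rootForm t₀ x x + 2 * rootForm t₀ y y - 2 * rootForm t₀ x y := by
  have h2 : slopeOf y ≠ slopeOf (x - y) := by
    have := slopeOf_ne h.symm.sub_right
    rwa [← slopeOf_neg (y - x), neg_sub] at this
  rw [cast_fareyHeight, fareyTri_val, Finset.sum_insert, Finset.sum_insert, Finset.sum_singleton,
    rootForm_slopeVec_slopeOf h.isCoprime, rootForm_slopeVec_slopeOf h.symm.isCoprime,
    rootForm_slopeVec_slopeOf h.sub_right.symm.isCoprime, rootForm_sub_self]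
  · ring
  · simpa using h2
  · simp [slopeOf_ne h, slopeOf_ne h.sub_right]

/-- Two vectors of a basis of `ℤ²` are on the same side, or on opposite sides, of all slopes of a
Farey triangle at once. -/
theorem not_opposite_signs {x y k l : ℤ × ℤ} (h : IsUnimodular x y) (hkl : IsUnimodular k l)
    (hk : 0 < det x k * det y k) : 0 ≤ det x l * det y l := by
  by_contra! hl
  have hp : det x y * det k l = det x k * det y l - det x l * det y k := by
    simp only [det]; ring
  have h1 : (det x k * det y l) * (det x l * det y k) < 0 := by
    have := mul_neg_of_pos_of_neg hk hl
    calc _ = (det x k * det y k) * (det x l * det y l) := by ring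
      _ < 0 := this
  have h2 : det x k * det y l - det x l * det y k = 1 ∨
      det x k * det y l - det x l * det y k = -1 := by
    rw [← hp]
    rcases h with h | h <;> rcases hkl with h' | h' <;> rw [h, h'] <;> norm_num
  generalize det x k * det y l = a at *
  generalize det x l * det y k = b at *
  rcases mul_neg_iff.1 h1 with ⟨ha, hb⟩ | ⟨ha, hb⟩ <;> rcases h2 with h2 | h2 <;> omega

theorem mul_det_nonneg_of_pos {x y : ℤ × ℤ} (h : IsUnimodular x y) {k : OnePoint ℚ}
    (hk : k ∈ t₀.1) (hpos : 0 < det x (slopeVec k) * det y (slopeVec k)) {l : OnePoint ℚ}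
    (hl : l ∈ t₀.1) : 0 ≤ det x (slopeVec l) * det y (slopeVec l) := by
  by_cases hkl : k = l
  · rw [← hkl]; exact hpos.le
  · exact not_opposite_signs h (fareyGraph_adj.1 (t₀.2.1 hk hl hkl)) hpos

theorem exists_mul_det_ne_zero (t₀ : FareyTriangle) {x y : ℤ × ℤ} (h : IsUnimodular x y) :
    ∃ k ∈ t₀.1, det x (slopeVec k) * det y (slopeVec k) ≠ 0 := by
  by_contra! hcon
  have hsub : t₀.1 ⊆ {slopeOf x, slopeOf y} := by
    intro k hk
    simp only [Finset.mem_insert, Finset.mem_singleton]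
    rcases mul_eq_zero.1 (hcon k hk) with h0 | h0
    · exact Or.inl (slopeOf_eq_of_det_eq_zero h.isCoprime h0).symm
    · exact Or.inr (slopeOf_eq_of_det_eq_zero h.symm.isCoprime h0).symm
  have := (Finset.card_le_card hsub).trans Finset.card_le_two
  rw [card_fareyTriangle] at this
  omega

theorem exists_pos_of_rootForm_pos {x y : ℤ × ℤ} (hf : 0 < rootForm t₀ x y) :
    ∃ k ∈ t₀.1, 0 < det x (slopeVec k) * det y (slopeVec k) := by
  by_contra! hcon
  exact (Finset.sum_nonpos hcon).not_gt hf

theorem mul_det_nonneg {x y : ℤ × ℤ} (h : IsUnimodular x y) (hf : 0 < rootForm t₀ x y)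
    {k : OnePoint ℚ} (hk : k ∈ t₀.1) : 0 ≤ det x (slopeVec k) * det y (slopeVec k) := by
  obtain ⟨l, hl, hpos⟩ := exists_pos_of_rootForm_pos hf
  exact mul_det_nonneg_of_pos h hl hpos hk

theorem rootForm_ne_zero {x y : ℤ × ℤ} (h : IsUnimodular x y) : rootForm t₀ x y ≠ 0 := by
  have key : ∀ x y : ℤ × ℤ, IsUnimodular x y → ∀ k ∈ t₀.1,
      0 < det x (slopeVec k) * det y (slopeVec k) → 0 < rootForm t₀ x y := fun x y h k hk hpos =>
    Finset.sum_pos' (fun l hl => mul_det_nonneg_of_pos h hk hpos hl) ⟨k, hk, hpos⟩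
  obtain ⟨k, hk, hne⟩ := exists_mul_det_ne_zero t₀ h
  rcases lt_or_gt_of_ne hne with hlt | hgt
  · have := key x (-y) h.neg_right k hk (by rw [det_neg_left]; linarith)
    rw [rootForm_neg_right] at this
    omega
  · exact (key x y h k hk hgt).ne'

theorem fareyHeight_lt_iff {x y : ℤ × ℤ} (h : IsUnimodular x y) :
    fareyHeight t₀ (fareyTri x y h) < fareyHeight t₀ (fareyTri x (-y) h.neg_right) ↔
      0 < rootForm t₀ x y := by
  have h1 := fareyHeight_fareyTri (t₀ := t₀) h
  have h2 := fareyHeight_fareyTri (t₀ := t₀) h.neg_right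
  rw [rootForm_neg_neg, rootForm_neg_right] at h2
  omega

theorem lt_fareyHeight_iff {x y : ℤ × ℤ} (h : IsUnimodular x y) :
    fareyHeight t₀ (fareyTri x (-y) h.neg_right) < fareyHeight t₀ (fareyTri x y h) ↔
      rootForm t₀ x y < 0 := by
  have h1 := fareyHeight_fareyTri (t₀ := t₀) h
  have h2 := fareyHeight_fareyTri (t₀ := t₀) h.neg_right
  rw [rootForm_neg_neg, rootForm_neg_right] at h2
  omega

theorem fareyHeight_ne (t t' : FareyTriangle) (h : fareyDual.Adj t t') :
    fareyHeight t₀ t ≠ fareyHeight t₀ t' := by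
  obtain ⟨x, y, hxy, rfl, rfl⟩ := exists_of_fareyDual_adj h
  have := rootForm_ne_zero (t₀ := t₀) hxy
  rcases lt_or_gt_of_ne this with h | h
  · exact ((lt_fareyHeight_iff hxy).2 h).ne'
  · exact ((fareyHeight_lt_iff hxy).2 h).ne

/-- Flipping an edge lowers the height only if the edge is longer than the other two together. -/
theorem fareyHeight_lt_two_mul {x y : ℤ × ℤ} (h : IsUnimodular x y)
    (hlt : fareyHeight t₀ (fareyTri x (-y) h.neg_right) < fareyHeight t₀ (fareyTri x y h)) :
    (fareyHeight t₀ (fareyTri x y h) : ℤ) <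
      2 * rootForm t₀ (slopeVec (slopeOf (x - y))) (slopeVec (slopeOf (x - y))) := by
  rw [lt_fareyHeight_iff] at hlt
  rw [rootForm_slopeVec_slopeOf h.sub_right.symm.isCoprime, rootForm_sub_self,
    fareyHeight_fareyTri]
  omega

/-- If flips of two different edges lowered the height, each of these edges would account for more than
half of the height of `t`. -/
theorem lower_neighbour_unique (t t' t'' : FareyTriangle) (h' : fareyDual.Adj t t')
    (h'' : fareyDual.Adj t t'') (hl' : fareyHeight t₀ t' < fareyHeight t₀ t)
    (hl'' : fareyHeight t₀ t'' < fareyHeight t₀ t) : t' = t'' := by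
  obtain ⟨x, y, hxy, rfl, rfl⟩ := exists_of_fareyDual_adj h'
  obtain ⟨u, v, huv, e, rfl⟩ := exists_of_fareyDual_adj h''
  have h1 := fareyHeight_lt_two_mul hxy hl'
  rw [e] at hl''
  have h2 := fareyHeight_lt_two_mul huv hl''
  rw [← e] at h2
  by_cases hr : slopeOf (x - y) = slopeOf (u - v)
  · symm
    refine eq_fareyTri_neg hxy h'' ?_
    rw [hr]
    exact notMem_fareyTri_neg huv
  · exfalso
    have hsum : ∑ r ∈ ({slopeOf (x - y), slopeOf (u - v)} : Finset (OnePoint ℚ)),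
        rootForm t₀ (slopeVec r) (slopeVec r) ≤
        ∑ r ∈ (fareyTri x y hxy).1, rootForm t₀ (slopeVec r) (slopeVec r) := by
      refine Finset.sum_le_sum_of_subset_of_nonneg ?_ fun r _ _ => rootForm_self_nonneg _
      intro r hr
      simp only [Finset.mem_insert, Finset.mem_singleton] at hr
      rcases hr with rfl | rfl
      · simp [fareyTri_val]
      · rw [e]; simp [fareyTri_val]
    rw [Finset.sum_pair hr, ← cast_fareyHeight] at hsum
    omega

/-- If no flip lowers the height, then the form is positive on the pairs `x, y`, on `y, y - x` and on
`x, x - y`.  For a slope of the root triangle with determinants `a`, `b` with `x`, `y`, this gives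
`0 ≤ a b`, `0 ≤ b (b - a)` and `0 ≤ a (a - b)`, so that one of `a`, `b`, `a - b` vanishes, and the
slope is a vertex of `t`. -/
theorem exists_lower_neighbour (t : FareyTriangle) (ht : t ≠ t₀) :
    ∃ t', fareyDual.Adj t t' ∧ fareyHeight t₀ t' < fareyHeight t₀ t := by
  by_contra! hcon
  obtain ⟨r, hr⟩ : t.1.Nonempty := by rw [← Finset.card_pos, card_fareyTriangle]; norm_num
  obtain ⟨x, y, h, rfl, -⟩ := exists_fareyTri t hr
  have key : ∀ u v (huv : IsUnimodular u v), fareyTri x y h = fareyTri u v huv →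
      0 < rootForm t₀ u v := by
    intro u v huv e
    have h1 := hcon _ (e ▸ fareyDual_adj_neg huv)
    rw [e] at h1
    have h2 := rootForm_ne_zero (t₀ := t₀) huv
    rw [← not_lt, lt_fareyHeight_iff] at h1
    omega
  have k1 := key _ _ _ rfl
  have k2 := key _ _ _ (fareyTri_rotate h)
  have k3 := key _ _ _ (fareyTri_rotate' h)
  have hsub : t₀.1 ⊆ (fareyTri x y h).1 := by
    intro k hk
    have n1 := mul_det_nonneg h k1 hk
    have n2 := mul_det_nonneg h.symm.sub_right k2 hk
    have n3 := mul_det_nonneg h.sub_right k3 hk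
    rw [det_sub_left] at n2 n3
    have hx := slopeOf_eq_of_det_eq_zero (m := x) (r := k) h.isCoprime
    have hy := slopeOf_eq_of_det_eq_zero (m := y) (r := k) h.symm.isCoprime
    have hxy := slopeOf_eq_of_det_eq_zero (m := x - y) (r := k) h.sub_right.symm.isCoprime
    rw [det_sub_left] at hxy
    generalize det x (slopeVec k) = a at *
    generalize det y (slopeVec k) = b at *
    have : a = 0 ∨ b = 0 ∨ a - b = 0 := by
      by_contra! hne
      obtain ⟨ha, hb, hab⟩ := hne
      rcases lt_or_gt_of_ne hab with hlt | hgt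
      · rcases lt_or_gt_of_ne ha with ha | ha
        · rcases lt_or_gt_of_ne hb with hb | hb
          · exact (mul_neg_of_neg_of_pos hb (by linarith : 0 < b - a)).not_ge n2
          · exact (mul_neg_of_neg_of_pos ha hb).not_ge n1
        · exact (mul_neg_of_pos_of_neg ha hlt).not_ge n3
      · rcases lt_or_gt_of_ne hb with hb | hb
        · rcases lt_or_gt_of_ne ha with ha | ha
          · exact (mul_neg_of_neg_of_pos ha hgt).not_ge n3
          · exact (mul_neg_of_pos_of_neg ha hb).not_ge n1
        · exact (mul_neg_of_pos_of_neg hb (by linarith : b - a < 0)).not_ge n2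
    rw [fareyTri_val]
    simp only [Finset.mem_insert, Finset.mem_singleton]
    rcases this with h0 | h0 | h0
    · exact Or.inl (hx h0).symm
    · exact Or.inr (Or.inl (hy h0).symm)
    · exact Or.inr (Or.inr (hxy h0).symm)
  exact ht (Subtype.ext (Finset.eq_of_subset_of_card_le hsub
    (by rw [card_fareyTriangle, card_fareyTriangle])).symm)

theorem isTree_fareyDual (t₀ : FareyTriangle) : fareyDual.IsTree :=
  isTree_of_descent (h := fareyHeight t₀) (root := t₀) fareyHeight_ne exists_lower_neighbour
    lower_neighbour_unique

/-- A Farey triangle of greatest height would have only one neighbour. -/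
theorem infinite_fareyTriangle (t₀ : FareyTriangle) : Infinite FareyTriangle := by
  by_contra hcon
  rw [not_infinite_iff_finite] at hcon
  have : Nonempty FareyTriangle := ⟨t₀⟩
  obtain ⟨t, ht⟩ := Finite.exists_max (fareyHeight t₀)
  have hsub : (fareyDual.neighborSet t).Subsingleton := fun u hu v hv =>
    lower_neighbour_unique t u v hu hv (lt_of_le_of_ne (ht u) (fareyHeight_ne t u hu).symm)
      (lt_of_le_of_ne (ht v) (fareyHeight_ne t v hv).symm)
  have := Set.encard_le_one_iff_subsingleton.2 hsub
  rw [encard_neighborSet] at this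
  exact absurd this (by norm_num)

/-! ### Lengths of periods -/

/-- The Euclidean inner product of two complex numbers. -/
def cdot (z w : ℂ) : ℝ := z.re * w.re + z.im * w.im

/-- Selling's formula: the inner product in terms of the determinants with the three vectors of a
superbase. -/
theorem selling (per : ℤ × ℤ →+ ℂ) {e f : ℤ × ℤ} (h : IsUnimodular e f) (m n : ℤ × ℤ) :
    cdot (per m) (per n) =
      cdot (per f) (per f - per e) * (det m e * det n e : ℤ) +
      cdot (per e) (per e - per f) * (det m f * det n f : ℤ) +
      cdot (per e) (per f) * (det m (e - f) * det n (e - f) : ℤ) := by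
  have hs : ((det e f : ℤ) : ℝ) * (det e f : ℤ) = 1 := by exact_mod_cast h.mul_self
  have hm := congrArg per (h.cramer m)
  have hn := congrArg per (h.cramer n)
  rw [map_sub, map_zsmul, map_zsmul] at hm hn
  rw [hm, hn, det_sub_right, det_sub_right]
  simp only [cdot, zsmul_eq_mul, Complex.sub_re, Complex.sub_im, Complex.mul_re, Complex.mul_im,
    Complex.intCast_re, Complex.intCast_im]
  push_cast
  generalize ((det e f : ℤ) : ℝ) = s at *
  linear_combination ((det m f * (per e).re - det m e * (per f).re) *
    (det n f * (per e).re - det n e * (per f).re) + (det m f * (per e).im - det m e * (per f).im) *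
    (det n f * (per e).im - det n e * (per f).im)) * hs

/-- If the root triangle is acute, then basis vectors at an acute angle for the root form are at an
acute angle for the Euclidean metric. -/
theorem cdot_pos_of_rootForm_pos (per : ℤ × ℤ →+ ℂ) {e f : ℤ × ℤ} (h : IsUnimodular e f)
    (h1 : 0 < cdot (per f) (per f - per e)) (h2 : 0 < cdot (per e) (per e - per f))
    (h3 : 0 < cdot (per e) (per f)) {x y : ℤ × ℤ} (hxy : IsUnimodular x y)
    (hf : 0 < rootForm (fareyTri e f h) x y) : 0 < cdot (per x) (per y) := by
  have hprod : ∀ m : ℤ × ℤ, IsCoprime m.1 m.2 → det x (slopeVec (slopeOf m)) *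
      det y (slopeVec (slopeOf m)) = det x m * det y m := by
    intro m hm
    rcases slopeVec_slopeOf hm with e | e <;> rw [e]
    rw [det_neg_right, det_neg_right]; ring
  have nn : ∀ m : ℤ × ℤ, IsCoprime m.1 m.2 → slopeOf m ∈ (fareyTri e f h).1 →
      0 ≤ det x m * det y m := fun m hm hmem => by
    rw [← hprod m hm]; exact mul_det_nonneg hxy hf hmem
  have ne := nn e h.isCoprime (by simp [fareyTri_val])
  have nf := nn f h.symm.isCoprime (by simp [fareyTri_val])
  have nef := nn (e - f) h.sub_right.symm.isCoprime (by simp [fareyTri_val])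
  have hpos : 0 < det x e * det y e ∨ 0 < det x f * det y f ∨
      0 < det x (e - f) * det y (e - f) := by
    obtain ⟨k, hk, hkpos⟩ := exists_pos_of_rootForm_pos hf
    rw [fareyTri_val] at hk
    simp only [Finset.mem_insert, Finset.mem_singleton] at hk
    rcases hk with rfl | rfl | rfl
    · rw [hprod e h.isCoprime] at hkpos; exact Or.inl hkpos
    · rw [hprod f h.symm.isCoprime] at hkpos; exact Or.inr (Or.inl hkpos)
    · rw [hprod (e - f) h.sub_right.symm.isCoprime] at hkpos; exact Or.inr (Or.inr hkpos)
  rw [selling per h]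
  generalize det x e * det y e = A at *
  generalize det x f * det y f = B at *
  generalize det x (e - f) * det y (e - f) = C at *
  have ne' : (0 : ℝ) ≤ A := by exact_mod_cast ne
  have nf' : (0 : ℝ) ≤ B := by exact_mod_cast nf
  have nef' : (0 : ℝ) ≤ C := by exact_mod_cast nef
  rcases hpos with hp | hp | hp
  · have : (0 : ℝ) < A := by exact_mod_cast hp
    positivity
  · have : (0 : ℝ) < B := by exact_mod_cast hp
    positivity
  · have : (0 : ℝ) < C := by exact_mod_cast hp
    positivity

/-! ### Circuits of five ideal points and bistellar flips -/

/-- A linear relation between the light-like vectors of five ideal points, positive on `p` and `q`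
and negative on the three points of `B`: the segment `pq` crosses the triangle `B`. -/
structure IsCircuit (B : Finset (OnePoint ℂ)) (p q : OnePoint ℂ) (ρ : OnePoint ℂ →₀ ℝ) : Prop where
  card : B.card = 3
  left_notMem : p ∉ B
  right_notMem : q ∉ B
  ne : p ≠ q
  left : ρ p = 1
  right : ρ q = 1
  neg : ∀ v ∈ B, ρ v < 0
  support : ρ.support ⊆ insert p (insert q B)
  comb_eq : comb ρ = 0

theorem insert_erase_subset (B : Finset (OnePoint ℂ)) (p q v : OnePoint ℂ) :
    insert p (insert q (B.erase v)) ⊆ insert p (insert q B) :=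
  Finset.insert_subset_insert _ (Finset.insert_subset_insert _ (Finset.erase_subset _ _))

namespace IsCircuit

variable {B : Finset (OnePoint ℂ)} {p q : OnePoint ℂ} {ρ : OnePoint ℂ →₀ ℝ}
  (h : IsCircuit B p q ρ)
include h

theorem swap : IsCircuit B q p ρ :=
  ⟨h.card, h.right_notMem, h.left_notMem, h.ne.symm, h.right, h.left, h.neg,
    by rw [Finset.insert_comm]; exact h.support, h.comb_eq⟩

theorem apply_eq_zero {v} (hv : v ∉ insert p (insert q B)) : ρ v = 0 := by
  by_contra hne
  exact hv (h.support (Finsupp.mem_support_iff.2 hne))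

theorem isRep_add {s c z} (hc : IsRep s c z) {m : ℝ} {s' : Finset (OnePoint ℂ)}
    (h0 : ∀ v ∈ s', 0 ≤ c v + m * ρ v) (hs : ∀ v ∉ s', c v + m * ρ v = 0) :
    IsRep s' (c + m • ρ) z := by
  refine ⟨fun v => ?_, fun v hv => ?_, ?_⟩
  · rw [Finsupp.add_apply, Finsupp.smul_apply, smul_eq_mul]
    by_cases hv : v ∈ s'
    · exact h0 v hv
    · rw [hs v hv]
  · by_contra hv'
    exact (Finsupp.mem_support_iff.1 hv) (by
      rw [Finsupp.add_apply, Finsupp.smul_apply, smul_eq_mul]; exact hs v hv')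
  · rw [map_add, map_smul, h.comb_eq, smul_zero, add_zero, hc.2.2]

/-- Subtracting a multiple of the circuit makes the coordinate at `q`, if it is the smaller of the two, vanish. -/
theorem exists_down_aux {c z} (hc : IsRep (insert p (insert q B)) c z) (hle : c q ≤ c p) :
    ∃ m : ℝ, 0 ≤ m ∧ IsRep (insert p B) (c + -m • ρ) z := by
  refine ⟨c q, hc.1 q, h.isRep_add hc (fun v hv => ?_) fun v hv => ?_⟩
  · rcases Finset.mem_insert.1 hv with rfl | hv
    · rw [h.left]; linarith
    · have := mul_nonneg (hc.1 q) (neg_nonneg.2 (h.neg v hv).le)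
      have := hc.1 v
      linarith
  · by_cases hq : v = q
    · rw [hq, h.right]; ring
    · have hv' : v ∉ insert p (insert q B) := by
        simp only [Finset.mem_insert, not_or] at hv ⊢
        exact ⟨hv.1, hq, hv.2⟩
      rw [h.apply_eq_zero hv', Finsupp.notMem_support_iff.1 fun h' => hv' (hc.2.1 h')]
      ring

/-- A point of the union of the three new tetrahedra lies in one of the two old ones. -/
theorem exists_down {c z} (hc : IsRep (insert p (insert q B)) c z) :
    ∃ m : ℝ, 0 ≤ m ∧ (IsRep (insert p B) (c + -m • ρ) z ∨ IsRep (insert q B) (c + -m • ρ) z) := by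
  rcases le_total (c q) (c p) with hle | hle
  · obtain ⟨m, hm, hr⟩ := h.exists_down_aux hc hle
    exact ⟨m, hm, Or.inl hr⟩
  · obtain ⟨m, hm, hr⟩ := h.swap.exists_down_aux (by rwa [Finset.insert_comm]) hle
    exact ⟨m, hm, Or.inr hr⟩

/-- A point of the union of the two old tetrahedra lies in one of the three new ones. -/
theorem exists_up {c z} (hc : IsRep (insert p B) c z) :
    ∃ v ∈ B, z ∈ idealHull (insert p (insert q (B.erase v))) := by
  have hne : B.Nonempty := Finset.card_pos.1 (by rw [h.card]; norm_num)
  -- The largest multiple of the circuit that can be added before a coordinate becomes negative.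
  obtain ⟨v, hv, hmin⟩ := Finset.exists_min_image B (fun v => c v / -ρ v) hne
  have hm0 : 0 ≤ c v / -ρ v := div_nonneg (hc.1 v) (neg_nonneg.2 (h.neg v hv).le)
  have hcq : c q = 0 := Finsupp.notMem_support_iff.1 fun h' => by
    rcases Finset.mem_insert.1 (hc.2.1 h') with h1 | h1
    exacts [h.ne h1.symm, h.right_notMem h1]
  refine ⟨v, hv, mem_idealHull.2 ⟨c + (c v / -ρ v) • ρ, h.isRep_add hc (fun w hw => ?_)
    fun w hw => ?_⟩⟩
  · rcases Finset.mem_insert.1 hw with rfl | hw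
    · rw [h.left]; have := hc.1 w; linarith
    · rcases Finset.mem_insert.1 hw with rfl | hw
      · rw [h.right, hcq]; linarith
      · have hw := Finset.mem_of_mem_erase hw
        have h1 := (le_div_iff₀ (neg_pos.2 (h.neg w hw))).1 (hmin w hw)
        linarith
  · by_cases hwv : w = v
    · rw [hwv]
      have := (h.neg v hv).ne
      field_simp
      ring
    · have hw' : w ∉ insert p (insert q B) := by
        simp only [Finset.mem_insert, Finset.mem_erase, not_or, not_and] at hw ⊢
        exact ⟨hw.1, hw.2.1, hw.2.2 hwv⟩
      rw [h.apply_eq_zero hw', Finsupp.notMem_support_iff.1 fun h' => hw' (by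
        rcases Finset.mem_insert.1 (hc.2.1 h') with h1 | h1
        · rw [h1]; exact Finset.mem_insert_self _ _
        · exact Finset.mem_insert_of_mem (Finset.mem_insert_of_mem h1))]
      ring

theorem notMem_erase {v : OnePoint ℂ} (hv : v ∈ B) : v ∉ insert p (insert q (B.erase v)) := by
  simp only [Finset.mem_insert, Finset.mem_erase, not_or]
  exact ⟨fun e => h.left_notMem (e ▸ hv), fun e => h.right_notMem (e ▸ hv), fun e => e.1 rfl⟩

theorem le_of_down_eq {v : OnePoint ℂ} (hv : v ∈ B) {c c' : OnePoint ℂ →₀ ℝ} {m m' : ℝ}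
    (hc : c v = 0) (hc' : 0 ≤ c' v) (he : c + -m • ρ = c' + -m' • ρ) : m' ≤ m := by
  have := DFunLike.congr_fun he v
  simp only [Finsupp.add_apply, Finsupp.smul_apply, smul_eq_mul, hc] at this
  nlinarith [h.neg v hv]

/-- The three new tetrahedra meet face to face. -/
theorem eq_of_down_eq {v v' : OnePoint ℂ} (hv : v ∈ B) (hv' : v' ∈ B) {c c' z z'} {m m' : ℝ}
    (hc : IsRep (insert p (insert q (B.erase v))) c z)
    (hc' : IsRep (insert p (insert q (B.erase v'))) c' z')
    (he : c + -m • ρ = c' + -m' • ρ) : c = c' := by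
  have h1 : c v = 0 := Finsupp.notMem_support_iff.1 fun h' => h.notMem_erase hv (hc.2.1 h')
  have h2 : c' v' = 0 := Finsupp.notMem_support_iff.1 fun h' => h.notMem_erase hv' (hc'.2.1 h')
  have h3 : m = m' := le_antisymm (h.le_of_down_eq hv' h2 (hc.1 v') he.symm)
    (h.le_of_down_eq hv h1 (hc'.1 v) he)
  rw [h3] at he
  exact add_right_cancel he

/-- The coefficient of the circuit at `v` is not zero, so `v` can be exchanged for `q`. -/
theorem isTetVertexSet (hσ : IsTetVertexSet (insert p B)) {v : OnePoint ℂ} (hv : v ∈ B) :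
    IsTetVertexSet (insert p (insert q (B.erase v))) := by
  refine ⟨?_, linearIndependent_iff_comb.2 fun c hc h0 => ?_⟩
  · rw [Finset.card_insert_of_notMem, Finset.card_insert_of_notMem, Finset.card_erase_of_mem hv,
      h.card]
    · exact fun h' => h.right_notMem (Finset.mem_of_mem_erase h')
    · rw [Finset.mem_insert]
      rintro (h' | h')
      exacts [h.ne h', h.left_notMem (Finset.mem_of_mem_erase h')]
  · have h1 : c - c q • ρ = 0 := by
      refine linearIndependent_iff_comb.1 hσ.2 _ (fun w hw => ?_) ?_
      · by_contra hw'
        refine (Finsupp.mem_support_iff.1 hw) ?_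
        rw [Finsupp.sub_apply, Finsupp.smul_apply, smul_eq_mul]
        by_cases hwq : w = q
        · rw [hwq, h.right]; ring
        · have hw2 : w ∉ insert p (insert q B) := by
            simp only [Finset.mem_insert, not_or] at hw' ⊢
            exact ⟨hw'.1, hwq, hw'.2⟩
          rw [h.apply_eq_zero hw2, Finsupp.notMem_support_iff.1
            fun h' => hw2 (insert_erase_subset _ _ _ v (hc h'))]
          ring
      · rw [map_sub, map_smul, h0, h.comb_eq, smul_zero, sub_zero]
    have h2 : c v = 0 := Finsupp.notMem_support_iff.1 fun h' => h.notMem_erase hv (hc h')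
    have h3 := DFunLike.congr_fun h1 v
    rw [Finsupp.sub_apply, Finsupp.smul_apply, smul_eq_mul, h2, Finsupp.zero_apply, zero_sub,
      neg_eq_zero, mul_eq_zero, or_iff_left (h.neg v hv).ne] at h3
    rw [h3, zero_smul, sub_zero] at h1
    exact h1

/-- The two old tetrahedra and the three new ones have the same union. -/
theorem exists_mem_iff (z : H3) :
    (z ∈ idealHull (insert p B) ∨ z ∈ idealHull (insert q B)) ↔
      ∃ v ∈ B, z ∈ idealHull (insert p (insert q (B.erase v))) := by
  constructor
  · rintro (hz | hz) <;> obtain ⟨c, hc⟩ := mem_idealHull.1 hz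
    · exact h.exists_up hc
    · obtain ⟨v, hv, hz⟩ := h.swap.exists_up hc
      exact ⟨v, hv, by rwa [Finset.insert_comm]⟩
  · rintro ⟨v, -, hz⟩
    obtain ⟨c, hc⟩ := mem_idealHull.1 hz
    obtain ⟨m, -, hm | hm⟩ := h.exists_down (hc.mono (hc.2.1.trans (insert_erase_subset _ _ _ v)))
    · exact Or.inl (mem_idealHull.2 ⟨_, hm⟩)
    · exact Or.inr (mem_idealHull.2 ⟨_, hm⟩)

end IsCircuit

/-! ### Tetrahedra with vertices in a lattice -/

/-- The point of the lattice `o + per ℤ²` with index `k`, as an ideal point. -/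
def latticePoint (o : ℂ) (per : ℤ × ℤ →+ ℂ) (k : ℤ × ℤ) : OnePoint ℂ := ((o + per k : ℂ) : OnePoint ℂ)

section Lattice

variable {o : ℂ} {per : ℤ × ℤ →+ ℂ}

@[simp] theorem shift_latticePoint (m k : ℤ × ℤ) :
    shift (per m) (latticePoint o per k) = latticePoint o per (k + m) := by
  rw [latticePoint, latticePoint, shift_coe, map_add, add_assoc]

@[simp] theorem latticePoint_ne_infty (k : ℤ × ℤ) : latticePoint o per k ≠ OnePoint.infty :=
  OnePoint.coe_ne_infty _

@[simp] theorem infty_ne_latticePoint (k : ℤ × ℤ) : OnePoint.infty ≠ latticePoint o per k :=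
  OnePoint.infty_ne_coe _

theorem latticePoint_injective (hper : Function.Injective per) :
    Function.Injective (latticePoint o per) := fun _ _ h =>
  hper (add_left_cancel (OnePoint.coe_injective h))

variable (o per) in
/-- The tetrahedra that are cones from `∞` over the triangles of the standard triangulation of the
plane with vertices `o + per ℤ²` and edges in the directions `x`, `y` and `x - y`. -/
def cuspTets (x y : ℤ × ℤ) : Set (Finset (OnePoint ℂ)) :=
  {s | ∃ k, s = {OnePoint.infty, latticePoint o per k, latticePoint o per (k + x),
      latticePoint o per (k + y)} ∨
    s = {OnePoint.infty, latticePoint o per (k + x + y), latticePoint o per (k + x),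
      latticePoint o per (k + y)}}

variable (o per) in
/-- The tetrahedra spanned by the parallelograms with sides `x` and `y` of the lattice. -/
def flatTets (x y : ℤ × ℤ) : Set (Finset (OnePoint ℂ)) :=
  {s | ∃ k, s = {latticePoint o per k, latticePoint o per (k + x), latticePoint o per (k + y),
      latticePoint o per (k + x + y)}}

theorem cuspTets_swap (x y : ℤ × ℤ) : cuspTets o per y x = cuspTets o per x y := by
  ext s
  simp only [cuspTets, mem_ofPred_eq]
  refine exists_congr fun k => ?_
  rw [add_right_comm k y x, Finset.pair_comm (latticePoint o per (k + y))]

theorem cuspTets_neg_subset (x y : ℤ × ℤ) : cuspTets o per (-x) (-y) ⊆ cuspTets o per x y := by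
  rintro s ⟨k, rfl | rfl⟩
  · refine ⟨k - x - y, Or.inr ?_⟩
    rw [show k - x - y + x + y = k by abel, show k - x - y + x = k + -y by abel,
      show k - x - y + y = k + -x by abel, Finset.pair_comm (latticePoint o per (k + -x))]
  · refine ⟨k - x - y, Or.inl ?_⟩
    rw [show k - x - y + x = k + -y by abel, show k - x - y + y = k + -x by abel,
      Finset.pair_comm (latticePoint o per (k + -x)), show k + -x + -y = k - x - y by abel]

theorem cuspTets_neg (x y : ℤ × ℤ) : cuspTets o per (-x) (-y) = cuspTets o per x y := by
  refine (cuspTets_neg_subset x y).antisymm ?_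
  have := cuspTets_neg_subset (o := o) (per := per) (-x) (-y)
  rwa [neg_neg, neg_neg] at this

theorem cuspTets_sub_subset (x y : ℤ × ℤ) : cuspTets o per x (x - y) ⊆ cuspTets o per x y := by
  rintro s ⟨k, rfl | rfl⟩
  · refine ⟨k - y, Or.inr ?_⟩
    rw [show k - y + x + y = k + x by abel, show k - y + x = k + (x - y) by abel,
      show k - y + y = k by abel]
    congr 1
    ext; simp; tauto
  · refine ⟨k + (x - y), Or.inl ?_⟩
    rw [show k + (x - y) + y = k + x by abel, show k + (x - y) + x = k + x + (x - y) by abel]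
    congr 1
    ext; simp; tauto

theorem cuspTets_sub (x y : ℤ × ℤ) : cuspTets o per x (x - y) = cuspTets o per x y := by
  refine (cuspTets_sub_subset x y).antisymm ?_
  have := cuspTets_sub_subset (o := o) (per := per) x (x - y)
  rwa [sub_sub_cancel] at this

theorem cuspTets_sub' (x y : ℤ × ℤ) : cuspTets o per y (y - x) = cuspTets o per x y := by
  rw [cuspTets_sub, cuspTets_swap]

theorem eq_or_neg_of_slopeOf_eq {m n : ℤ × ℤ} (hm : IsCoprime m.1 m.2) (hn : IsCoprime n.1 n.2)
    (h : slopeOf m = slopeOf n) : m = n ∨ m = -n := by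
  rcases slopeVec_slopeOf hm with e | e <;> rcases slopeVec_slopeOf hn with e' | e' <;>
    rw [h] at e <;> rw [e] at e'
  · exact Or.inl e'
  · exact Or.inr e'
  · exact Or.inr (by rw [← e', neg_neg])
  · exact Or.inl (neg_injective e')

theorem cuspTets_eq_of_slopeOf_eq {x y x' y' : ℤ × ℤ} (h : IsUnimodular x y)
    (h' : IsUnimodular x' y') (hx : slopeOf x' = slopeOf x) (hy : slopeOf y' = slopeOf y)
    (hxy : slopeOf (x' - y') = slopeOf (x - y)) : cuspTets o per x' y' = cuspTets o per x y := by
  have ex := eq_or_neg_of_slopeOf_eq h'.isCoprime h.isCoprime hx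
  have ey := eq_or_neg_of_slopeOf_eq h'.symm.isCoprime h.symm.isCoprime hy
  have hne := slopeOf_sub_ne_add h
  rcases ex with rfl | rfl <;> rcases ey with rfl | rfl
  · rfl
  · rw [sub_neg_eq_add] at hxy
    exact absurd hxy.symm hne
  · rw [← slopeOf_neg, neg_sub, sub_neg_eq_add, add_comm] at hxy
    exact absurd hxy.symm hne
  · exact cuspTets_neg x y

/-- A standard triangulation with given set of vertices is determined by the slopes of its edges. -/
theorem cuspTets_eq_of_fareyTri_eq {x y x' y' : ℤ × ℤ} (h : IsUnimodular x y)
    (h' : IsUnimodular x' y') (he : fareyTri x' y' h' = fareyTri x y h) :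
    cuspTets o per x' y' = cuspTets o per x y := by
  have hv : ({slopeOf x', slopeOf y', slopeOf (x' - y')} : Finset (OnePoint ℚ)) =
      {slopeOf x, slopeOf y, slopeOf (x - y)} := congrArg Subtype.val he
  have h1 : slopeOf x' ∈ ({slopeOf x, slopeOf y, slopeOf (x - y)} : Finset (OnePoint ℚ)) := by
    rw [← hv]; simp
  have h2 : slopeOf y' ∈ ({slopeOf x, slopeOf y, slopeOf (x - y)} : Finset (OnePoint ℚ)) := by
    rw [← hv]; simp
  have h3 : slopeOf (x' - y') ∈ ({slopeOf x, slopeOf y, slopeOf (x - y)} : Finset (OnePoint ℚ)) := by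
    rw [← hv]; simp
  have n1 : slopeOf x' ≠ slopeOf y' := slopeOf_ne h'
  have n2 : slopeOf x' ≠ slopeOf (x' - y') := slopeOf_ne h'.sub_right
  have n3 : slopeOf y' ≠ slopeOf (x' - y') := by
    have := slopeOf_ne h'.symm.sub_right
    rwa [← slopeOf_neg (y' - x'), neg_sub] at this
  have e1 : slopeOf (y - x) = slopeOf (x - y) := by rw [← slopeOf_neg, neg_sub]
  simp only [Finset.mem_insert, Finset.mem_singleton] at h1 h2 h3
  rcases h1 with h1 | h1 | h1 <;> rcases h2 with h2 | h2 | h2 <;>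
    first | exact absurd (h1.trans h2.symm) n1 | skip
  all_goals
    rcases h3 with h3 | h3 | h3 <;>
      first | exact absurd (h1.trans h3.symm) n2 | exact absurd (h2.trans h3.symm) n3 | skip
  · exact cuspTets_eq_of_slopeOf_eq h h' h1 h2 h3
  · rw [← cuspTets_sub x y]
    exact cuspTets_eq_of_slopeOf_eq h.sub_right h' h1 h2 (by rw [h3, sub_sub_cancel])
  · rw [← cuspTets_swap x y]
    exact cuspTets_eq_of_slopeOf_eq h.symm h' h1 h2 (by rw [h3, e1])
  · rw [← cuspTets_sub' x y]
    exact cuspTets_eq_of_slopeOf_eq h.symm.sub_right h' h1 (by rw [h2, e1])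
      (by rw [h3, sub_sub_cancel])
  · rw [← cuspTets_sub x y, ← cuspTets_swap x (x - y)]
    exact cuspTets_eq_of_slopeOf_eq h.sub_right.symm h' h1 h2
      (by rw [h3, ← slopeOf_neg]; congr 1; abel)
  · rw [← cuspTets_sub' x y, ← cuspTets_swap y (y - x)]
    exact cuspTets_eq_of_slopeOf_eq h.symm.sub_right.symm h' (by rw [h1, e1]) h2
      (by rw [h3, ← slopeOf_neg]; congr 1; abel)

end Lattice

/-! ### Decompositions of a region into ideal tetrahedra, and their flips -/

/-- The ideal tetrahedra with vertex sets in `𝒮` form a triangulation of the region `R` that is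
invariant under the lattice `per` and has finite quotient.  Meeting face to face is expressed by the
uniqueness of barycentric coordinates. -/
structure IsDecomposition (per : ℤ × ℤ →+ ℂ) (R : Set H3) (𝒮 : Set (Finset (OnePoint ℂ))) :
    Prop where
  isTetVertexSet : ∀ s ∈ 𝒮, IsTetVertexSet s
  invariant : ∀ s ∈ 𝒮, ∀ m, shiftSet (per m) s ∈ 𝒮
  finite : ∃ F : Set (Finset (OnePoint ℂ)), F.Finite ∧ ∀ s ∈ 𝒮, ∃ s' ∈ F, ∃ m, s = shiftSet (per m) s'
  unique : ∀ s ∈ 𝒮, ∀ s' ∈ 𝒮, ∀ c c' p, IsRep s c p → IsRep s' c' p → c = c'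
  covers : ∀ p, p ∈ R ↔ ∃ s ∈ 𝒮, p ∈ idealHull s

theorem IsDecomposition.idealHull_subset {per : ℤ × ℤ →+ ℂ} {R : Set H3}
    {𝒮 : Set (Finset (OnePoint ℂ))} (hD : IsDecomposition per R 𝒮) {s} (hs : s ∈ 𝒮) :
    idealHull s ⊆ R := fun _ hp => (hD.covers _).2 ⟨s, hs, hp⟩

section Lattice

variable {o : ℂ} {per : ℤ × ℤ →+ ℂ} {x y : ℤ × ℤ}

theorem shiftSet_cuspTet₁ (m k : ℤ × ℤ) : shiftSet (per m) {OnePoint.infty, latticePoint o per k,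
      latticePoint o per (k + x), latticePoint o per (k + y)} =
    {OnePoint.infty, latticePoint o per (k + m), latticePoint o per (k + m + x),
      latticePoint o per (k + m + y)} := by
  simp only [shiftSet, Finset.image_insert, Finset.image_singleton, shift_infty, shift_latticePoint]
  rw [add_right_comm k m, add_right_comm k m]

theorem shiftSet_cuspTet₂ (m k : ℤ × ℤ) : shiftSet (per m) {OnePoint.infty,
      latticePoint o per (k + x + y), latticePoint o per (k + x), latticePoint o per (k + y)} =
    {OnePoint.infty, latticePoint o per (k + m + x + y), latticePoint o per (k + m + x),
      latticePoint o per (k + m + y)} := by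
  simp only [shiftSet, Finset.image_insert, Finset.image_singleton, shift_infty, shift_latticePoint]
  rw [add_right_comm k m, add_right_comm k m, add_right_comm (k + x) m]

theorem shiftSet_flatTet (m k : ℤ × ℤ) : shiftSet (per m) {latticePoint o per k,
      latticePoint o per (k + x), latticePoint o per (k + y), latticePoint o per (k + x + y)} =
    {latticePoint o per (k + m), latticePoint o per (k + m + x), latticePoint o per (k + m + y),
      latticePoint o per (k + m + x + y)} := by
  simp only [shiftSet, Finset.image_insert, Finset.image_singleton, shift_latticePoint]
  rw [add_right_comm k m, add_right_comm k m, add_right_comm (k + x) m]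

theorem shiftSet_mem_cuspTets {s} (hs : s ∈ cuspTets o per x y) (m : ℤ × ℤ) :
    shiftSet (per m) s ∈ cuspTets o per x y := by
  obtain ⟨k, rfl | rfl⟩ := hs
  · exact ⟨k + m, Or.inl (shiftSet_cuspTet₁ m k)⟩
  · exact ⟨k + m, Or.inr (shiftSet_cuspTet₂ m k)⟩

theorem shiftSet_mem_flatTets {s} (hs : s ∈ flatTets o per x y) (m : ℤ × ℤ) :
    shiftSet (per m) s ∈ flatTets o per x y := by
  obtain ⟨k, rfl⟩ := hs
  exact ⟨k + m, shiftSet_flatTet m k⟩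

theorem finite_cuspTets (o : ℂ) (per : ℤ × ℤ →+ ℂ) (x y : ℤ × ℤ) :
    ∃ F : Set (Finset (OnePoint ℂ)), F.Finite ∧
      ∀ s ∈ cuspTets o per x y, ∃ s' ∈ F, ∃ m, s = shiftSet (per m) s' := by
  refine ⟨{{OnePoint.infty, latticePoint o per 0, latticePoint o per (0 + x),
      latticePoint o per (0 + y)}, {OnePoint.infty, latticePoint o per (0 + x + y),
      latticePoint o per (0 + x), latticePoint o per (0 + y)}}, toFinite _, ?_⟩
  rintro s ⟨k, rfl | rfl⟩
  · exact ⟨_, Or.inl rfl, k, by rw [shiftSet_cuspTet₁ k 0, zero_add]⟩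
  · exact ⟨_, Or.inr rfl, k, by rw [shiftSet_cuspTet₂ k 0, zero_add]⟩

theorem finite_flatTets (o : ℂ) (per : ℤ × ℤ →+ ℂ) (x y : ℤ × ℤ) :
    ∃ F : Set (Finset (OnePoint ℂ)), F.Finite ∧
      ∀ s ∈ flatTets o per x y, ∃ s' ∈ F, ∃ m, s = shiftSet (per m) s' := by
  refine ⟨{{latticePoint o per 0, latticePoint o per (0 + x), latticePoint o per (0 + y),
    latticePoint o per (0 + x + y)}}, finite_singleton _, ?_⟩
  rintro s ⟨k, rfl⟩
  exact ⟨_, rfl, k, by rw [shiftSet_flatTet k 0, zero_add]⟩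

namespace IsUnimodular

theorem left_ne_zero (h : IsUnimodular x y) : x ≠ 0 := by
  rintro rfl; simp [IsUnimodular, det] at h

theorem ne (h : IsUnimodular x y) : x ≠ y := by
  rintro rfl; simp [IsUnimodular, det_self] at h

theorem add_ne_zero (h : IsUnimodular x y) : x + y ≠ 0 := fun e => by
  rw [add_eq_zero_iff_eq_neg] at e
  exact h.neg_right.ne e

/-- The diagonal in the direction `x - y` of one parallelogram is not a side of another triangle
of the triangulation in the directions `x`, `y`, `x - y`, except for the two adjacent ones. -/
theorem eq_of_diagonal (h : IsUnimodular x y) {k l : ℤ × ℤ} {z : ℤ × ℤ} (hz : z = 0 ∨ z = x + y)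
    (h1 : k + x = l + z ∨ k + x = l + x ∨ k + x = l + y)
    (h2 : k + y = l + z ∨ k + y = l + x ∨ k + y = l + y) : k = l := by
  have e : ∀ u v : ℤ × ℤ, u = v → det u y = det v y ∧ det x u = det x v := by
    rintro u _ rfl; exact ⟨rfl, rfl⟩
  rcases h1 with h1 | h1 | h1
  · exfalso
    rcases h2 with h2 | h2 | h2 <;> rcases hz with rfl | rfl <;>
    · have a1 := e _ _ h1
      have a2 := e _ _ h2
      simp only [det_add_left, det_add_right, det_self, add_zero] at a1 a2
      rcases h with h | h <;> omega
  · exact add_right_cancel h1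
  · exfalso
    rcases h2 with h2 | h2 | h2 <;> rcases hz with rfl | rfl <;>
    · have a1 := e _ _ h1
      have a2 := e _ _ h2
      simp only [det_add_left, det_add_right, det_self, add_zero] at a1 a2
      rcases h with h | h <;> omega

end IsUnimodular

variable (o per x y) in
/-- The triangle of ideal points that is pierced by the diagonal of the parallelogram `k`. -/
def flipFace (k : ℤ × ℤ) : Finset (OnePoint ℂ) :=
  {OnePoint.infty, latticePoint o per (k + x), latticePoint o per (k + y)}

variable (o per x y) in
/-- The parallelogram law, as a relation between the light-like vectors of the corners of the
parallelogram `k` and of `∞`. -/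
def flipRel (k : ℤ × ℤ) : OnePoint ℂ →₀ ℝ :=
  Finsupp.single (latticePoint o per k) 1 + Finsupp.single (latticePoint o per (k + x + y)) 1 -
    Finsupp.single (latticePoint o per (k + x)) 1 - Finsupp.single (latticePoint o per (k + y)) 1 -
    Finsupp.single OnePoint.infty (2 * cdot (per x) (per y))

/-- If the sides of a parallelogram are at an acute angle, then the geodesic joining the two ends of
its long diagonal pierces the ideal triangle of the short diagonal and `∞`. -/
theorem isCircuit_flipRel (hper : Function.Injective per) (h : IsUnimodular x y)
    (hpos : 0 < cdot (per x) (per y)) (k : ℤ × ℤ) :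
    IsCircuit (flipFace o per x y k) (latticePoint o per k) (latticePoint o per (k + x + y))
      (flipRel o per x y k) := by
  have inj : ∀ {k l : ℤ × ℤ}, latticePoint o per k = latticePoint o per l ↔ k = l :=
    (latticePoint_injective hper).eq_iff
  have hx := h.left_ne_zero
  have hy := h.symm.left_ne_zero
  have hne := h.ne
  have hadd := h.add_ne_zero
  have e1 : k ≠ k + x := by simpa using hx
  have e2 : k ≠ k + y := by simpa using hy
  have e3 : k ≠ k + x + y := by rw [add_assoc]; simpa using hadd
  have e4 : k + x ≠ k + y := by simpa using hne
  have e5 : k + x ≠ k + x + y := by simpa using hy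
  have e6 : k + y ≠ k + x + y := by rw [add_right_comm]; simpa using hx
  refine ⟨?_, ?_, ?_, ?_, ?_, ?_, ?_, ?_, ?_⟩
  · rw [flipFace, Finset.card_insert_of_notMem (by simp), Finset.card_pair (by rwa [Ne, inj])]
  · simp [flipFace, inj, e1, e2]
  · simp [flipFace, inj, e5.symm, e6.symm]
  · rwa [Ne, inj]
  · simp [flipRel, inj, e1.symm, e2.symm, e3.symm]
  · simp [flipRel, inj, e3, e5, e6]
  · intro v hv
    simp only [flipFace, Finset.mem_insert, Finset.mem_singleton] at hv
    rcases hv with rfl | rfl | rfl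
    · simpa [flipRel, Finsupp.single_apply] using hpos
    · simp [flipRel, inj, e1, e4.symm, e5.symm]
    · simp [flipRel, inj, e2, e4, e6.symm]
  · intro v hv
    by_contra hv'
    refine Finsupp.mem_support_iff.1 hv ?_
    simp only [flipFace, Finset.mem_insert, Finset.mem_singleton, not_or] at hv'
    obtain ⟨h1, h2, h3, h4, h5⟩ := hv'
    simp [flipRel, Ne.symm h1, Ne.symm h2, Ne.symm h3, Ne.symm h4,
      Ne.symm h5]
  · simp only [flipRel, map_add, map_sub, comb_single, latticePoint, nullVec_coe, nullVec_infty]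
    refine Prod.ext ?_ (Prod.ext ?_ ?_)
    · simp; ring
    · simp [norm_sq_eq, cdot]; ring
    · simp

theorem mem_cuspTets_iff {s} : s ∈ cuspTets o per x y ↔
    ∃ k, s = insert (latticePoint o per k) (flipFace o per x y k) ∨
      s = insert (latticePoint o per (k + x + y)) (flipFace o per x y k) := by
  simp only [cuspTets, mem_ofPred_eq, flipFace]
  refine exists_congr fun k => ?_
  rw [Finset.insert_comm OnePoint.infty (latticePoint o per k),
    Finset.insert_comm OnePoint.infty (latticePoint o per (k + x + y))]

/-- The three tetrahedra with vertices in the parallelogram `k` that share its long diagonal. -/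
theorem insert_insert_erase_flipFace (hper : Function.Injective per) (h : IsUnimodular x y)
    (k : ℤ × ℤ) (s : Finset (OnePoint ℂ)) :
    (∃ v ∈ flipFace o per x y k, s = insert (latticePoint o per k)
      (insert (latticePoint o per (k + x + y)) ((flipFace o per x y k).erase v))) ↔
    s = {latticePoint o per k, latticePoint o per (k + x), latticePoint o per (k + y),
      latticePoint o per (k + x + y)} ∨
    s = {OnePoint.infty, latticePoint o per (k + y), latticePoint o per (k + y + x),
      latticePoint o per (k + y + -y)} ∨
    s = {OnePoint.infty, latticePoint o per (k + y + x + -y), latticePoint o per (k + y + x),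
      latticePoint o per (k + y + -y)} := by
  have hne : latticePoint o per (k + x) ≠ latticePoint o per (k + y) := fun e =>
    h.ne (by simpa using latticePoint_injective hper e)
  have e1 : (flipFace o per x y k).erase OnePoint.infty =
      {latticePoint o per (k + x), latticePoint o per (k + y)} := by
    rw [flipFace, Finset.erase_insert (by simp)]
  have e2 : (flipFace o per x y k).erase (latticePoint o per (k + x)) =
      {OnePoint.infty, latticePoint o per (k + y)} := by
    rw [flipFace, Finset.insert_comm, Finset.erase_insert (by simp [hne])]
  have e3 : (flipFace o per x y k).erase (latticePoint o per (k + y)) =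
      {OnePoint.infty, latticePoint o per (k + x)} := by
    rw [flipFace, Finset.pair_comm, Finset.insert_comm, Finset.erase_insert (by simp [hne.symm])]
  rw [add_neg_cancel_right, show k + y + x = k + x + y by abel, add_neg_cancel_right]
  constructor
  · rintro ⟨v, hv, rfl⟩
    simp only [flipFace, Finset.mem_insert, Finset.mem_singleton] at hv
    rcases hv with rfl | rfl | rfl
    · left; rw [e1]; ext; simp; tauto
    · right; left; rw [e2]; ext; simp; tauto
    · right; right; rw [e3]; ext; simp; tauto
  · rintro (rfl | rfl | rfl)
    · refine ⟨OnePoint.infty, by simp [flipFace], ?_⟩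
      rw [e1]; ext; simp; tauto
    · refine ⟨latticePoint o per (k + x), by simp [flipFace], ?_⟩
      rw [e2]; ext; simp; tauto
    · refine ⟨latticePoint o per (k + y), by simp [flipFace], ?_⟩
      rw [e3]; ext; simp; tauto

/-- The tetrahedra that appear in the flip of all parallelograms, sorted by parallelograms. -/
theorem mem_flipped_iff (hper : Function.Injective per) (h : IsUnimodular x y) {s} :
    s ∈ cuspTets o per x (-y) ∪ flatTets o per x y ↔
      ∃ k, ∃ v ∈ flipFace o per x y k, s = insert (latticePoint o per k)
        (insert (latticePoint o per (k + x + y)) ((flipFace o per x y k).erase v)) := by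
  simp only [insert_insert_erase_flipFace hper h]
  constructor
  · rintro (⟨k, hk⟩ | ⟨k, hk⟩)
    · refine ⟨k - y, Or.inr ?_⟩
      rw [sub_add_cancel]; exact hk
    · exact ⟨k, Or.inl hk⟩
  · rintro ⟨k, hk | hk⟩
    · exact Or.inr ⟨k, hk⟩
    · exact Or.inl ⟨k + y, hk⟩

theorem left_mem_cuspTets (k : ℤ × ℤ) :
    insert (latticePoint o per k) (flipFace o per x y k) ∈ cuspTets o per x y :=
  mem_cuspTets_iff.2 ⟨k, Or.inl rfl⟩

theorem right_mem_cuspTets (k : ℤ × ℤ) :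
    insert (latticePoint o per (k + x + y)) (flipFace o per x y k) ∈ cuspTets o per x y :=
  mem_cuspTets_iff.2 ⟨k, Or.inr rfl⟩

/-- The vertical triangle over the short diagonal of the parallelogram `k` is not a face of a
tetrahedron over another parallelogram. -/
theorem eq_of_flipFace_subset (hper : Function.Injective per) (h : IsUnimodular x y) {k l : ℤ × ℤ}
    {s : Finset (OnePoint ℂ)} (hs : s = insert (latticePoint o per l) (flipFace o per x y l) ∨
      s = insert (latticePoint o per (l + x + y)) (flipFace o per x y l))
    (hk : flipFace o per x y k ⊆ s) : k = l := by
  have inj : ∀ {k l : ℤ × ℤ}, latticePoint o per k = latticePoint o per l ↔ k = l :=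
    (latticePoint_injective hper).eq_iff
  have h1 : latticePoint o per (k + x) ∈ s := hk (by simp [flipFace])
  have h2 : latticePoint o per (k + y) ∈ s := hk (by simp [flipFace])
  rcases hs with rfl | rfl
  · simp only [flipFace, Finset.mem_insert, Finset.mem_singleton, inj, latticePoint_ne_infty,
      false_or] at h1 h2
    exact h.eq_of_diagonal (Or.inl rfl) (by rwa [add_zero]) (by rwa [add_zero])
  · simp only [flipFace, Finset.mem_insert, Finset.mem_singleton, inj, latticePoint_ne_infty,
      false_or] at h1 h2
    exact h.eq_of_diagonal (Or.inr rfl) (by rwa [← add_assoc]) (by rwa [← add_assoc])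

/-- Flipping all parallelograms with sides `x` and `y` turns a decomposition into another one. -/
theorem IsDecomposition.flip (hper : Function.Injective per) (h : IsUnimodular x y)
    (hpos : 0 < cdot (per x) (per y)) {R : Set H3} {K : Set (Finset (OnePoint ℂ))}
    (hK : ∀ s ∈ K, OnePoint.infty ∉ s) (hD : IsDecomposition per R (cuspTets o per x y ∪ K)) :
    IsDecomposition per R (cuspTets o per x (-y) ∪ flatTets o per x y ∪ K) := by
  have hc := isCircuit_flipRel (o := o) hper h hpos
  have hnew := fun {s} => mem_flipped_iff (o := o) (s := s) hper h
  have hinf : ∀ k, OnePoint.infty ∈ flipFace o per x y k := fun k => by simp [flipFace]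
  -- Points of the new tetrahedra have unchanged coordinates, up to a multiple of the circuit, in
  -- one of the old tetrahedra.
  have down : ∀ k, ∀ v ∈ flipFace o per x y k, ∀ c z, IsRep (insert (latticePoint o per k)
      (insert (latticePoint o per (k + x + y)) ((flipFace o per x y k).erase v))) c z →
      ∃ m : ℝ, 0 ≤ m ∧ ∃ s, (s = insert (latticePoint o per k) (flipFace o per x y k) ∨
        s = insert (latticePoint o per (k + x + y)) (flipFace o per x y k)) ∧
        IsRep s (c + -m • flipRel o per x y k) z := by
    intro k v hv c z hr
    obtain ⟨m, hm, hr' | hr'⟩ :=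
      (hc k).exists_down (hr.mono (hr.2.1.trans (insert_erase_subset _ _ _ v)))
    · exact ⟨m, hm, _, Or.inl rfl, hr'⟩
    · exact ⟨m, hm, _, Or.inr rfl, hr'⟩
  have old : ∀ k s, (s = insert (latticePoint o per k) (flipFace o per x y k) ∨
      s = insert (latticePoint o per (k + x + y)) (flipFace o per x y k)) →
      s ∈ cuspTets o per x y ∪ K := fun k s hs => Or.inl (mem_cuspTets_iff.2 ⟨k, hs⟩)
  -- A positive multiple of the circuit would make the coordinates positive on all of the vertical
  -- triangle over the short diagonal, which belongs to no other parallelogram.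
  have zero : ∀ k l, k ≠ l → ∀ c z s (m : ℝ), 0 ≤ m → (∀ v, 0 ≤ c v) →
      (s = insert (latticePoint o per l) (flipFace o per x y l) ∨
        s = insert (latticePoint o per (l + x + y)) (flipFace o per x y l)) →
      IsRep s (c + -m • flipRel o per x y k) z → m = 0 := by
    intro k l hkl c z s m hm hc0 hs hr
    by_contra hm0
    refine hkl (eq_of_flipFace_subset (o := o) hper h hs fun v hv => hr.2.1 ?_)
    rw [Finsupp.mem_support_iff, Finsupp.add_apply, Finsupp.smul_apply, smul_eq_mul]
    have h1 := (hc k).neg v hv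
    have h2 := hc0 v
    have h3 : 0 < m := lt_of_le_of_ne hm (Ne.symm hm0)
    nlinarith
  -- On the lower tetrahedra the coordinate at `∞` vanishes, which excludes such a multiple.
  have mixed : ∀ k, ∀ v ∈ flipFace o per x y k, ∀ s' ∈ K, ∀ c c' z,
      IsRep (insert (latticePoint o per k)
        (insert (latticePoint o per (k + x + y)) ((flipFace o per x y k).erase v))) c z →
      IsRep s' c' z → c = c' := by
    intro k v hv s' hs' c c' z hr hr'
    obtain ⟨m, hm, s, hs, hd⟩ := down k v hv c z hr
    have he := hD.unique _ (old k s hs) _ (Or.inr hs') _ _ _ hd hr'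
    have h0 : c' OnePoint.infty = 0 := Finsupp.notMem_support_iff.1 fun h' => hK s' hs' (hr'.2.1 h')
    rw [← he, Finsupp.add_apply, Finsupp.smul_apply, smul_eq_mul] at h0
    have h1 := (hc k).neg _ (hinf k)
    have h2 := hr.1 OnePoint.infty
    have hm0 : m = 0 := by
      by_contra hm0
      have h3 : 0 < m := lt_of_le_of_ne hm (Ne.symm hm0)
      nlinarith
    rw [← he, hm0, neg_zero, zero_smul, add_zero]
  refine ⟨?_, ?_, ?_, ?_, ?_⟩
  · rintro s (hs | hs)
    · obtain ⟨k, v, hv, rfl⟩ := hnew.1 hs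
      exact (hc k).isTetVertexSet (hD.isTetVertexSet _ (Or.inl (left_mem_cuspTets k))) hv
    · exact hD.isTetVertexSet s (Or.inr hs)
  · rintro s ((hs | hs) | hs) m
    · exact Or.inl (Or.inl (shiftSet_mem_cuspTets hs m))
    · exact Or.inl (Or.inr (shiftSet_mem_flatTets hs m))
    · rcases hD.invariant s (Or.inr hs) m with h' | h'
      · exfalso
        have h1 : OnePoint.infty ∈ shiftSet (per m) s := by
          obtain ⟨k, h' | h'⟩ := h' <;> rw [h'] <;> simp
        obtain ⟨v, hv, he⟩ := Finset.mem_image.1 h1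
        have : v = OnePoint.infty := shift_injective _ (he.trans (shift_infty _).symm)
        exact hK s hs (this ▸ hv)
      · exact Or.inr h'
  · obtain ⟨F₁, hF₁, h₁⟩ := finite_cuspTets o per x (-y)
    obtain ⟨F₂, hF₂, h₂⟩ := finite_flatTets o per x y
    obtain ⟨F₃, hF₃, h₃⟩ := hD.finite
    refine ⟨F₁ ∪ F₂ ∪ F₃, (hF₁.union hF₂).union hF₃, ?_⟩
    rintro s ((hs | hs) | hs)
    · obtain ⟨s', hs', h'⟩ := h₁ s hs
      exact ⟨s', Or.inl (Or.inl hs'), h'⟩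
    · obtain ⟨s', hs', h'⟩ := h₂ s hs
      exact ⟨s', Or.inl (Or.inr hs'), h'⟩
    · obtain ⟨s', hs', h'⟩ := h₃ s (Or.inr hs)
      exact ⟨s', Or.inr hs', h'⟩
  · rintro s (hs | hs) s' (hs' | hs') c c' z hr hr'
    · obtain ⟨k, v, hv, rfl⟩ := hnew.1 hs
      obtain ⟨l, w, hw, rfl⟩ := hnew.1 hs'
      obtain ⟨m, hm, t, ht, hd⟩ := down k v hv c z hr
      obtain ⟨n, hn, u, hu, hd'⟩ := down l w hw c' z hr'
      have he := hD.unique _ (old k t ht) _ (old l u hu) _ _ _ hd hd'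
      by_cases hkl : k = l
      · subst hkl
        exact (hc k).eq_of_down_eq hv hw hr hr' he
      · have hm0 := zero k l hkl c z u m hm hr.1 hu (by rw [he]; exact hd')
        have hn0 := zero l k (Ne.symm hkl) c' z t n hn hr'.1 ht (by rw [← he]; exact hd)
        rwa [hm0, hn0, neg_zero, zero_smul, zero_smul, add_zero, add_zero] at he
    · obtain ⟨k, v, hv, rfl⟩ := hnew.1 hs
      exact mixed k v hv s' hs' c c' z hr hr'
    · obtain ⟨k, v, hv, rfl⟩ := hnew.1 hs'
      exact (mixed k v hv s hs c' c z hr' hr).symm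
    · exact hD.unique s (Or.inr hs) s' (Or.inr hs') c c' z hr hr'
  · intro z
    rw [hD.covers]
    constructor
    · rintro ⟨s, hs | hs, hz⟩
      · obtain ⟨k, hk⟩ := mem_cuspTets_iff.1 hs
        obtain ⟨v, hv, hz'⟩ := ((hc k).exists_mem_iff z).1 (by
          rcases hk with rfl | rfl
          exacts [Or.inl hz, Or.inr hz])
        exact ⟨_, Or.inl (hnew.2 ⟨k, v, hv, rfl⟩), hz'⟩
      · exact ⟨s, Or.inr hs, hz⟩
    · rintro ⟨s, hs | hs, hz⟩
      · obtain ⟨k, v, hv, rfl⟩ := hnew.1 hs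
        rcases ((hc k).exists_mem_iff z).2 ⟨v, hv, hz⟩ with hz' | hz'
        · exact ⟨_, Or.inl (left_mem_cuspTets k), hz'⟩
        · exact ⟨_, Or.inl (right_mem_cuspTets k), hz'⟩
      · exact ⟨s, Or.inr hs, hz⟩

end Lattice

/-! ### Triangulations of an embedded drilled ananas -/

theorem translate_mem_openIdealHull {a : ℂ} {s p} :
    H3.translate a p ∈ openIdealHull (shiftSet a s) ↔ p ∈ openIdealHull s := by
  have key : ∀ a s p, p ∈ openIdealHull s → H3.translate a p ∈ openIdealHull (shiftSet a s) := by
    intro a s p hp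
    obtain ⟨c, hc, hs⟩ := mem_openIdealHull.1 hp
    refine mem_openIdealHull.2 ⟨_, hc.shift a, ?_⟩
    rw [Finsupp.mapDomain_support_of_injective (shift_injective a), hs, shiftSet]
  refine ⟨fun h => ?_, key a s p⟩
  have := key (-a) _ _ h
  rwa [shiftSet_shiftSet, translate_translate, add_neg_cancel, shiftSet_zero,
    translate_zero] at this

/-- The geodesic from `∞` to a point of `ℂ` is the vertical line. -/
theorem mk_mem_openIdealHull (v : ℂ) {t : ℝ} (ht : 0 < t) :
    (⟨v, t, ht⟩ : H3) ∈ openIdealHull {OnePoint.infty, (v : OnePoint ℂ)} := by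
  refine ⟨fun w => if w = OnePoint.infty then t ^ 2 else 1, fun w _ => ?_, ?_⟩
  · beta_reduce
    split_ifs <;> positivity
  · rw [Finset.sum_pair (OnePoint.infty_ne_coe v)]
    simp [nullVec_infty, nullVec_coe, H3.vec, add_comm]

theorem exists_t_lt {u v : OnePoint ℂ} (hu : u ≠ OnePoint.infty) (hv : v ≠ OnePoint.infty) :
    ∃ T, ∀ p ∈ openIdealHull {u, v}, p.t < T := by
  induction u using OnePoint.rec with
  | infty => exact absurd rfl hu
  | coe u =>
  induction v using OnePoint.rec with
  | infty => exact absurd rfl hv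
  | coe v =>
  refine ⟨‖u‖ + ‖v‖ + 1, fun p hp => ?_⟩
  obtain ⟨c, hc, -⟩ := mem_openIdealHull.1 hp
  have := hc.sq_le (w := 0) (D := ‖u‖ + ‖v‖) (by simp) (fun w hw => by
    simp only [Finset.mem_insert, Finset.mem_singleton, OnePoint.coe_eq_coe] at hw
    rw [sub_zero]
    rcases hw with h | h <;> rw [h] <;> linarith [norm_nonneg u, norm_nonneg v])
  have := (sq_le_sq₀ p.t_pos.le (by positivity)).1 this
  linarith

namespace DrilledAnanas

/-- The developing map is an embedding into `ℍ³`, under which going out the cusp amounts to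
going up to `∞`. -/
structure IsEmbedded (N : DrilledAnanas) : Prop where
  injective : Function.Injective N.dev
  exists_inverse : ∃ g : H3 → Cover, (∀ p, g (N.dev p) = p) ∧ ContinuousOn g (range N.dev)
  height_of_t : ∀ h, ∃ T, ∀ p, T ≤ (N.dev p).t → h ≤ height p
  t_of_height : ∀ T, ∃ h, ∀ p, h ≤ height p → T ≤ (N.dev p).t

variable {N : DrilledAnanas}

theorem deck_preimage (m : ℤ × ℤ) {A B : Set H3} (h : ∀ p, p.translate (N.period m) ∈ B ↔ p ∈ A) :
    deck m '' (N.dev ⁻¹' A) = N.dev ⁻¹' B := by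
  ext p
  constructor
  · rintro ⟨q, hq, rfl⟩
    rw [mem_preimage, N.dev_deck, h]
    exact hq
  · intro hp
    refine ⟨deck (-m) p, ?_, by rw [deck_deck, neg_add_cancel, deck_zero]⟩
    rw [mem_preimage, ← h, ← N.dev_deck, deck_deck, neg_add_cancel, deck_zero]
    exact hp

theorem deck_preimage_idealHull (m : ℤ × ℤ) (s) : deck m '' (N.dev ⁻¹' idealHull s) =
    N.dev ⁻¹' idealHull (shiftSet (N.period m) s) :=
  deck_preimage m fun _ => translate_mem_idealHull

theorem deck_preimage_openIdealHull (m : ℤ × ℤ) (s) : deck m '' (N.dev ⁻¹' openIdealHull s) =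
    N.dev ⁻¹' openIdealHull (shiftSet (N.period m) s) :=
  deck_preimage m fun _ => translate_mem_openIdealHull

theorem cell_preimage {s r : Finset (OnePoint ℂ)} (hr : r ⊆ s) :
    N.cell (N.dev ⁻¹' idealHull s) r = N.dev ⁻¹' openIdealHull r :=
  inter_eq_right.2 (preimage_mono (openIdealHull_subset hr))

namespace IsEmbedded

variable (E : N.IsEmbedded)
include E

theorem isTet_preimage {s} (hs : IsTetVertexSet s) (hR : idealHull s ⊆ range N.dev) :
    N.IsTet (N.dev ⁻¹' idealHull s) s := by
  obtain ⟨g, hg, hgc⟩ := E.exists_inverse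
  refine ⟨hs, g, hgc.mono hR, fun z hz => ?_, ?_⟩
  · obtain ⟨p, rfl⟩ := hR hz
    rw [hg]
  · ext p
    constructor
    · rintro ⟨z, hz, rfl⟩
      obtain ⟨p, rfl⟩ := hR hz
      rwa [mem_preimage, hg]
    · exact fun hp => ⟨_, hp, hg p⟩

theorem eq_preimage {σ : Set Cover} {s} (h : N.IsTet σ s) : σ = N.dev ⁻¹' idealHull s := by
  rw [← h.dev_image, preimage_image_eq _ E.injective]

theorem entersCusp_iff {A : Set H3} (hA : A ⊆ range N.dev) :
    EntersCusp (N.dev ⁻¹' A) ↔ ∀ T : ℝ, ∃ z ∈ A, T ≤ z.t := by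
  constructor
  · intro h T
    obtain ⟨b, hb⟩ := E.t_of_height T
    obtain ⟨p, hp, hbp⟩ := h b
    exact ⟨_, hp, hb p hbp⟩
  · intro h b
    obtain ⟨T, hT⟩ := E.height_of_t b
    obtain ⟨z, hz, hzT⟩ := h T
    obtain ⟨p, rfl⟩ := hA hz
    exact ⟨p, hz, hT p hzT⟩

theorem entersCusp_edge {u v : OnePoint ℂ} (huv : u ≠ v)
    (hA : openIdealHull {u, v} ⊆ range N.dev) :
    EntersCusp (N.dev ⁻¹' openIdealHull {u, v}) ↔ u = OnePoint.infty ∨ v = OnePoint.infty := by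
  rw [E.entersCusp_iff hA]
  constructor
  · intro h
    by_contra! hc
    obtain ⟨T, hT⟩ := exists_t_lt hc.1 hc.2
    obtain ⟨z, hz, hzT⟩ := h T
    exact (hT z hz).not_ge hzT
  · have key : ∀ v : OnePoint ℂ, v ≠ OnePoint.infty → ∀ T : ℝ,
        ∃ z ∈ openIdealHull {OnePoint.infty, v}, T ≤ z.t := by
      intro v hv T
      induction v using OnePoint.rec with
      | infty => exact absurd rfl hv
      | coe v =>
        exact ⟨_, mk_mem_openIdealHull v (lt_max_of_lt_right one_pos : 0 < max T 1),
          le_max_left _ _⟩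
    rintro (rfl | rfl)
    · exact key v huv.symm
    · rw [Finset.pair_comm]; exact key u huv

section Triangulation

variable {𝒮 : Set (Finset (OnePoint ℂ))} (hD : IsDecomposition N.period (range N.dev) 𝒮)
include hD

theorem isTet_of_mem {s} (hs : s ∈ 𝒮) : N.IsTet (N.dev ⁻¹' idealHull s) s :=
  E.isTet_preimage (hD.isTetVertexSet s hs) (hD.idealHull_subset hs)

/-- The geometric ideal triangulation given by a decomposition of the image of the developing
map. -/
def triangulation : N.GeometricTriangulation where
  tets := {σ | ∃ s ∈ 𝒮, σ = N.dev ⁻¹' idealHull s}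
  isTet := by
    rintro σ ⟨s, hs, rfl⟩
    exact ⟨s, E.isTet_of_mem hD hs⟩
  invariant := by
    rintro σ ⟨s, hs, rfl⟩ m
    exact ⟨_, hD.invariant s hs m, deck_preimage_idealHull m s⟩
  finite := by
    obtain ⟨F, hF, h⟩ := hD.finite
    refine ⟨(fun s => N.dev ⁻¹' idealHull s) '' F, hF.image _, ?_⟩
    rintro σ ⟨s, hs, rfl⟩
    obtain ⟨s', hs', m, rfl⟩ := h s hs
    exact ⟨_, mem_image_of_mem _ hs', m, (deck_preimage_idealHull m s').symm⟩
  locallyFinite := by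
    obtain ⟨F, hF, h⟩ := hD.finite
    have h1 := (locallyFinite_idealHull N.period_indep hF h).preimage_continuous N.dev_continuous
    let e : {σ | ∃ s ∈ 𝒮, σ = N.dev ⁻¹' idealHull s} → 𝒮 :=
      fun σ => ⟨σ.2.choose, σ.2.choose_spec.1⟩
    have he : ∀ σ : {σ | ∃ s ∈ 𝒮, σ = N.dev ⁻¹' idealHull s}, (σ : Set Cover) = N.dev ⁻¹' idealHull (e σ : Finset (OnePoint ℂ)) :=
      fun σ => σ.2.choose_spec.2
    have h2 := h1.comp_injective (g := e) fun σ σ' h => Subtype.ext (by rw [he σ, he σ', h])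
    convert h2 using 2 with σ
    exact he σ
  covers := by
    refine eq_univ_of_forall fun p => ?_
    obtain ⟨s, hs, hp⟩ := (hD.covers (N.dev p)).1 (mem_range_self p)
    exact ⟨_, ⟨s, hs, rfl⟩, hp⟩
  faceToFace := by
    rintro _ ⟨s₁, hs, rfl⟩ _ ⟨s₁', hs', rfl⟩ s s' ht ht' r hr r' hr'
    obtain rfl := (E.isTet_of_mem hD hs).vertexSet_unique ht
    obtain rfl := (E.isTet_of_mem hD hs').vertexSet_unique ht'
    rw [cell_preimage hr, cell_preimage hr']
    by_cases he : r = r'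
    · exact Or.inl (by rw [he])
    · refine Or.inr (disjoint_left.2 fun p hp hp' => he ?_)
      obtain ⟨c, hc, rfl⟩ := mem_openIdealHull.1 hp
      obtain ⟨c', hc', rfl⟩ := mem_openIdealHull.1 hp'
      rw [hD.unique _ hs _ hs' c c' _ (hc.mono hr) (hc'.mono hr')]

theorem mem_tets {σ : Set Cover} : σ ∈ (E.triangulation hD).tets ↔
    ∃ s ∈ 𝒮, σ = N.dev ⁻¹' idealHull s := Iff.rfl

theorem exists_of_isTet {σ : Set Cover} {s} (hσ : σ ∈ (E.triangulation hD).tets)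
    (h : N.IsTet σ s) : s ∈ 𝒮 ∧ σ = N.dev ⁻¹' idealHull s := by
  obtain ⟨s', hs', rfl⟩ := hσ
  obtain rfl := (E.isTet_of_mem hD hs').vertexSet_unique h
  exact ⟨hs', rfl⟩

end Triangulation

/-! ### The cusp cellulation -/

section Cusp

variable {o : ℂ} {x y : ℤ × ℤ} {K : Set (Finset (OnePoint ℂ))}

/-- The tetrahedra of `K` do not meet the cusp, so the cusp cellulation is the standard triangulation
with directions `x`, `y`, `x - y`. -/
theorem inducesCuspTriangulation (h : IsUnimodular x y) (hK : ∀ s ∈ K, OnePoint.infty ∉ s)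
    (hD : IsDecomposition N.period (range N.dev) (cuspTets o N.period x y ∪ K)) :
    (E.triangulation hD).InducesCuspTriangulation (fareyTri x y h) := by
  have hper := period_injective N.period_indep
  have inj : ∀ {k l : ℤ × ℤ}, latticePoint o N.period k = latticePoint o N.period l ↔ k = l :=
    (latticePoint_injective hper).eq_iff
  have henter : ∀ s ∈ cuspTets o N.period x y ∪ K, ∀ u ∈ s, ∀ v ∈ s, u ≠ v →
      (EntersCusp (N.cell (N.dev ⁻¹' idealHull s) {u, v}) ↔
        u = OnePoint.infty ∨ v = OnePoint.infty) := by
    intro s hs u hu v hv huv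
    have hr : ({u, v} : Finset (OnePoint ℂ)) ⊆ s := by
      intro w hw
      simp only [Finset.mem_insert, Finset.mem_singleton] at hw
      rcases hw with rfl | rfl <;> assumption
    rw [cell_preimage hr]
    exact E.entersCusp_edge huv ((openIdealHull_subset hr).trans (hD.idealHull_subset hs))
  have hsub : ∀ {s : Finset (OnePoint ℂ)} {v}, OnePoint.infty ∈ s → v ∈ s →
      ({OnePoint.infty, v} : Finset (OnePoint ℂ)) ⊆ s := by
    intro s v h1 h2 w hw
    simp only [Finset.mem_insert, Finset.mem_singleton] at hw
    rcases hw with rfl | rfl <;> assumption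
  -- The vertices, other than `∞`, of a tetrahedron at the cusp.
  have hvert : ∀ s ∈ cuspTets o N.period x y ∪ K, OnePoint.infty ∈ s → ∃ k z : ℤ × ℤ,
      (z = 0 ∨ z = x + y) ∧ ∀ v ∈ s, v ≠ OnePoint.infty → v = latticePoint o N.period (k + z) ∨
        v = latticePoint o N.period (k + x) ∨ v = latticePoint o N.period (k + y) := by
    rintro s (⟨k, rfl | rfl⟩ | hs) hi
    · refine ⟨k, 0, Or.inl rfl, fun v hv hne => ?_⟩
      simp only [Finset.mem_insert, Finset.mem_singleton] at hv
      rw [add_zero]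
      exact hv.resolve_left hne
    · refine ⟨k, x + y, Or.inr rfl, fun v hv hne => ?_⟩
      simp only [Finset.mem_insert, Finset.mem_singleton] at hv
      rw [← add_assoc]
      exact hv.resolve_left hne
    · exact absurd hi (hK s hs)
  have hs₀ : ({OnePoint.infty, latticePoint o N.period 0, latticePoint o N.period (0 + x),
      latticePoint o N.period (0 + y)} : Finset (OnePoint ℂ)) ∈ cuspTets o N.period x y ∪ K :=
    Or.inl ⟨0, Or.inl rfl⟩
  refine ⟨⟨_, _, ⟨_, hs₀, rfl⟩, _, E.isTet_of_mem hD hs₀, OnePoint.infty, by simp,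
    latticePoint o N.period 0, by simp, by simp, rfl, (henter _ hs₀ _ (by simp) _ (by simp)
      (by simp)).2 (Or.inl rfl)⟩, ?_, ?_⟩
  · have key : ∀ e ∈ (E.triangulation hD).cuspEdges, ∃ k, e = N.dev ⁻¹' openIdealHull
        {OnePoint.infty, latticePoint o N.period k} := by
      rintro e ⟨σ, hσ, s, ht, u, hu, v, hv, huv, rfl, he⟩
      obtain ⟨hs, rfl⟩ := E.exists_of_isTet hD hσ ht
      have aux : ∀ v ∈ s, OnePoint.infty ∈ s → OnePoint.infty ≠ v →
          ∃ k, N.cell (N.dev ⁻¹' idealHull s) {OnePoint.infty, v} =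
            N.dev ⁻¹' openIdealHull {OnePoint.infty, latticePoint o N.period k} := by
        intro v hv hi hne
        obtain ⟨k, z, -, hall⟩ := hvert s hs hi
        rw [cell_preimage (hsub hi hv)]
        rcases hall v hv hne.symm with rfl | rfl | rfl
        exacts [⟨_, rfl⟩, ⟨_, rfl⟩, ⟨_, rfl⟩]
      rcases (henter s hs u hu v hv huv).1 he with rfl | rfl
      · exact aux v hv hu huv
      · rw [Finset.pair_comm]
        exact aux u hu hv huv.symm
    intro e he e' he'
    obtain ⟨k, rfl⟩ := key e he
    obtain ⟨l, rfl⟩ := key e' he'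
    refine ⟨l - k, ?_⟩
    rw [deck_preimage_openIdealHull]
    simp [shiftSet, Finset.image_insert, -map_sub]
  · ext r
    rw [fareyTri_val]
    constructor
    · rintro ⟨σ, hσ, s, ht, u, hu, v, hv, w, hw, huv, huw, hvw, he, he', m, hm, hmap, rfl⟩
      obtain ⟨hs, rfl⟩ := E.exists_of_isTet hD hσ ht
      have hui : u = OnePoint.infty := by
        by_contra hui
        exact hvw ((((henter s hs u hu v hv huv).1 he).resolve_left hui).trans
          (((henter s hs u hu w hw huw).1 he').resolve_left hui).symm)
      subst hui
      obtain ⟨k, z, hz, hall⟩ := hvert s hs hu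
      rw [cell_preimage (hsub hu hv), cell_preimage (hsub hu hw), deck_preimage_openIdealHull] at hmap
      have hR := (openIdealHull_subset (hsub hu hw)).trans (hD.idealHull_subset hs)
      have hR' : openIdealHull (shiftSet (N.period m) {OnePoint.infty, v}) ⊆ range N.dev := by
        refine (openIdealHull_subset ?_).trans (hD.idealHull_subset (hD.invariant s hs m))
        exact Finset.image_subset_image (hsub hu hv)
      have himg := congrArg (N.dev '' ·) hmap
      beta_reduce at himg
      rw [image_preimage_eq_of_subset hR, image_preimage_eq_of_subset hR'] at himg
      have hset := eq_of_openIdealHull_eq (by rw [card_shiftSet, Finset.card_pair huv])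
        (by rw [Finset.card_pair huw]) himg
      have hvw' : shift (N.period m) v = w := by
        have : shift (N.period m) v ∈ ({OnePoint.infty, w} : Finset (OnePoint ℂ)) := by
          rw [← hset]; exact Finset.mem_image_of_mem _ (by simp)
        simp only [Finset.mem_insert, Finset.mem_singleton] at this
        refine this.resolve_left fun h' => huv ?_
        exact (shift_injective _ (h'.trans (shift_infty (N.period m)).symm)).symm
      have hslope : m = x ∨ m = -x ∨ m = y ∨ m = -y ∨ m = x - y ∨ m = -(x - y) := by
        have hv' := hall v hv huv.symm
        have hw' := hall w hw huw.symm
        rcases hz with rfl | rfl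
        · rcases hv' with rfl | rfl | rfl <;> rcases hw' with rfl | rfl | rfl <;>
            first | exact absurd rfl hvw | (
              rw [shift_latticePoint, inj, add_assoc, add_right_inj] at hvw'
              grind)
        · rcases hv' with rfl | rfl | rfl <;> rcases hw' with rfl | rfl | rfl <;>
            first | exact absurd rfl hvw | (
              rw [shift_latticePoint, inj, add_assoc, add_right_inj] at hvw'
              grind)
      simp only [Finset.coe_insert, Finset.coe_singleton, mem_insert_iff, mem_singleton_iff]
      rcases hslope with rfl | rfl | rfl | rfl | rfl | rfl <;> simp [slopeOf_neg, -neg_sub]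
    · have key : ∀ i j : ℤ × ℤ, i ≠ j → latticePoint o N.period i ∈
          ({OnePoint.infty, latticePoint o N.period 0, latticePoint o N.period (0 + x),
            latticePoint o N.period (0 + y)} : Finset (OnePoint ℂ)) →
          latticePoint o N.period j ∈
          ({OnePoint.infty, latticePoint o N.period 0, latticePoint o N.period (0 + x),
            latticePoint o N.period (0 + y)} : Finset (OnePoint ℂ)) →
          slopeOf (j - i) ∈ (E.triangulation hD).cuspSlopes := by
        intro i j hij hi hj
        refine ⟨_, ⟨_, hs₀, rfl⟩, _, E.isTet_of_mem hD hs₀, OnePoint.infty, by simp, _, hi, _, hj,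
          by simp, by simp, by rwa [Ne, inj], (henter _ hs₀ _ (by simp) _ hi (by simp)).2 (Or.inl rfl),
          (henter _ hs₀ _ (by simp) _ hj (by simp)).2 (Or.inl rfl), j - i,
          sub_ne_zero.2 hij.symm, ?_, rfl⟩
        rw [cell_preimage (hsub (by simp) hi), cell_preimage (hsub (by simp) hj),
          deck_preimage_openIdealHull]
        simp [shiftSet, Finset.image_insert, -map_sub]
      intro hr
      simp only [Finset.coe_insert, Finset.coe_singleton, mem_insert_iff, mem_singleton_iff] at hr
      rcases hr with rfl | rfl | rfl
      · have := key 0 (0 + x) (by simpa using h.left_ne_zero.symm) (by simp) (by simp)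
        simpa using this
      · have := key 0 (0 + y) (by simpa using h.symm.left_ne_zero.symm) (by simp) (by simp)
        simpa using this
      · have := key (0 + y) (0 + x) (by simpa using h.ne.symm) (by simp) (by simp)
        simpa using this

end Cusp

end IsEmbedded

end DrilledAnanas

namespace DrilledAnanas.IsEmbedded

variable {N : DrilledAnanas} (E : N.IsEmbedded)
include E

/-! ### Flips are geometric 2-3 moves -/

variable {o : ℂ} {x y : ℤ × ℤ} {K : Set (Finset (OnePoint ℂ))}

/-- In the quotient by the lattice, the flip of all parallelograms with sides `x, y` is a single 2-3
move, and it suffices to look at one parallelogram. -/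
theorem isTwoThreeMove (h : IsUnimodular x y) (hpos : 0 < cdot (N.period x) (N.period y))
    (hK : ∀ s ∈ K, OnePoint.infty ∉ s)
    (hD : IsDecomposition N.period (range N.dev) (cuspTets o N.period x y ∪ K))
    (hD' : IsDecomposition N.period (range N.dev)
      (cuspTets o N.period x (-y) ∪ flatTets o N.period x y ∪ K)) :
    (E.triangulation hD).IsTwoThreeMove (E.triangulation hD') := by
  have hper := period_injective N.period_indep
  have hinj := latticePoint_injective (o := o) hper
  have hc := isCircuit_flipRel (o := o) hper h hpos 0
  have hs : ({OnePoint.infty, latticePoint o N.period (0 + x), latticePoint o N.period (0 + y),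
      latticePoint o N.period 0} : Finset (OnePoint ℂ)) =
      insert (latticePoint o N.period 0) (flipFace o N.period x y 0) := by
    rw [flipFace]; ext; simp; tauto
  have hs' : ({OnePoint.infty, latticePoint o N.period (0 + x), latticePoint o N.period (0 + y),
      latticePoint o N.period (0 + x + y)} : Finset (OnePoint ℂ)) =
      insert (latticePoint o N.period (0 + x + y)) (flipFace o N.period x y 0) := by
    rw [flipFace]; ext; simp; tauto
  have hne : latticePoint o N.period (0 + x) ≠ latticePoint o N.period (0 + y) := fun e =>
    h.ne (by simpa using hinj e)
  have e1 : (flipFace o N.period x y 0).erase OnePoint.infty =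
      {latticePoint o N.period (0 + x), latticePoint o N.period (0 + y)} := by
    rw [flipFace, Finset.erase_insert (by simp)]
  have e2 : (flipFace o N.period x y 0).erase (latticePoint o N.period (0 + x)) =
      {latticePoint o N.period (0 + y), OnePoint.infty} := by
    rw [flipFace, Finset.insert_comm, Finset.erase_insert ?_, Finset.pair_comm]
    simpa using hne
  have e3 : (flipFace o N.period x y 0).erase (latticePoint o N.period (0 + y)) =
      {OnePoint.infty, latticePoint o N.period (0 + x)} := by
    rw [flipFace, Finset.pair_comm, Finset.insert_comm, Finset.erase_insert ?_]
    simpa using hne.symm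
  have m1 : OnePoint.infty ∈ flipFace o N.period x y 0 := by simp [flipFace]
  have m2 : latticePoint o N.period (0 + x) ∈ flipFace o N.period x y 0 := by simp [flipFace]
  have m3 : latticePoint o N.period (0 + y) ∈ flipFace o N.period x y 0 := by simp [flipFace]
  have hmem : insert (latticePoint o N.period 0) (flipFace o N.period x y 0) ∈
      cuspTets o N.period x y ∪ K := Or.inl (left_mem_cuspTets 0)
  have hmem' : insert (latticePoint o N.period (0 + x + y)) (flipFace o N.period x y 0) ∈
      cuspTets o N.period x y ∪ K := Or.inl (right_mem_cuspTets 0)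
  have hnew : ∀ v ∈ flipFace o N.period x y 0, insert (latticePoint o N.period 0)
      (insert (latticePoint o N.period (0 + x + y)) ((flipFace o N.period x y 0).erase v)) ∈
      cuspTets o N.period x (-y) ∪ flatTets o N.period x y ∪ K := fun v hv =>
    Or.inl ((mem_flipped_iff hper h).2 ⟨0, v, hv, rfl⟩)
  have heq : ∀ s ∈ cuspTets o N.period x y ∪ K, ∀ s' ∈ cuspTets o N.period x y ∪ K,
      N.dev ⁻¹' idealHull s = N.dev ⁻¹' idealHull s' → s = s' := fun s hs s' hs' he =>
    (E.isTet_of_mem hD hs).vertexSet_unique (he ▸ E.isTet_of_mem hD hs')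
  have sh₁ : ∀ m, shiftSet (N.period m) (insert (latticePoint o N.period 0)
      (flipFace o N.period x y 0)) = insert (latticePoint o N.period m)
      (flipFace o N.period x y m) := by
    intro m
    rw [flipFace, flipFace, Finset.insert_comm, shiftSet_cuspTet₁, zero_add, Finset.insert_comm]
  have sh₂ : ∀ m, shiftSet (N.period m) (insert (latticePoint o N.period (0 + x + y))
      (flipFace o N.period x y 0)) = insert (latticePoint o N.period (m + x + y))
      (flipFace o N.period x y m) := by
    intro m
    rw [flipFace, flipFace, Finset.insert_comm, shiftSet_cuspTet₂, zero_add, Finset.insert_comm]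
  have csub : ∀ v ∈ flipFace o N.period x y 0,
      ({latticePoint o N.period 0, latticePoint o N.period (0 + x + y)} : Finset (OnePoint ℂ)) ⊆
      insert (latticePoint o N.period 0) (insert (latticePoint o N.period (0 + x + y))
        ((flipFace o N.period x y 0).erase v)) := fun v _ =>
    Finset.insert_subset_insert _ (Finset.singleton_subset_iff.2 (Finset.mem_insert_self _ _))
  have hτ : ∀ v ∈ flipFace o N.period x y 0, ∀ s, (flipFace o N.period x y 0).erase v = s →
      N.IsTet (N.dev ⁻¹' idealHull (insert (latticePoint o N.period 0)
        (insert (latticePoint o N.period (0 + x + y)) ((flipFace o N.period x y 0).erase v))))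
        (insert (latticePoint o N.period 0) (insert (latticePoint o N.period (0 + x + y)) s)) := by
    rintro v hv _ rfl
    exact E.isTet_of_mem hD' (hnew v hv)
  refine ⟨OnePoint.infty, latticePoint o N.period (0 + x), latticePoint o N.period (0 + y),
    latticePoint o N.period 0, latticePoint o N.period (0 + x + y), _, _, _, _, _,
    ⟨_, hmem, rfl⟩, ⟨_, hmem', rfl⟩, fun m he => ?_, ?_, ?_, ?_, hτ _ m3 _ e3, hτ _ m1 _ e1,
    hτ _ m2 _ e2, ?_, ?_, ?_, ?_⟩
  · rw [deck_preimage_idealHull] at he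
    have he := heq _ (hD.invariant _ hmem m) _ hmem' he
    rw [sh₁] at he
    have hm : (0 : ℤ × ℤ) = m := eq_of_flipFace_subset (o := o) hper h (Or.inl he.symm)
      (Finset.subset_insert _ _)
    rw [← hm] at he
    have := Finset.mem_insert_self (latticePoint o N.period 0) (flipFace o N.period x y 0)
    rw [he, Finset.mem_insert] at this
    exact this.elim hc.ne hc.left_notMem
  · rw [hs]; exact E.isTet_of_mem hD hmem
  · rw [hs']; exact E.isTet_of_mem hD hmem'
  · have : ({OnePoint.infty, latticePoint o N.period (0 + x), latticePoint o N.period (0 + y)} :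
        Finset (OnePoint ℂ)) = flipFace o N.period x y 0 := rfl
    rw [this, cell_preimage (Finset.subset_insert _ _), cell_preimage (Finset.subset_insert _ _)]
  · rw [cell_preimage (csub _ m3), cell_preimage (csub _ m1)]
  · rw [cell_preimage (csub _ m1), cell_preimage (csub _ m2)]
  · ext p
    have := hc.exists_mem_iff (N.dev p)
    constructor
    · rintro ((hp | hp) | hp)
      exacts [this.2 ⟨_, m3, hp⟩, this.2 ⟨_, m1, hp⟩, this.2 ⟨_, m2, hp⟩]
    · intro hp
      obtain ⟨v, hv, hp⟩ := this.1 hp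
      simp only [flipFace, Finset.mem_insert, Finset.mem_singleton] at hv
      rcases hv with rfl | rfl | rfl
      exacts [Or.inl (Or.inr hp), Or.inr hp, Or.inl (Or.inl hp)]
  · ext κ
    have shnew : ∀ m, ∀ v, shiftSet (N.period m) (insert (latticePoint o N.period 0)
        (insert (latticePoint o N.period (0 + x + y)) ((flipFace o N.period x y 0).erase v))) =
        insert (latticePoint o N.period m) (insert (latticePoint o N.period (m + x + y))
          ((flipFace o N.period x y m).erase (shift (N.period m) v))) := by
      intro m v
      have hB : (flipFace o N.period x y 0).image (shift (N.period m)) =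
          flipFace o N.period x y m := by
        simp only [flipFace, Finset.image_insert, Finset.image_singleton, shift_infty,
          shift_latticePoint]
        rw [add_right_comm, add_right_comm 0 y, zero_add]
      rw [shiftSet, Finset.image_insert, Finset.image_insert,
        Finset.image_erase (shift_injective _), hB, shift_latticePoint, shift_latticePoint,
        zero_add, show 0 + x + y + m = m + x + y by abel]
    constructor
    · rintro ⟨s, hs | hs, rfl⟩
      · right
        obtain ⟨k, v, hv, rfl⟩ := (mem_flipped_iff hper h).1 hs
        refine ⟨k, ?_⟩
        simp only [deck_preimage_idealHull, shnew, shift_infty, shift_latticePoint]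
        simp only [flipFace, Finset.mem_insert, Finset.mem_singleton] at hv
        rw [show 0 + x + k = k + x by abel, show 0 + y + k = k + y by abel]
        rcases hv with rfl | rfl | rfl
        exacts [Or.inr (Or.inl rfl), Or.inr (Or.inr rfl), Or.inl rfl]
      · left
        have hi : ∀ k t, OnePoint.infty ∈ t → t ∈ cuspTets o N.period x y ∪ K →
            N.dev ⁻¹' idealHull s ≠ deck k '' (N.dev ⁻¹' idealHull t) := by
          intro k t ht ht' he
          rw [deck_preimage_idealHull] at he
          have he := heq _ (Or.inr hs) _ (hD.invariant _ ht' k) he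
          refine hK s hs ?_
          rw [he]
          exact Finset.mem_image.2 ⟨_, ht, rfl⟩
        exact ⟨⟨s, Or.inr hs, rfl⟩, fun m => ⟨hi m _ (Finset.mem_insert_of_mem m1) hmem,
          hi m _ (Finset.mem_insert_of_mem m1) hmem'⟩⟩
    · rintro (⟨⟨s, hs, rfl⟩, hκ⟩ | ⟨m, hκ⟩)
      · rcases hs with hs | hs
        · exfalso
          obtain ⟨k, rfl | rfl⟩ := mem_cuspTets_iff.1 hs
          · exact (hκ k).1 (by rw [deck_preimage_idealHull, sh₁])
          · exact (hκ k).2 (by rw [deck_preimage_idealHull, sh₂])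
        · exact ⟨s, Or.inr hs, rfl⟩
      · have hfin : ∀ v ∈ flipFace o N.period x y 0,
            deck m '' (N.dev ⁻¹' idealHull (insert (latticePoint o N.period 0)
            (insert (latticePoint o N.period (0 + x + y)) ((flipFace o N.period x y 0).erase v)))) ∈
            (E.triangulation hD').tets := fun v hv =>
          (E.triangulation hD').invariant _ ⟨_, hnew v hv, rfl⟩ m
        rcases hκ with rfl | rfl | rfl
        exacts [hfin _ m3, hfin _ m1, hfin _ m2]

end DrilledAnanas.IsEmbedded

/-! ### The decomposition of each Farey triangle -/

variable {t₀ : FareyTriangle}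

/-- The flip by which `t` is reached from its lower neighbour. -/
theorem exists_flip {t : FareyTriangle} (ht : t ≠ t₀) : ∃ x y, ∃ h : IsUnimodular x y,
    t = fareyTri x (-y) h.neg_right ∧ fareyHeight t₀ (fareyTri x y h) < fareyHeight t₀ t := by
  obtain ⟨u, hu, hlt⟩ := exists_lower_neighbour t ht
  obtain ⟨x, y, h, rfl, rfl⟩ := exists_of_fareyDual_adj hu.symm
  exact ⟨x, y, h, rfl, hlt⟩

theorem fareyHeight_root_le (t : FareyTriangle) : fareyHeight t₀ t₀ ≤ fareyHeight t₀ t := by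
  induction hn : fareyHeight t₀ t using Nat.strong_induction_on generalizing t with
  | _ n ih =>
    subst hn
    by_cases ht : t = t₀
    · rw [ht]
    · obtain ⟨u, -, hlt⟩ := exists_lower_neighbour t ht
      exact (ih _ hlt u rfl).trans hlt.le

/-- The tetrahedra that have been cut off from the cusp by the flips along the path of the dual
tree from the root triangle to `t`. -/
def lowTets (o : ℂ) (per : ℤ × ℤ →+ ℂ) (t₀ t : FareyTriangle) : Set (Finset (OnePoint ℂ)) :=
  open Classical in
  if ht : t = t₀ then ∅
  else
    have hf := exists_flip ht
    flatTets o per hf.choose hf.choose_spec.choose ∪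
      lowTets o per t₀ (fareyTri hf.choose hf.choose_spec.choose hf.choose_spec.choose_spec.choose)
termination_by fareyHeight t₀ t
decreasing_by exact hf.choose_spec.choose_spec.choose_spec.2

theorem lowTets_root (o : ℂ) (per : ℤ × ℤ →+ ℂ) : lowTets o per t₀ t₀ = ∅ := by
  rw [lowTets, dif_pos rfl]

theorem exists_lowTets (o : ℂ) (per : ℤ × ℤ →+ ℂ) {t : FareyTriangle} (ht : t ≠ t₀) :
    ∃ x y, ∃ h : IsUnimodular x y, t = fareyTri x (-y) h.neg_right ∧
      fareyHeight t₀ (fareyTri x y h) < fareyHeight t₀ t ∧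
      lowTets o per t₀ t = flatTets o per x y ∪ lowTets o per t₀ (fareyTri x y h) := by
  have hf := exists_flip ht
  refine ⟨_, _, hf.choose_spec.choose_spec.choose, hf.choose_spec.choose_spec.choose_spec.1,
    hf.choose_spec.choose_spec.choose_spec.2, ?_⟩
  rw [lowTets, dif_neg ht]

/-- The vertex sets of the tetrahedra of the triangulation associated with the Farey triangle
`t`. -/
def fareyTets (o : ℂ) (per : ℤ × ℤ →+ ℂ) (t₀ t : FareyTriangle) : Set (Finset (OnePoint ℂ)) :=
  {s | ∃ x y, ∃ h : IsUnimodular x y, t = fareyTri x y h ∧ s ∈ cuspTets o per x y} ∪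
    lowTets o per t₀ t

theorem fareyTets_fareyTri (o : ℂ) (per : ℤ × ℤ →+ ℂ) {x y : ℤ × ℤ} (h : IsUnimodular x y) :
    fareyTets o per t₀ (fareyTri x y h) =
      cuspTets o per x y ∪ lowTets o per t₀ (fareyTri x y h) := by
  rw [fareyTets]
  congr 1
  ext s
  constructor
  · rintro ⟨x', y', h', he, hs⟩
    rwa [cuspTets_eq_of_fareyTri_eq h h' he.symm] at hs
  · exact fun hs => ⟨x, y, h, rfl, hs⟩

theorem infty_notMem_of_mem_lowTets {o : ℂ} {per : ℤ × ℤ →+ ℂ} (t : FareyTriangle) :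
    ∀ s ∈ lowTets o per t₀ t, OnePoint.infty ∉ s := by
  induction hn : fareyHeight t₀ t using Nat.strong_induction_on generalizing t with
  | _ n ih =>
    subst hn
    intro s hs
    by_cases ht : t = t₀
    · rw [ht, lowTets_root] at hs; exact absurd hs (notMem_empty s)
    · obtain ⟨x, y, h, -, hlt, he⟩ := exists_lowTets o per ht
      rw [he] at hs
      rcases hs with ⟨k, rfl⟩ | hs
      · simp
      · exact ih _ hlt _ rfl s hs

theorem isDecomposition_fareyTets {o : ℂ} {per : ℤ × ℤ →+ ℂ} (hper : Function.Injective per)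
    {R : Set H3} {e f : ℤ × ℤ} (h : IsUnimodular e f)
    (h1 : 0 < cdot (per f) (per f - per e)) (h2 : 0 < cdot (per e) (per e - per f))
    (h3 : 0 < cdot (per e) (per f)) (hD : IsDecomposition per R (cuspTets o per e f))
    (t : FareyTriangle) : IsDecomposition per R (fareyTets o per (fareyTri e f h) t) := by
  induction hn : fareyHeight (fareyTri e f h) t using Nat.strong_induction_on generalizing t with
  | _ n ih =>
    subst hn
    by_cases ht : t = fareyTri e f h
    · rw [ht, fareyTets_fareyTri, lowTets_root, union_empty]
      exact hD
    · obtain ⟨x, y, hxy, rfl, hlt, he⟩ := exists_lowTets o per ht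
      have hpos := cdot_pos_of_rootForm_pos per h h1 h2 h3 hxy ((fareyHeight_lt_iff hxy).1 hlt)
      have ih := ih _ hlt _ rfl
      rw [fareyTets_fareyTri] at ih
      rw [fareyTets_fareyTri, he, ← union_assoc]
      exact ih.flip hper hxy hpos (infty_notMem_of_mem_lowTets _)

/-! ### Acute triangles -/

/-- The dihedral angle at the vertical edge over `b` is the angle at `b` of the triangle `bcd`. -/
theorem cdot_pos_of_dihedralAngle_lt {b c d : ℂ} (hc : c ≠ b) (hd : d ≠ b)
    (h : dihedralAngle OnePoint.infty b c d < Real.pi / 2) : 0 < cdot (c - b) (d - b) := by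
  have hcr : crossRatio OnePoint.infty b c d = (c - b) / (d - b) := by
    have h1 : bracket (c : OnePoint ℂ) b = c - b := by
      change c * 1 - b * 1 = _; ring
    have h2 : bracket (d : OnePoint ℂ) b = d - b := by
      change d * 1 - b * 1 = _; ring
    have h3 : bracket (c : OnePoint ℂ) OnePoint.infty = -1 := by
      change c * 0 - 1 * 1 = _; ring
    have h4 : bracket (d : OnePoint ℂ) OnePoint.infty = -1 := by
      change d * 0 - 1 * 1 = _; ring
    rw [crossRatio, h1, h2, h3, h4, mul_comm, mul_div_mul_left _ _ (by norm_num)]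
  have hd' : d - b ≠ 0 := sub_ne_zero.2 hd
  rw [dihedralAngle, hcr, Complex.abs_arg_lt_pi_div_two_iff,
    or_iff_left (div_ne_zero (sub_ne_zero.2 hc) hd'), Complex.div_re, ← add_div,
    div_pos_iff_of_pos_right (Complex.normSq_pos.2 hd')] at h
  exact h

/-! ### The root triangulation -/

section Root

variable {o : ℂ} {per : ℤ × ℤ →+ ℂ} {x y : ℤ × ℤ}

/-- The two descriptions of the cones over the standard triangulation agree. -/
theorem exists_cone_eq (s : Finset (OnePoint ℂ)) : s ∈ cuspTets o per x y ↔ ∃ k Δ,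
    (Δ = {o + per k, o + per (k + x), o + per (k + y)} ∨
      Δ = {o + per (k + x), o + per (k + y), o + per (k + x + y)}) ∧ s = cone Δ := by
  have e1 : ∀ a b c : ℂ, cone {a, b, c} = {OnePoint.infty, ↑a, ↑b, ↑c} := fun a b c => by
    simp [cone, Finset.image_insert]
  have e2 : ∀ a b c : ℂ, cone {a, b, c} = {OnePoint.infty, ↑c, ↑a, ↑b} := fun a b c => by
    rw [e1]; ext; simp; tauto
  constructor
  · rintro ⟨k, rfl | rfl⟩
    · exact ⟨k, _, Or.inl rfl, (e1 _ _ _).symm⟩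
    · exact ⟨k, _, Or.inr rfl, (e2 _ _ _).symm⟩
  · rintro ⟨k, Δ, rfl | rfl, rfl⟩
    · exact ⟨k, Or.inl (e1 _ _ _)⟩
    · exact ⟨k, Or.inr (e2 _ _ _)⟩

end Root

namespace DrilledAnanas.GeometricTriangulation

variable {N : DrilledAnanas} {𝒯 : N.GeometricTriangulation}

/-- A triangulation with two tetrahedra consists of the cones from `∞` over a standard
triangulation of the plane. -/
theorem exists_cuspTets (h_two : 𝒯.HasTwoTetrahedra) : N.IsEmbedded ∧
    ∃ (o : ℂ) (x y : ℤ × ℤ), IsUnimodular x y ∧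
      IsDecomposition N.period (range N.dev) (cuspTets o N.period x y) ∧
      ∀ σ, σ ∈ 𝒯.tets ↔ ∃ s ∈ cuspTets o N.period x y, σ = N.dev ⁻¹' idealHull s := by
  obtain ⟨o, x, y, hxy, hmem, htet, hinj, hsec, hup, hdown⟩ := structure_of_two h_two
  have E : N.IsEmbedded := ⟨hinj, hsec, hup, hdown⟩
  have htet' : ∀ s ∈ cuspTets o N.period x y, N.IsTet (N.dev ⁻¹' idealHull s) s := by
    intro s hs
    obtain ⟨k, Δ, hΔ, rfl⟩ := (exists_cone_eq s).1 hs
    exact htet Δ k hΔ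
  have hmem' : ∀ σ, σ ∈ 𝒯.tets ↔ ∃ s ∈ cuspTets o N.period x y, σ = N.dev ⁻¹' idealHull s := by
    intro σ
    rw [hmem]
    constructor
    · rintro ⟨k, Δ, hΔ, h⟩
      exact ⟨cone Δ, (exists_cone_eq _).2 ⟨k, Δ, hΔ, rfl⟩, E.eq_preimage h⟩
    · rintro ⟨s, hs, rfl⟩
      obtain ⟨k, Δ, hΔ, rfl⟩ := (exists_cone_eq s).1 hs
      exact ⟨k, Δ, hΔ, htet Δ k hΔ⟩
  have hR : ∀ s ∈ cuspTets o N.period x y, idealHull s ⊆ range N.dev := fun s hs => by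
    rw [← (htet' s hs).dev_image]
    exact image_subset_range _ _
  refine ⟨E, o, x, y, hxy, ⟨fun s hs => (htet' s hs).1, fun s hs m => shiftSet_mem_cuspTets hs m,
    finite_cuspTets o N.period x y, ?_, ?_⟩, hmem'⟩
  · intro s hs s' hs' c c' z hc hc'
    obtain ⟨p, rfl⟩ := hR s hs (mem_idealHull.2 ⟨c, hc⟩)
    exact rep_unique ((hmem' _).2 ⟨s, hs, rfl⟩) ((hmem' _).2 ⟨s', hs', rfl⟩) (htet' s hs)
      (htet' s' hs') (mem_idealHull.2 ⟨c, hc⟩) (mem_idealHull.2 ⟨c', hc'⟩) hc hc'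
  · intro z
    constructor
    · rintro ⟨p, rfl⟩
      obtain ⟨σ, hσ, hp⟩ := mem_sUnion.1 (𝒯.covers.symm.subset (mem_univ p))
      obtain ⟨s, hs, rfl⟩ := (hmem' σ).1 hσ
      exact ⟨s, hs, hp⟩
    · rintro ⟨s, hs, hz⟩
      exact hR s hs hz

end DrilledAnanas.GeometricTriangulation

/-- The dihedral angles at the vertical edges of a cone are the angles of its base. -/
theorem cdot_pos_of_isAcute {N : DrilledAnanas} {𝒯 : N.GeometricTriangulation}
    (h_acute : 𝒯.IsAcute) {o : ℂ} {x y : ℤ × ℤ} (h : IsUnimodular x y)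
    (ht : N.IsTet (N.dev ⁻¹' idealHull {OnePoint.infty, latticePoint o N.period 0,
      latticePoint o N.period x, latticePoint o N.period y})
      {OnePoint.infty, latticePoint o N.period 0, latticePoint o N.period x,
        latticePoint o N.period y})
    (hmem : N.dev ⁻¹' idealHull {OnePoint.infty, latticePoint o N.period 0,
      latticePoint o N.period x, latticePoint o N.period y} ∈ 𝒯.tets) :
    0 < cdot (N.period y) (N.period y - N.period x) ∧
      0 < cdot (N.period x) (N.period x - N.period y) ∧ 0 < cdot (N.period x) (N.period y) := by
  have hper := period_injective N.period_indep
  have key : ∀ i j k : ℤ × ℤ, j ≠ i → k ≠ i →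
      ({OnePoint.infty, latticePoint o N.period i, latticePoint o N.period j,
        latticePoint o N.period k} : Finset (OnePoint ℂ)) = {OnePoint.infty,
          latticePoint o N.period 0, latticePoint o N.period x, latticePoint o N.period y} →
      0 < cdot (N.period j - N.period i) (N.period k - N.period i) := by
    intro i j k hj hk he
    have := h_acute _ hmem OnePoint.infty (latticePoint o N.period i) (latticePoint o N.period j)
      (latticePoint o N.period k) (by rw [he]; exact ht)
    have := cdot_pos_of_dihedralAngle_lt (fun e => hj (hper (add_left_cancel e)))
      (fun e => hk (hper (add_left_cancel e))) this
    rwa [add_sub_add_left_eq_sub, add_sub_add_left_eq_sub] at this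
  have hx := h.left_ne_zero
  have hy := h.symm.left_ne_zero
  have hxy := h.ne
  have k1 := key y 0 x hy.symm hxy (by ext; simp; tauto)
  have k2 := key x 0 y hx.symm hxy.symm (by ext; simp; tauto)
  have k3 := key 0 x y hx hy rfl
  simp only [cdot, map_zero, zero_sub, sub_zero, Complex.sub_re, Complex.sub_im, Complex.neg_re,
    Complex.neg_im] at *
  refine ⟨?_, ?_, ?_⟩ <;> linarith

end Ananas

end

open Ananas

theorem proposition3p7 (N : Ananas.DrilledAnanas) (𝒯₀ : N.GeometricTriangulation)
    (h_two : 𝒯₀.HasTwoTetrahedra) (h_acute : 𝒯₀.IsAcute) :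
    ∃ (V : Set N.GeometricTriangulation) (G : SimpleGraph V) (root : V)
      (Φ : G ≃g Ananas.fareyDual),
      (root : N.GeometricTriangulation) = 𝒯₀ ∧
      Infinite V ∧ G.IsTree ∧ (∀ v : V, (G.neighborSet v).encard = 3) ∧
      (∀ v w : V, G.Adj v w → G.dist root v < G.dist root w →
        (v : N.GeometricTriangulation).IsTwoThreeMove w) ∧
      (∀ v : V, (v : N.GeometricTriangulation).InducesCuspTriangulation (Φ v)) := by
  obtain ⟨E, o, e, f, hef, hD, htets⟩ :=
    DrilledAnanas.GeometricTriangulation.exists_cuspTets h_two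
  have hper := period_injective N.period_indep
  set t₀ := fareyTri e f hef with ht₀
  have hs₀ : ({OnePoint.infty, latticePoint o N.period 0, latticePoint o N.period e,
      latticePoint o N.period f} : Finset (OnePoint ℂ)) ∈ cuspTets o N.period e f :=
    ⟨0, Or.inl (by rw [zero_add, zero_add])⟩
  obtain ⟨h1, h2, h3⟩ := cdot_pos_of_isAcute h_acute hef (E.isTet_of_mem hD hs₀)
    ((htets _).2 ⟨_, hs₀, rfl⟩)
  have hDt := isDecomposition_fareyTets hper hef h1 h2 h3 hD
  let T : FareyTriangle → N.GeometricTriangulation := fun t => E.triangulation (hDt t)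
  have hcusp : ∀ t, (T t).InducesCuspTriangulation t := by
    intro t
    obtain ⟨r, hr⟩ : t.1.Nonempty := by rw [← Finset.card_pos, card_fareyTriangle]; norm_num
    obtain ⟨x, y, h, rfl, -⟩ := exists_fareyTri t hr
    have he := fareyTets_fareyTri (t₀ := t₀) o N.period h
    have key : ∀ 𝒮 (h𝒮 : IsDecomposition N.period (range N.dev) 𝒮),
        𝒮 = cuspTets o N.period x y ∪ lowTets o N.period t₀ (fareyTri x y h) →
        (E.triangulation h𝒮).InducesCuspTriangulation (fareyTri x y h) := by
      rintro _ h𝒮 rfl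
      exact E.inducesCuspTriangulation h (infty_notMem_of_mem_lowTets _) h𝒮
    exact key _ _ he
  -- The slopes of the cusp cellulation determine the Farey triangle.
  have hinj : Function.Injective T := fun t t' he => by
    have h1 := (hcusp t).2.2
    rw [he, (hcusp t').2.2] at h1
    exact Subtype.ext (Finset.coe_injective h1.symm)
  have hmove : ∀ t t', fareyDual.Adj t t' → fareyHeight t₀ t < fareyHeight t₀ t' →
      (T t).IsTwoThreeMove (T t') := by
    intro t t' hadj hlt
    have ht' : t' ≠ t₀ := by
      rintro rfl
      exact (fareyHeight_root_le t).not_gt hlt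
    obtain ⟨x, y, h, rfl, hlt', he⟩ := exists_lowTets o N.period ht'
    obtain rfl : t = fareyTri x y h := lower_neighbour_unique _ _ _ hadj.symm
      (fareyDual_adj_neg h).symm hlt hlt'
    have hpos := cdot_pos_of_rootForm_pos N.period hef h1 h2 h3 h ((fareyHeight_lt_iff h).1 hlt)
    have key : ∀ 𝒮 𝒮' (h𝒮 : IsDecomposition N.period (range N.dev) 𝒮)
        (h𝒮' : IsDecomposition N.period (range N.dev) 𝒮'),
        𝒮 = cuspTets o N.period x y ∪ lowTets o N.period t₀ (fareyTri x y h) →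
        𝒮' = cuspTets o N.period x (-y) ∪ flatTets o N.period x y ∪
          lowTets o N.period t₀ (fareyTri x y h) →
        (E.triangulation h𝒮).IsTwoThreeMove (E.triangulation h𝒮') := by
      rintro _ _ h𝒮 h𝒮' rfl rfl
      exact E.isTwoThreeMove h hpos (infty_notMem_of_mem_lowTets _) h𝒮 h𝒮'
    exact key _ _ _ _ (fareyTets_fareyTri o N.period h)
      (by rw [fareyTets_fareyTri, he, union_assoc])
  have hroot : T t₀ = 𝒯₀ := by
    ext σ
    rw [htets, DrilledAnanas.IsEmbedded.mem_tets, ht₀, fareyTets_fareyTri, lowTets_root,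
      union_empty]
  let Ψ : FareyTriangle ≃ range T := Equiv.ofInjective T hinj
  have hΨ : ∀ v : range T, T (Ψ.symm v) = v := fun v => Equiv.apply_ofInjective_symm hinj v
  let Φ : fareyDual.comap Ψ.symm ≃g fareyDual := SimpleGraph.Iso.comap Ψ.symm fareyDual
  have hΦ : ∀ v, Φ v = Ψ.symm v := fun _ => rfl
  have hinf := infinite_fareyTriangle t₀
  refine ⟨range T, fareyDual.comap Ψ.symm, Ψ t₀, Φ, hroot, Infinite.of_injective Ψ Ψ.injective,
    Φ.isTree_iff.2 (isTree_fareyDual t₀), fun v => ?_, fun v w hvw hd => ?_, fun v => ?_⟩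
  · rw [← encard_neighborSet (Ψ.symm v)]
    exact Set.encard_congr (Φ.mapNeighborSet v)
  · have hlt := height_lt_of_dist_lt (h := fun v => fareyHeight t₀ (Ψ.symm v)) (root := Ψ t₀)
      (fun v w hvw => fareyHeight_ne _ _ hvw) (fun v hv => ?_)
      (fun v w w' hw hw' hl hl' => Ψ.symm.injective (lower_neighbour_unique _ _ _ hw hw' hl hl'))
      hvw hd
    · have := hmove _ _ hvw hlt
      rwa [hΨ, hΨ] at this
    · obtain ⟨u, hu, hlt⟩ := exists_lower_neighbour (t₀ := t₀) (Ψ.symm v) (fun e => hv (by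
        rw [← e, Equiv.apply_symm_apply]))
      refine ⟨Ψ u, ?_, ?_⟩
      · rw [SimpleGraph.comap_adj, Equiv.symm_apply_apply]; exact hu
      · rw [Equiv.symm_apply_apply]; exact hlt
  · have := hcusp (Ψ.symm v)
    rwa [hΨ] at this
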